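/- **Model.** Two players $i\in\{1,2\}$ play in periods $t=1,2,\dots$. A state $\theta\in\{H,L\}$ is drawn once, with $\mathbb P(\theta=H)=p_0\in(0,1)$. In each period $t$ each player $i$ first receives a private signal $x_{it}$ in a finite set $X$ and then chooses $a_{it}\in\{I,N\}$; past action profiles are publicly observed. Given $\theta$, the signals are independent across players and periods with law $f_\theta$, where $f_H\ne f_L$ and $f_\theta(x)>0$ for all $\theta,x$. The stage payoff $u_i(a,\theta)$ is $0$ if $a_i=N$; it is $1-c$ if $\theta=H$ and $a=(I,I)$, and $-c$ in all other cases with $a_i=I$, where $c\in(0,1)$. A pure strategy maps each private history $(a^{t-1},x_i^t)$ (past action profiles $a^{t-1}=(a_1,\dots,a_{t-1})$ and own signals $x_i^t=(x_{i1},\dots,x_{it})$) to an action. A mixed strategy $\sigma_i$ is a Borel probability measure on the set of pure strategies with the product topology. Payoffs are $\mathbb E_\sigma\big[\sum_{t\ge1}(1-\delta)\delta^{t-1}u_i(a_t,\theta)\big]$ with $\delta\in(0,1)$, and an equilibrium is a mixed-strategy Nash equilibrium of this game. A player's payoff in state $\theta$ is the same expectation conditional on $\theta$. **Cool-off strategies.**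 A function $T:\mathbb N\to\mathbb N$ splits the action histories into cool-off and investment histories. The empty history is a cool-off history. For $t\ge1$: if $a^{t-1}$ is an investment history, then $a^t$ is one iff $a_t=(I,I)$. If $a^{t-1}$ is a cool-off history and $a^{s-1}$ is its longest investment subhistory, then $a^t$ is an investment history iff $t>s+T(s)-1$; if it has no investment subhistory, then $a^t$ is one iff $t>T(1)$. A violation along $a^{t-1}$ is a choice of $I$ by some player in a period $\tau<t$ such that $a^{\tau-1}$ is a cool-off history. Let $S(T)$ be the set of pure strategies that play $N$ at every cool-off history and at every history with a violation. A private history $(a^{t-1},x_i^t)$ is consistent with a pure strategy $s_i$ of player $i$ if $s_i(a^{\tau-1},x_i^\tau)=a_{i\tau}$ for all $\tau<t$. An action history $a^{t-1}$ is consistent with $\sigma_i$ if, for some $x_i^t\in X^t$, $(a^{t-1},x_i^t)$ is consistent with some $s_i$ in the support of $\sigma_i$. In that case let $$\sigma_i(a^{t-1})(I\mid H)=\frac{\sum_{x_i^t\in X^t}f_H(x_i^t)\prod_{\tau<t}\sigma_i(a^{\tau-1},x_i^\tau)(a_{i\tau})\;\sigma_i(a^{t-1},x_i^t)(I)}{\sum_{x_i^t\in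 X^t}f_H(x_i^t)\prod_{\tau<t}\sigma_i(a^{\tau-1},x_i^\tau)(a_{i\tau})},$$ where $f_H(x_i^t)=\prod_{\tau\le t}f_H(x_{i\tau})$ and $\sigma_i(h)(b)$ is the $\sigma_i$-probability that $s_i(h)=b$ conditional on $s_i$ being consistent with the private history $h$. This is the probability that player $i$ invests at $a^{t-1}$ in state $H$. For $\varepsilon>0$, let $\Sigma_i(T,\varepsilon)$ be the set of mixed strategies $\sigma_i$ whose support is contained in $S(T)$ and such that $\sigma_i(a^{t-1})(I\mid H)\ge1-\varepsilon$ for every investment history $a^{t-1}$ that is consistent with $\sigma_i$ and contains no violation. Put $\mathcal S(T,\varepsilon)=\Sigma_1(T,\varepsilon)\times\Sigma_2(T,\varepsilon)$. **Theorem (Payoff Efficiency).** Fix $X,f_H,f_L,p_0$ as above and $c\in(0,1)$. For every $\Delta>0$ there exists $\bar\delta\in(0,1)$ such that for every $\delta\in[\bar\delta,1)$ there exist a cool-off function $T:\mathbb N\to\mathbb N$ and a constant $\varepsilon>0$ with the following properties: the game has an equilibrium in $\mathcal S(T,\varepsilon)$, and in every equilibrium $\sigma^*\in\mathcal S(T,\varepsilon)$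 both players obtain a payoff of at least $1-c-\Delta$ in state $\theta=H$ and a payoff of at least $-\Delta$ in state $\theta=L$. -/

import Mathlib

open MeasureTheory

namespace InvestmentGame

/-- The two states of nature. -/
inductive State
  | H
  | L
  deriving DecidableEq

/-- The two actions: invest and not invest. -/
inductive Act
  | I
  | N
  deriving DecidableEq

instance : Fintype Act := ⟨{Act.I, Act.N}, fun a => by cases a <;> simp⟩

instance : MeasurableSpace State := ⊤
instance : MeasurableSpace Act := ⊤
instance : DiscreteMeasurableSpace Act := ⟨fun _ => trivial⟩
instance : TopologicalSpace Act := ⊥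
instance : DiscreteTopology Act := ⟨rfl⟩
instance : BorelSpace Act := ⟨borel_eq_top_of_discrete.symm⟩

/-- Action profiles; the two players are the elements of `Fin 2`. -/
abbrev Profile := Fin 2 → Act

/-- The opponent of player `i`. -/
def opp (i : Fin 2) : Fin 2 := 1 - i

/-- Stage payoff of player `i`: not investing gives `0`; investing costs `c` and yields `1` exactly
when the state is `H` and the opponent invests too. -/
noncomputable def stagePayoff (c : ℝ) (θ : State) (a : Profile) (i : Fin 2) : ℝ :=
  match a i with
  | Act.N => 0
  | Act.I => (if θ = State.H ∧ a (opp i) = Act.I then 1 else 0) - c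

/-! ### Strategies

An action history `a : Fin n → Profile` lists the profiles of periods `1, …, n` (entry `k` belongs
to period `k + 1`).  At period `n + 1` a player knows such an `a` and his own `n + 1` signals. -/

/-- Pure strategies, with the product topology and its Borel `σ`-algebra (which is the product
`σ`-algebra, see `borelSpace_pureStrategy`). -/
abbrev PureStrategy (X : Type*) := (n : ℕ) → (Fin n → Profile) → (Fin (n + 1) → X) → Act

theorem borelSpace_pureStrategy (X : Type*) [Finite X] : BorelSpace (PureStrategy X) :=
  by
    have h1 : ∀ n, BorelSpace ((Fin (n + 1) → X) → Act) := fun n => Pi.borelSpace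
    have h2 : ∀ n, BorelSpace ((Fin n → Profile) → (Fin (n + 1) → X) → Act) := fun n => Pi.borelSpace
    exact Pi.borelSpace

/-- Mixed strategies are Borel probability measures on pure strategies. -/
abbrev MixedStrategy (X : Type*) := ProbabilityMeasure (PureStrategy X)

/-! ### Play and payoffs -/

section Play

variable {X : Type*}

/-- The action history of length `n` produced by the pure strategies `s` when player `i` receives
the signal `x k i` in period `k + 1`. -/
def hist (s : Fin 2 → PureStrategy X) (x : ℕ → Fin 2 → X) : (n : ℕ) → Fin n → Profile
  | 0 => Fin.elim0
  | n + 1 => Fin.snoc (α := fun _ => Profile) (hist s x n)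
      (fun i => s i n (hist s x n) (fun k => x k i))

/-- The infinite action path produced by pure strategies and signals
(entry `n` is the profile of period `n + 1`). -/
def path (s : Fin 2 → PureStrategy X) (x : ℕ → Fin 2 → X) (n : ℕ) : Profile :=
  fun i => s i n (hist s x n) (fun k => x k i)

section Measurability

variable [Finite X] [MeasurableSpace X] [MeasurableSingletonClass X]

theorem measurable_act {n : ℕ} (i : Fin 2)
    (h : Measurable fun p : (Fin 2 → PureStrategy X) × (ℕ → Fin 2 → X) => hist p.1 p.2 n) :
    Measurable fun p : (Fin 2 → PureStrategy X) × (ℕ → Fin 2 → X) =>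
      p.1 i n (hist p.1 p.2 n) (fun k => p.2 k i) := by
  have h1 : Measurable fun q : (PureStrategy X) × ((Fin n → Profile) × (Fin (n + 1) → X)) =>
      q.1 n q.2.1 q.2.2 := by
    refine measurable_from_prod_countable_left fun y => ?_
    exact (measurable_pi_apply y.2).comp ((measurable_pi_apply y.1).comp (measurable_pi_apply n))
  have h2 : Measurable fun p : (Fin 2 → PureStrategy X) × (ℕ → Fin 2 → X) =>
      (p.1 i, (hist p.1 p.2 n, fun k : Fin (n + 1) => p.2 k i)) := by
    fun_prop
  exact h1.comp h2

theorem measurable_hist (n : ℕ) : Measurable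
    fun p : (Fin 2 → PureStrategy X) × (ℕ → Fin 2 → X) => hist p.1 p.2 n := by
  induction n with
  | zero => exact measurable_const
  | succ n ih =>
    refine measurable_pi_lambda _ fun k => ?_
    refine Fin.lastCases ?_ (fun k => ?_) k
    · simp only [hist, Fin.snoc_last]
      exact measurable_pi_lambda _ fun i => measurable_act i ih
    · simp only [hist, Fin.snoc_castSucc]
      exact (measurable_pi_apply k).comp ih

theorem measurable_path : Measurable
    fun p : (Fin 2 → PureStrategy X) × (ℕ → Fin 2 → X) => path p.1 p.2 :=
  measurable_pi_lambda _ fun n => measurable_pi_lambda _ fun i =>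
    measurable_act i (measurable_hist n)

end Measurability

/-- Outcomes: the state, the signals and the actions of all periods. -/
abbrev Outcome (X : Type*) := State × (ℕ → Fin 2 → X) × (ℕ → Profile)

/-- Normalised discounted payoff of player `i` along an outcome. -/
noncomputable def longRunPayoff (c δ : ℝ) (i : Fin 2) (ω : Outcome X) : ℝ :=
  ∑' t : ℕ, (1 - δ) * δ ^ t * stagePayoff c ω.1 (ω.2.2 t) i

variable [MeasurableSpace X]

/-- Law of the signals in state `θ`: independent across players and periods, with law `f θ`. -/
noncomputable def signalLaw (f : State → PMF X) (θ : State) : Measure (ℕ → Fin 2 → X) :=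
  Measure.infinitePi fun _ : ℕ => Measure.pi fun _ : Fin 2 => (f θ).toMeasure

/-- The law of the outcome conditional on the state `θ` under the mixed profile `σ`: the players
draw pure strategies independently of each other and of the signals. -/
noncomputable def outcomeLawGiven (f : State → PMF X) (σ : Fin 2 → MixedStrategy X) (θ : State) :
    Measure (Outcome X) :=
  ((Measure.pi fun i => (σ i : Measure (PureStrategy X))).prod (signalLaw f θ)).map
    fun p => (θ, p.2, path p.1 p.2)

/-- The law of the outcome under the mixed profile `σ`, when `H` has prior probability `p₀`. -/
noncomputable def outcomeLaw (p₀ : ℝ) (f : State → PMF X) (σ : Fin 2 → MixedStrategy X) :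
    Measure (Outcome X) :=
  ENNReal.ofReal p₀ • outcomeLawGiven f σ State.H +
    ENNReal.ofReal (1 - p₀) • outcomeLawGiven f σ State.L

/-- Long-run expected payoff of player `i`. -/
noncomputable def payoff (p₀ : ℝ) (f : State → PMF X) (c δ : ℝ) (σ : Fin 2 → MixedStrategy X)
    (i : Fin 2) : ℝ :=
  ∫ ω, longRunPayoff c δ i ω ∂(outcomeLaw p₀ f σ)

/-- Long-run expected payoff of player `i` in (conditional on) the state `θ`. -/
noncomputable def payoffInState (f : State → PMF X) (c δ : ℝ) (σ : Fin 2 → MixedStrategy X)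
    (θ : State) (i : Fin 2) : ℝ :=
  ∫ ω, longRunPayoff c δ i ω ∂(outcomeLawGiven f σ θ)

/-- Nash equilibrium of the (unrestricted) repeated game, in mixed strategies. -/
def IsNash (p₀ : ℝ) (f : State → PMF X) (c δ : ℝ) (σ : Fin 2 → MixedStrategy X) : Prop :=
  ∀ (i : Fin 2) (τ : MixedStrategy X),
    payoff p₀ f c δ (Function.update σ i τ) i ≤ payoff p₀ f c δ σ i

end Play

/-! ### The cool-off scheme -/

/-- The length of the longest subhistory of `a` (possibly `a` itself) that is an investment history,
if there is one.  Extending a history `a^n` to `a^(n+1)`: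
* if no subhistory of `a^n` is an investment history, `a^(n+1)` is one iff `n + 1 > T 1`;
* if `a^n` itself is an investment history, `a^(n+1)` is one iff its last profile is `(I, I)`;
* if the longest investment subhistory `a^(s-1)` of `a^n` is a proper one, with `m = s - 1`, then
  `a^(n+1)` is one iff `n + 1 > s + T s - 1`. -/
def lastInvestment (T : ℕ → ℕ) : (n : ℕ) → (Fin n → Profile) → Option ℕ
  | 0, _ => none
  | n + 1, a =>
    match lastInvestment T n (Fin.init a) with
    | none => if n + 1 ≤ T 1 then none else some (n + 1)
    | some m =>
      if m = n then
        if a (Fin.last n) = fun _ => Act.I then some (n + 1) else some m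
      else
        if n + 1 ≤ (m + 1) + T (m + 1) - 1 then some m else some (n + 1)

/-- The set of investment histories induced by the cool-off function `T`. -/
def IsInvestment (T : ℕ → ℕ) {n : ℕ} (a : Fin n → Profile) : Prop :=
  lastInvestment T n a = some n

/-- The set of cool-off histories is the complement. -/
def IsCoolOff (T : ℕ → ℕ) {n : ℕ} (a : Fin n → Profile) : Prop :=
  ¬ IsInvestment T a

/-! The next facts check that `IsInvestment` satisfies the recursive clauses of a cool-off scheme. -/

/-- `lastInvestment` is the length of the longest investment subhistory. -/
theorem lastInvestment_spec (T : ℕ → ℕ) : ∀ (n : ℕ) (a : Fin n → Profile),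
    (∀ m, lastInvestment T n a = some m → ∃ h : m ≤ n, IsInvestment T (Fin.take m h a)) ∧
    ∀ k (h : k ≤ n), IsInvestment T (Fin.take k h a) →
      ∃ m, lastInvestment T n a = some m ∧ k ≤ m := by
  intro n
  induction n with
  | zero =>
    intro a
    refine ⟨by simp [lastInvestment], ?_⟩
    intro k h hk
    obtain rfl : k = 0 := by omega
    simp [IsInvestment, lastInvestment] at hk
  | succ n ih =>
    intro a
    obtain ⟨ih1, ih2⟩ := ih (Fin.init a)
    have key : ∀ k (h : k ≤ n), Fin.take k (h.trans n.le_succ) a = Fin.take k h (Fin.init a) :=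
      fun k h => rfl
    have hself : ∀ h : n + 1 ≤ n + 1, Fin.take (n + 1) h a = a := fun h => rfl
    have hval : ∀ m, lastInvestment T (n + 1) a = some m →
        m = n + 1 ∨ lastInvestment T n (Fin.init a) = some m := by
      intro m hm
      simp only [lastInvestment] at hm
      cases hl : lastInvestment T n (Fin.init a) <;> simp only [hl] at hm <;>
        split_ifs at hm <;>
        first
          | exact Or.inr hm
          | exact Or.inl (Option.some.inj hm).symm
    have hval2 : ∀ m, lastInvestment T n (Fin.init a) = some m →
        lastInvestment T (n + 1) a = some m ∨ lastInvestment T (n + 1) a = some (n + 1) := by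
      intro m hm
      simp only [lastInvestment, hm]
      split_ifs <;> simp
    constructor
    · intro m hm
      rcases hval m hm with rfl | h
      · exact ⟨le_rfl, hm⟩
      · obtain ⟨h', h2⟩ := ih1 m h
        exact ⟨h'.trans n.le_succ, h2⟩
    · intro k h hk
      rcases Nat.lt_or_ge n k with hlt | hle
      · obtain rfl : k = n + 1 := by omega
        exact ⟨n + 1, hk, le_rfl⟩
      · obtain ⟨m, hm, hkm⟩ := ih2 k hle hk
        rcases hval2 m hm with h | h
        · exact ⟨m, h, hkm⟩
        · exact ⟨n + 1, h, by omega⟩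

/-- The empty history is a cool-off history. -/
theorem isCoolOff_zero (T : ℕ → ℕ) (a : Fin 0 → Profile) : IsCoolOff T a := by
  simp [IsCoolOff, IsInvestment, lastInvestment]

/-- Extension of an investment history. -/
theorem isInvestment_succ_of_isInvestment (T : ℕ → ℕ) {n : ℕ} (a : Fin (n + 1) → Profile)
    (h : IsInvestment T (Fin.init a)) :
    IsInvestment T a ↔ a (Fin.last n) = fun _ => Act.I := by
  have h' : lastInvestment T n (Fin.init a) = some n := h
  simp only [IsInvestment, lastInvestment, h']
  split_ifs <;> simp_all

/-- Extension of a cool-off history whose longest investment subhistory has length `m = s - 1`. -/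
theorem isInvestment_succ_of_longest (T : ℕ → ℕ) {n m : ℕ} (a : Fin (n + 1) → Profile)
    (hC : IsCoolOff T (Fin.init a)) (hmn : m ≤ n)
    (hm : IsInvestment T (Fin.take m hmn (Fin.init a)))
    (hmax : ∀ k (hk : k ≤ n), IsInvestment T (Fin.take k hk (Fin.init a)) → k ≤ m) :
    IsInvestment T a ↔ n + 1 > (m + 1) + T (m + 1) - 1 := by
  obtain ⟨h1, h2⟩ := lastInvestment_spec T n (Fin.init a)
  obtain ⟨m', hm', hle⟩ := h2 m hmn hm
  obtain ⟨h3, h4⟩ := h1 m' hm'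
  obtain rfl : m = m' := le_antisymm hle (hmax m' h3 h4)
  have hne : m ≠ n := by
    intro hmn'
    exact hC (hmn' ▸ hm' : lastInvestment T n (Fin.init a) = some n)
  simp only [IsInvestment, lastInvestment, hm', if_neg hne]
  split_ifs <;> simp <;> omega

/-- Extension of a history without investment subhistories. -/
theorem isInvestment_succ_of_none (T : ℕ → ℕ) {n : ℕ} (a : Fin (n + 1) → Profile)
    (h : ∀ k (hk : k ≤ n), IsCoolOff T (Fin.take k hk (Fin.init a))) :
    IsInvestment T a ↔ n + 1 > T 1 := by
  have h' : lastInvestment T n (Fin.init a) = none := by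
    cases hl : lastInvestment T n (Fin.init a) with
    | none => rfl
    | some m =>
      obtain ⟨h1, h2⟩ := (lastInvestment_spec T n (Fin.init a)).1 m hl
      exact absurd h2 (h m h1)
  simp only [IsInvestment, lastInvestment, h']
  split_ifs <;> simp <;> omega

/-- Some player chose `I` during a cool-off phase along the action history `a`. -/
def HasViolation (T : ℕ → ℕ) {n : ℕ} (a : Fin n → Profile) : Prop :=
  ∃ (k : Fin n) (i : Fin 2), IsCoolOff T (Fin.take k k.is_lt.le a) ∧ a k i = Act.I

/-! ### Cool-off strategies -/

section Strategies

variable {X : Type*}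

/-- Pure strategies that implement the scheme of `T`: play `N` in cool-off phases, and play `N`
after any history along which some player chose `I` during a cool-off phase. -/
def pureCoolOff (X : Type*) (T : ℕ → ℕ) : Set (PureStrategy X) :=
  {s | (∀ (n : ℕ) (a : Fin n → Profile) (x : Fin (n + 1) → X), IsCoolOff T a → s n a x = Act.N) ∧
    ∀ (n : ℕ) (a : Fin n → Profile) (x : Fin (n + 1) → X), HasViolation T a → s n a x = Act.N}

/-- Mixed strategies whose support is contained in the previous set. -/
def mixedCoolOff (X : Type*) (T : ℕ → ℕ) : Set (MixedStrategy X) :=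
  {σ | (σ : Measure (PureStrategy X)).support ⊆ pureCoolOff X T}

/-- The private history `(a, x)` is consistent with the pure strategy `s` of player `i`. -/
def Consistent (i : Fin 2) {n : ℕ} (a : Fin n → Profile) (x : Fin (n + 1) → X)
    (s : PureStrategy X) : Prop :=
  ∀ k : Fin n, s k (Fin.take k k.is_lt.le a) (Fin.take (k + 1) (by omega) x) = a k i

/-- The action history `a` is consistent with the mixed strategy `σ` of player `i`: for some
signals (all of which have positive probability), the private history is consistent with some pure
strategy in the support of `σ`. -/
def ConsistentMixed (i : Fin 2) (σ : MixedStrategy X) {n : ℕ} (a : Fin n → Profile) : Prop :=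
  ∃ x : Fin (n + 1) → X, ∃ s ∈ (σ : Measure (PureStrategy X)).support, Consistent i a x s

/-- The probability that `σ` assigns to the action `b` at the private history `(a, x)`, conditional
on `σ` having drawn a pure strategy consistent with that history. -/
noncomputable def actionProb (i : Fin 2) (σ : MixedStrategy X) {n : ℕ} (a : Fin n → Profile)
    (x : Fin (n + 1) → X) (b : Act) : ℝ :=
  (σ : Measure (PureStrategy X)).real {s | Consistent i a x s ∧ s n a x = b} /
    (σ : Measure (PureStrategy X)).real {s | Consistent i a x s}

/-- Probability weight, in state `H`, of the signals `x` and of the own actions recorded in `a`. -/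
noncomputable def weightH (f : State → PMF X) (i : Fin 2) (σ : MixedStrategy X) {n : ℕ}
    (a : Fin n → Profile) (x : Fin (n + 1) → X) : ℝ :=
  (∏ k, (f State.H (x k)).toReal) *
    ∏ k : Fin n, actionProb i σ (Fin.take k k.is_lt.le a) (Fin.take (k + 1) (by omega) x) (a k i)

/-- The conditional probability of investing at the action history `a` in state `H`. -/
noncomputable def investProbH [Fintype X] (f : State → PMF X) (i : Fin 2) (σ : MixedStrategy X)
    {n : ℕ} (a : Fin n → Profile) : ℝ :=
  (∑ x : Fin (n + 1) → X, weightH f i σ a x * actionProb i σ a x Act.I) /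
    ∑ x : Fin (n + 1) → X, weightH f i σ a x

/-- Cool-off strategies of player `i`: at every investment history that is consistent with the
strategy and along which nobody invested during a cool-off phase, the player invests with
probability at least `1 - ε` in state `H`.  (After an investment during a cool-off phase,
`mixedCoolOff` prescribes `N` forever.) -/
def coolOffStrategies [Fintype X] (f : State → PMF X) (T : ℕ → ℕ) (ε : ℝ) (i : Fin 2) :
    Set (MixedStrategy X) :=
  {σ | σ ∈ mixedCoolOff X T ∧
    ∀ (n : ℕ) (a : Fin n → Profile), IsInvestment T a → ¬ HasViolation T a →
      ConsistentMixed i σ a → 1 - ε ≤ investProbH f i σ a}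

/-- Profiles of cool-off strategies. -/
def coolOffProfiles [Fintype X] (f : State → PMF X) (T : ℕ → ℕ) (ε : ℝ) :
    Set (Fin 2 → MixedStrategy X) :=
  {σ | ∀ i, σ i ∈ coolOffStrategies f T ε i}

end Strategies

end InvestmentGame

open InvestmentGame

/-! Fix γ < 1 with γ² > c and γ > ρ, where ρ = Σ √(f_H f_L) < 1 is the Bhattacharyya coefficient of
the signal laws (`affinity`), and let ε = 1 - γ².

Incentives. If a player declines to invest at an investment history, a cool-off phase follows that
is so long that everything after it is worth at most η times the current period. So investing once
and never again risks little beyond the current period, in which it earns at least γ² - c on average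
in state H. A best response that declines to invest must therefore hold a low belief in H
(`belief_le_of_not_invest`).

Learning. The opponent's actions cannot depress beliefs quickly: during a cool-off phase they reveal
nothing, and each joint investment moves the likelihood ratio of L to H by a factor of at most γ⁻²
(`reachProb_L_le`). A low belief after k - m joint investments thus forces γ^(k-m) w_H ≤ M √(w_H
w_L) for the weights w of the own signals, and √(w_H w_L) sums to ρ^l over l fresh signals. The
H-probability of ever failing to invest in a phase is then bounded by a geometric series in ρ/γ with
a factor ρ^(length of the cool-off phase) in front (`followsOwn_mul_le`). Long cool-off phases push
it below 1 - γ².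

Hence some best response to a cool-off strategy is again a cool-off strategy
(`IsAdmissible.exists_bestResponse`): investing during a cool-off phase is useless, since the
opponent then gives up, and behaviour at histories that the opponent never produces is
payoff-irrelevant and can be set to `I`.

Existence. After clearing denominators the defining conditions of cool-off strategies are linear in
the mixed strategy and involve clopen events only, so they cut out a closed convex set in a compact
space. The game restricted to this set has an equilibrium (`exists_restricted_equilibrium`),
obtained by compactness from approximate equilibria of bimatrix games. These are fixed points of a
logit map, and a fixed point theorem for C¹ maps suffices for them. By the preceding paragraph the
restricted equilibrium is an equilibrium of the full game.

Efficiency. The first cool-off length is fixed before δ, so its cost vanishes as δ → 1; only the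
later lengths depend on δ. In any equilibrium in cool-off strategies the opponent, who plays best
responses, invests throughout the first phase with high probability in H. A player can therefore
deviate to `cautious`, which invests along the first phase if the early signals favour H, and earn
almost p₀(1 - c) ex ante. As payoffs never exceed 1 - c in H and 0 in L, an ex-ante payoff close to
p₀(1 - c) forces near efficiency in each state. -/

namespace InvestmentGame

/-! ### A fixed point theorem -/

section FixedPoint

-- Lagrange interpolation at equally spaced nodes. It transports an identity for polynomials of
-- bounded degree from small parameters to the parameter 1 by a linear combination, which can be
-- applied under an integral sign.
open Polynomial in
theorem exists_interpolation_weights (n : ℕ) {T : ℝ} (hT : 0 < T) :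
    ∃ w τ : Fin (n + 1) → ℝ, (∀ k, τ k ∈ Set.Icc 0 T) ∧
      ∀ p : ℝ[X], p.natDegree ≤ n → p.eval 1 = ∑ k, w k * p.eval (τ k) := by
  let τ : Fin (n + 1) → ℝ := fun k => T * (k / (n + 1))
  have hτ : Function.Injective τ := by
    intro a b hab
    have h1 : (n + 1 : ℝ) ≠ 0 := by positivity
    simp only [τ] at hab
    field_simp at hab
    exact Fin.ext (by exact_mod_cast hab)
  refine ⟨fun k => (Lagrange.basis Finset.univ τ k).eval 1, τ, fun k => ?_, fun p hp => ?_⟩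
  · have hk : (k : ℝ) ≤ n + 1 := by exact_mod_cast k.is_lt.le
    have h2 : (k : ℝ) / (n + 1) ≤ 1 := by
      rw [div_le_one (by positivity)]; exact hk
    exact ⟨by positivity, by nlinarith⟩
  · have hdeg : p.degree < (Finset.univ : Finset (Fin (n + 1))).card := by
      refine lt_of_le_of_lt Polynomial.degree_le_natDegree ?_
      simpa using Nat.cast_lt.2 (Nat.lt_succ_of_le hp)
    conv_lhs => rw [Lagrange.eq_interpolate (s := Finset.univ) (v := τ) hτ.injOn hdeg]
    simp [Lagrange.interpolate_apply, Polynomial.eval_finsetSum, mul_comm]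

variable {E : Type*} [NormedAddCommGroup E] [InnerProductSpace ℝ E] [FiniteDimensional ℝ E]

open Polynomial in
theorem exists_polynomial_det (A : E →L[ℝ] E) :
    ∃ p : ℝ[X], p.natDegree ≤ Module.finrank ℝ E ∧
      ∀ t : ℝ, (ContinuousLinearMap.id ℝ E + t • A).det = p.eval t := by
  let b := Module.finBasis ℝ E
  let M := LinearMap.toMatrix b b (A : E →ₗ[ℝ] E)
  refine ⟨((X : ℝ[X]) • M.map C + (1 : Matrix _ _ ℝ).map C).det, ?_, fun t => ?_⟩
  · simpa using natDegree_det_X_add_C_le M 1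
  · rw [ContinuousLinearMap.det, ← LinearMap.det_toMatrix b, ← Polynomial.coe_evalRingHom,
      RingHom.map_det]
    congr 1
    ext i j
    simp [LinearMap.toMatrix_apply, M, Matrix.one_apply, Finsupp.single_apply,
      add_comm, eq_comm]
    split_ifs <;> simp [mul_comm]

/-- Along s ↦ 1 + sA the determinant starts at 1 and never vanishes on [0, 1], as these operators
are invertible by the Neumann series. So it cannot change sign. -/
theorem det_id_add_pos {A : E →L[ℝ] E} (hA : ‖A‖ < 1) :
    0 < (ContinuousLinearMap.id ℝ E + A).det := by
  obtain ⟨p, -, hp⟩ := exists_polynomial_det A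
  have hne : ∀ s ∈ Set.Icc (0 : ℝ) 1, p.eval s ≠ 0 := by
    intro s hs
    rw [← hp s]
    have hu : IsUnit (1 - (-(s • A))) := by
      apply isUnit_one_sub_of_norm_lt_one
      rw [norm_neg, norm_smul, Real.norm_of_nonneg hs.1]
      nlinarith [hs.2, norm_nonneg A]
    rw [sub_neg_eq_add] at hu
    have := hu.map (ContinuousLinearMap.toLinearMapRingHom (R₁ := ℝ) (M₁ := E))
    exact (this.map (LinearMap.det : (E →ₗ[ℝ] E) →* ℝ)).ne_zero
  have h1 := hp 1
  rw [one_smul] at h1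
  have h0 : p.eval 0 = 1 := by
    rw [← hp 0]
    simp [ContinuousLinearMap.det]
  rw [h1]
  by_contra hcon
  push Not at hcon
  obtain ⟨s, hs, hs0⟩ := intermediate_value_Icc' (zero_le_one (α := ℝ)) (f := fun s => p.eval s)
    (by fun_prop) (show (0 : ℝ) ∈ Set.Icc (p.eval 1) (p.eval 0) from ⟨hcon, by rw [h0]; norm_num⟩)
  exact hne s hs hs0

/-- The radial projection to a ball. -/
theorem exists_ballProjection {E : Type*} [NormedAddCommGroup E]
    [InnerProductSpace ℝ E] {R : ℝ} (hR : 0 < R) :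
    ∃ P : E → E, LipschitzWith 1 P ∧ (∀ x, P x ∈ Metric.closedBall 0 R) ∧
      (∀ x ∈ Metric.closedBall 0 R, P x = x) ∧ ∀ x ∉ Metric.closedBall 0 R, ‖P x‖ = R := by
  let P : E → E := fun x => if ‖x‖ ≤ R then x else (R / ‖x‖) • x
  have hP2 : ∀ x, ¬ ‖x‖ ≤ R → ‖P x‖ = R := by
    intro x hx
    have : 0 < ‖x‖ := lt_trans hR (not_le.1 hx)
    simp only [P, if_neg hx, norm_smul, Real.norm_eq_abs]
    rw [abs_of_pos (by positivity)]
    field_simp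
  have hmem : ∀ x, ‖P x‖ ≤ R := by
    intro x
    by_cases hx : ‖x‖ ≤ R
    · simp [P, hx]
    · exact (hP2 x hx).le
  -- The obtuse-angle inequality of a metric projection. Used at two points and added up, it gives
  -- the Lipschitz constant 1 by Cauchy–Schwarz.
  have hvar : ∀ x w, ‖w‖ ≤ R → inner ℝ (x - P x) (w - P x) ≤ 0 := by
    intro x w hw
    by_cases hx : ‖x‖ ≤ R
    · simp [P, hx]
    · have hx' := not_le.1 hx
      have hx0 : 0 < ‖x‖ := lt_trans hR hx'
      have e1 : x - P x = (1 - R / ‖x‖) • x := by simp [P, hx, sub_smul]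
      have e2 : inner ℝ x (P x) = R * ‖x‖ := by
        simp only [P, if_neg hx, inner_smul_right, real_inner_self_eq_norm_sq]
        field_simp
      rw [e1, inner_smul_left, inner_sub_right, e2]
      have h1 : 0 ≤ 1 - R / ‖x‖ := by
        rw [sub_nonneg, div_le_one hx0]; exact hx'.le
      have h2 := real_inner_le_norm x w
      have h3 : inner ℝ x w - R * ‖x‖ ≤ 0 := by nlinarith
      exact mul_nonpos_of_nonneg_of_nonpos (by simpa using h1) h3
  refine ⟨P, LipschitzWith.of_dist_le_mul fun x y => ?_, fun x => by simpa using hmem x, ?_, ?_⟩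
  · rw [dist_eq_norm, dist_eq_norm, NNReal.coe_one, one_mul]
    have h1 := hvar x (P y) (hmem y)
    have h2 := hvar y (P x) (hmem x)
    have h3 : ‖P x - P y‖ ^ 2 ≤ inner ℝ (x - y) (P x - P y) := by
      rw [← real_inner_self_eq_norm_sq]
      simp only [inner_sub_left, inner_sub_right] at *
      linarith
    have h4 := real_inner_le_norm (x - y) (P x - P y)
    by_contra hcon
    push Not at hcon
    nlinarith [norm_nonneg (x - y), norm_nonneg (P x - P y)]
  · intro x hx
    simp only [mem_closedBall_zero_iff] at hx
    simp [P, hx]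
  · intro x hx
    simp only [mem_closedBall_zero_iff] at hx
    exact hP2 x hx

/-- Differentiating the constant ‖r‖² shows that the range of `D` is orthogonal to r(x) ≠ 0, so `D`
is not surjective. -/
theorem det_eq_zero_of_norm_const {r : E → E} {x : E} {D : E →L[ℝ] E} {R : ℝ} (hR : 0 < R)
    (hD : HasFDerivAt r D x) (hr : ∀ᶠ y in nhds x, ‖r y‖ = R) : D.det = 0 := by
  have h1 : HasFDerivAt (fun y => ‖r y‖ ^ 2) (2 • (innerSL ℝ (r x)).comp D) x := hD.norm_sq
  have h2 : HasFDerivAt (fun y => ‖r y‖ ^ 2) (0 : E →L[ℝ] ℝ) x :=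
    (hasFDerivAt_const (R ^ 2) x).congr_of_eventuallyEq (hr.mono fun y hy => by simp [hy])
  have h3 : ∀ v, inner ℝ (r x) (D v) = 0 := by
    intro v
    have := congrArg (fun L : E →L[ℝ] ℝ => L v) (h1.unique h2)
    simpa using this
  have hrx : r x ≠ 0 := by
    intro h0
    have := hr.self_of_nhds
    rw [h0, norm_zero] at this
    exact hR.ne this
  by_contra hdet
  have hu : IsUnit (D : E →ₗ[ℝ] E) := by
    exact (LinearMap.isUnit_iff_isUnit_det _).2 (IsUnit.mk0 _ hdet)
  obtain ⟨v, hv⟩ := ((Module.End.isUnit_iff _).1 hu).2 (r x)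
  have := h3 v
  rw [show D v = r x from hv, real_inner_self_eq_norm_sq] at this
  exact hrx (by simpa using this)

variable [MeasurableSpace E] [BorelSpace E]

/-- A volume argument. For small t the map x ↦ x + t(r(x) - x) is a bijection of the ball, so its
Jacobian integrates to the volume of the ball. The Jacobian is polynomial in t, so the same holds at
t = 1. There the map is r, which takes values in the sphere and has Jacobian zero inside the ball.
-/
theorem no_smooth_retraction {R : ℝ} (hR : 0 < R) {U : Set E} (hU : IsOpen U)
    (hBU : Metric.closedBall 0 R ⊆ U) {r : E → E} (hr : ContDiffOn ℝ 1 r U)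
    (hnorm : ∀ x ∈ Metric.closedBall (0 : E) R, ‖r x‖ = R)
    (hfix : ∀ x, ‖x‖ = R → r x = x) : False := by
  set B : Set E := Metric.closedBall 0 R with hB
  have hcomp : IsCompact B := isCompact_closedBall 0 R
  let g : E → E := fun x => r x - x
  have hg : ContDiffOn ℝ 1 g U := hr.sub contDiffOn_id
  have hgc : ContinuousOn (fderiv ℝ g) U := hg.continuousOn_fderiv_of_isOpen hU le_rfl
  have hgd : ∀ x ∈ B, HasFDerivAt g (fderiv ℝ g x) x := fun x hx =>
    ((hg.differentiableOn (by norm_num)).differentiableAt (hU.mem_nhds (hBU hx))).hasFDerivAt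
  obtain ⟨C, hC⟩ := hcomp.exists_bound_of_continuousOn (hgc.mono hBU)
  let C' : NNReal := ⟨max C 1, le_trans zero_le_one (le_max_right _ _)⟩
  have hC'1 : (1 : ℝ) ≤ C' := le_max_right _ _
  have hCC' : ∀ x ∈ B, ‖fderiv ℝ g x‖ ≤ C' := fun x hx => (hC x hx).trans (le_max_left _ _)
  have hlip : LipschitzOnWith C' g B :=
    (convex_closedBall 0 R).lipschitzOnWith_of_nnnorm_fderiv_le
      (fun x hx => (hgd x hx).differentiableAt) (fun x hx => hCC' x hx)
  obtain ⟨P, hP1, hPm, hPid, hPout⟩ := exists_ballProjection (E := E) hR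
  -- For t ≤ T the map t • g is 1/2-Lipschitz on the ball, which yields injectivity as well as the
  -- contraction used for surjectivity.
  let T : ℝ := 1 / (2 * C')
  have hT : 0 < T := by positivity
  have hTC : T * C' = 1 / 2 := by simp only [T]; field_simp
  have hF : ∀ t ∈ Set.Icc 0 T,
      ∫ x in B, (ContinuousLinearMap.id ℝ E + t • fderiv ℝ g x).det = volume.real B := by
    intro t ht
    have htC : t * C' ≤ 1 / 2 := by rw [← hTC]; gcongr; exact ht.2
    let F : E → E := fun x => x + t • g x
    have hFd : ∀ x ∈ B, HasFDerivWithinAt F (ContinuousLinearMap.id ℝ E + t • fderiv ℝ g x) B x :=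
      fun x hx => ((hasFDerivAt_id x).add ((hgd x hx).const_smul t)).hasFDerivWithinAt
    have hinj : Set.InjOn F B := by
      intro x hx y hy hxy
      have h1 : x - y = t • (g y - g x) := by
        simp only [F] at hxy
        rw [smul_sub, sub_eq_sub_iff_add_eq_add, hxy, add_comm]
      have h2 : ‖x - y‖ ≤ 1 / 2 * ‖x - y‖ := by
        calc ‖x - y‖ = t * ‖g y - g x‖ := by
              rw [h1, norm_smul, Real.norm_of_nonneg ht.1]
          _ ≤ t * (C' * ‖y - x‖) := by
              gcongr
              · exact ht.1
              · simpa [dist_eq_norm] using hlip.dist_le_mul y hy x hx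
          _ = (t * C') * ‖x - y‖ := by rw [norm_sub_rev]; ring
          _ ≤ _ := by gcongr
      have : ‖x - y‖ = 0 := le_antisymm (by linarith) (norm_nonneg _)
      exact sub_eq_zero.1 (norm_eq_zero.1 this)
    have himg : F '' B = B := by
      apply Set.Subset.antisymm
      · rintro _ ⟨x, hx, rfl⟩
        have hrB : r x ∈ B := by simp [hB, hnorm x hx]
        have ht1 : t ≤ 1 := by nlinarith [ht.1]
        have := (convex_closedBall (0 : E) R) hx hrB (sub_nonneg.2 ht1) ht.1 (by ring)
        convert! this using 1
        simp only [F, g]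
        module
      · intro y hy
        -- The projection extends g to the whole space, so that x + t g(x) = y can be solved by
        -- contraction. A solution outside the ball would project to the sphere, where g vanishes,
        -- and would equal y, which lies in the ball.
        have hctr : ContractingWith (1 / 2) (fun x => y - t • g (P x)) := by
          refine ⟨by rw [← NNReal.coe_lt_coe]; norm_num, LipschitzWith.of_dist_le_mul fun a b => ?_⟩
          have h1 := hlip.dist_le_mul (P a) (hPm a) (P b) (hPm b)
          have h2 := hP1.dist_le_mul a b
          simp only [NNReal.coe_one, one_mul] at h2
          rw [dist_sub_left, dist_eq_norm, ← smul_sub, norm_smul, Real.norm_of_nonneg ht.1,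
            ← dist_eq_norm]
          calc t * dist (g (P a)) (g (P b)) ≤ t * (C' * dist a b) := by
                gcongr
                · exact ht.1
                · exact h1.trans (by gcongr)
            _ = (t * C') * dist a b := by ring
            _ ≤ _ := by push_cast; gcongr
        let x := hctr.fixedPoint
        have hx : y - t • g (P x) = x := hctr.fixedPoint_isFixedPt
        by_cases hxB : x ∈ B
        · refine ⟨x, hxB, ?_⟩
          rw [hPid x hxB] at hx
          simp only [F]
          rw [← hx]
          simp only [hx]
          rw [← eq_sub_iff_add_eq, hx]
        · exfalso
          have : g (P x) = 0 := by simp [g, hfix (P x) (hPout x hxB)]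
          rw [this, smul_zero, sub_zero] at hx
          exact hxB (hx ▸ hy)
    have hcv := integral_image_eq_integral_abs_det_fderiv_smul volume hcomp.measurableSet hFd hinj
      (fun _ => (1 : ℝ))
    rw [himg] at hcv
    simp only [smul_eq_mul, mul_one, integral_const, measureReal_restrict_apply_univ] at hcv
    rw [hcv]
    refine setIntegral_congr_fun hcomp.measurableSet fun x hx => ?_
    have hpos : 0 < (ContinuousLinearMap.id ℝ E + t • fderiv ℝ g x).det := by
      apply det_id_add_pos
      rw [norm_smul, Real.norm_of_nonneg ht.1]
      calc t * ‖fderiv ℝ g x‖ ≤ t * C' := by gcongr; exacts [ht.1, hCC' x hx]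
        _ < 1 := by linarith
    simp only [abs_of_pos hpos]
  obtain ⟨w, τ, hτ, hw⟩ := exists_interpolation_weights (Module.finrank ℝ E) hT
  have hsum : ∑ k, w k = 1 := by simpa using (hw 1 (by simp)).symm
  have hint : ∀ t : ℝ, IntegrableOn
      (fun x => (ContinuousLinearMap.id ℝ E + t • fderiv ℝ g x).det) B := by
    intro t
    refine ContinuousOn.integrableOn_compact hcomp ?_
    exact ContinuousLinearMap.continuous_det.comp_continuousOn
      (continuousOn_const.add ((hgc.mono hBU).const_smul t))
  have h1 : ∫ x in B, (ContinuousLinearMap.id ℝ E + (1 : ℝ) • fderiv ℝ g x).det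
      = volume.real B := by
    calc _ = ∫ x in B, ∑ k, w k * (ContinuousLinearMap.id ℝ E + τ k • fderiv ℝ g x).det := by
          congr 1
          ext x
          obtain ⟨p, hp, hpt⟩ := exists_polynomial_det (fderiv ℝ g x)
          simp only [hpt]
          exact hw p hp
      _ = ∑ k, w k * volume.real B := by
          rw [integral_finsetSum _ fun k _ => (hint (τ k)).const_mul (w k)]
          refine Finset.sum_congr rfl fun k _ => ?_
          rw [integral_const_mul, hF (τ k) (hτ k)]
      _ = _ := by rw [← Finset.sum_mul, hsum, one_mul]
  have h2 : ∫ x in Metric.ball (0 : E) R,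
      (ContinuousLinearMap.id ℝ E + (1 : ℝ) • fderiv ℝ g x).det = 0 := by
    refine setIntegral_eq_zero_of_forall_eq_zero fun x hx => ?_
    have hxB : x ∈ B := Metric.ball_subset_closedBall hx
    refine det_eq_zero_of_norm_const (r := r) hR (x := x) ?_ ?_
    · have := (hasFDerivAt_id x).add (hgd x hxB)
      rw [one_smul]
      refine this.congr_of_eventuallyEq (Filter.Eventually.of_forall fun y => ?_)
      simp [g]
    · filter_upwards [Metric.isOpen_ball.mem_nhds hx] with y hy
      exact hnorm y (Metric.ball_subset_closedBall hy)
  have hae : (Metric.ball (0 : E) R) =ᵐ[volume] B := by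
    have hnt : Nontrivial E := by
      by_contra hcon
      rw [not_nontrivial_iff_subsingleton] at hcon
      have := hnorm 0 (Metric.mem_closedBall_self hR.le)
      rw [Subsingleton.elim (r 0) 0, norm_zero] at this
      exact hR.ne this
    rw [hB, ← Metric.ball_union_sphere]
    refine (union_ae_eq_left_of_ae_eq_empty ?_).symm
    rw [ae_eq_empty]
    exact Measure.addHaar_sphere volume 0 R
  rw [setIntegral_congr_set hae] at h2
  rw [h2] at h1
  have : 0 < volume.real B := by
    rw [measureReal_def]
    exact ENNReal.toReal_pos (Metric.measure_closedBall_pos volume 0 hR).ne'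
      hcomp.measure_lt_top.ne
  linarith

/-- A continuously differentiable self-map with bounded range has a fixed point. -/
theorem exists_fixedPoint_of_contDiff {f : E → E} (hf : ContDiff ℝ 1 f) {R : ℝ} (hR : 0 < R)
    (hfR : ∀ x, ‖f x‖ < R) : ∃ x, f x = x := by
  by_contra! hne
  have hv : ∀ x, 0 < ‖x - f x‖ := fun x => norm_pos_iff.2 (sub_ne_zero.2 (hne x).symm)
  -- The retraction will send x to the point where the ray from f(x) through x leaves the ball; u is
  -- its direction.
  let u : E → E := fun x => ‖x - f x‖⁻¹ • (x - f x)
  have hu1 : ∀ x, ‖u x‖ = 1 := by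
    intro x
    simp only [u, norm_smul, norm_inv, norm_norm]
    exact inv_mul_cancel₀ (hv x).ne'
  have hu : ContDiff ℝ 1 u := by
    refine ContDiff.smul (ContDiff.inv (ContDiff.norm ℝ (contDiff_id.sub hf) fun x => ?_) fun x => ?_)
      (contDiff_id.sub hf)
    · exact sub_ne_zero.2 (hne x).symm
    · exact (hv x).ne'
  -- The discriminant of ‖x + s u‖² = R² as an equation in s. It is positive on the closed ball,
  -- hence on an open neighbourhood, so the root is smooth there. On the sphere ⟨x, u⟩ > 0 because
  -- ‖f x‖ < R, and the larger root is 0.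
  let d : E → ℝ := fun x => R ^ 2 - ‖x‖ ^ 2 + (inner ℝ x (u x)) ^ 2
  have hd : ContDiff ℝ 1 d :=
    (contDiff_const.sub (contDiff_id.norm_sq ℝ)).add ((contDiff_id.inner ℝ hu).pow 2)
  have hpos : ∀ x, ‖x‖ = R → 0 < inner ℝ x (u x) := by
    intro x hx
    simp only [u, inner_smul_right, inner_sub_right, real_inner_self_eq_norm_sq]
    have h1 := real_inner_le_norm x (f x)
    have h2 := hfR x
    have h3 : 0 < ‖x‖ ^ 2 - inner ℝ x (f x) := by rw [hx] at *; nlinarith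
    exact mul_pos (inv_pos.2 (hv x)) h3
  have hdpos : ∀ x ∈ Metric.closedBall (0 : E) R, 0 < d x := by
    intro x hx
    rw [mem_closedBall_zero_iff] at hx
    rcases hx.lt_or_eq with h | h
    · have : ‖x‖ ^ 2 < R ^ 2 := by nlinarith [norm_nonneg x]
      simp only [d]
      nlinarith [sq_nonneg (inner ℝ x (u x))]
    · have := hpos x h
      simp only [d, h]
      nlinarith
  let r : E → E := fun x => x + (Real.sqrt (d x) - inner ℝ x (u x)) • u x
  refine no_smooth_retraction hR (U := {x | 0 < d x}) (isOpen_lt continuous_const hd.continuous)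
    hdpos (r := r) ?_ ?_ ?_
  · refine contDiffOn_id.add (ContDiffOn.smul (ContDiffOn.sub ?_ ?_) hu.contDiffOn)
    · exact hd.contDiffOn.sqrt fun x hx => (ne_of_gt hx)
    · exact (contDiff_id.inner ℝ hu).contDiffOn
  · intro x hx
    have h0 := Real.sq_sqrt (hdpos x hx).le
    have h1 : ‖r x‖ ^ 2 = R ^ 2 := by
      simp only [r]
      rw [norm_add_sq_real, norm_smul, inner_smul_right, hu1, mul_one, Real.norm_eq_abs, sq_abs,
        sub_sq, h0]
      simp only [d]
      ring
    rw [← abs_of_nonneg (norm_nonneg (r x)), ← abs_of_pos hR]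
    exact (sq_eq_sq_iff_abs_eq_abs _ _).1 h1
  · intro x hx
    have : Real.sqrt (d x) = inner ℝ x (u x) := by
      simp only [d, hx]
      rw [sub_self, zero_add]
      exact Real.sqrt_sq (hpos x hx).le
    simp [r, this]

end FixedPoint

/-! ### Approximate equilibria of bimatrix games -/

section Bimatrix

/-- The logit choice probabilities for the values `v` and the precision `β`. -/
noncomputable def logit {ι : Type*} [Fintype ι] (β : ℝ) (v : ι → ℝ) (k : ι) : ℝ :=
  Real.exp (β * v k) / ∑ j, Real.exp (β * v j)

variable {ι : Type*} [Fintype ι] [Nonempty ι]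

theorem sum_exp_pos (β : ℝ) (v : ι → ℝ) : 0 < ∑ j, Real.exp (β * v j) :=
  Finset.sum_pos (fun _ _ => Real.exp_pos _) Finset.univ_nonempty

theorem logit_nonneg (β : ℝ) (v : ι → ℝ) (k : ι) : 0 ≤ logit β v k :=
  div_nonneg (Real.exp_pos _).le (sum_exp_pos β v).le

theorem sum_logit (β : ℝ) (v : ι → ℝ) : ∑ k, logit β v k = 1 := by
  simp only [logit, ← Finset.sum_div]
  exact div_self (sum_exp_pos β v).ne'

theorem logit_le_one (β : ℝ) (v : ι → ℝ) (k : ι) : logit β v k ≤ 1 := by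
  rw [← sum_logit β v]
  exact Finset.single_le_sum (fun j _ => logit_nonneg β v j) (Finset.mem_univ k)

/-- An alternative that is worse by g > 0 is chosen with probability at most exp(-βg), and g
exp(-βg) ≤ 1/β. -/
theorem le_sum_logit_mul {β : ℝ} (hβ : 0 < β) (v : ι → ℝ) (k : ι) :
    v k ≤ ∑ j, logit β v j * v j + Fintype.card ι / β := by
  have hterm : ∀ j, logit β v j * (v k - v j) ≤ 1 / β := by
    intro j
    rcases le_or_gt (v k - v j) 0 with h | h
    · exact (mul_nonpos_of_nonneg_of_nonpos (logit_nonneg β v j) h).trans (by positivity)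
    · have h1 : logit β v j ≤ (Real.exp (β * (v k - v j)))⁻¹ := by
        rw [← Real.exp_neg, logit, div_le_iff₀ (sum_exp_pos β v)]
        calc Real.exp (β * v j) = Real.exp (-(β * (v k - v j))) * Real.exp (β * v k) := by
              rw [← Real.exp_add]; ring_nf
          _ ≤ _ := by
              gcongr
              exact Finset.single_le_sum (f := fun j => Real.exp (β * v j))
                (fun _ _ => (Real.exp_pos _).le) (Finset.mem_univ k)
      have h2 : β * (v k - v j) ≤ Real.exp (β * (v k - v j)) := by
        linarith [Real.add_one_le_exp (β * (v k - v j))]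
      calc logit β v j * (v k - v j) ≤ (Real.exp (β * (v k - v j)))⁻¹ * (v k - v j) := by gcongr
        _ ≤ 1 / β := by
          rw [le_div_iff₀ hβ, inv_mul_eq_div, div_mul_eq_mul_div, div_le_one (Real.exp_pos _)]
          linarith
  have h3 : ∑ j, logit β v j * (v k - v j) ≤ Fintype.card ι / β := by
    calc _ ≤ ∑ _j : ι, 1 / β := Finset.sum_le_sum fun j _ => hterm j
      _ = _ := by simp [div_eq_mul_inv]
  have h4 : ∑ j, logit β v j * (v k - v j) = v k - ∑ j, logit β v j * v j := by
    simp only [mul_sub, Finset.sum_sub_distrib, ← Finset.sum_mul, sum_logit, one_mul]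
  linarith

/-- Every bimatrix game has approximate equilibria in mixed strategies. -/
theorem exists_approx_bimatrix_nash {κ : Type*} [Fintype κ] [Nonempty κ] (A B : ι → κ → ℝ)
    {ε : ℝ} (hε : 0 < ε) :
    ∃ (p : ι → ℝ) (q : κ → ℝ), (∀ k, 0 ≤ p k) ∧ ∑ k, p k = 1 ∧ (∀ l, 0 ≤ q l) ∧ ∑ l, q l = 1 ∧
      (∀ k, ∑ l, q l * A k l ≤ ∑ j, p j * ∑ l, q l * A j l + ε) ∧
      ∀ l, ∑ k, p k * B k l ≤ ∑ j, q j * ∑ k, p k * B k j + ε := by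
  obtain ⟨β, hβ, hβι, hβκ⟩ : ∃ β : ℝ, 0 < β ∧ Fintype.card ι / β ≤ ε ∧ Fintype.card κ / β ≤ ε := by
    have h1 : (0 : ℝ) < Fintype.card ι := by exact_mod_cast Fintype.card_pos
    refine ⟨(Fintype.card ι + Fintype.card κ) / ε, by positivity, ?_, ?_⟩ <;>
    · rw [div_div_eq_mul_div, div_le_iff₀ (by positivity), mul_comm ε]
      gcongr
      simp
  let vA : EuclideanSpace ℝ (ι ⊕ κ) → ι → ℝ := fun x k => ∑ l, x (Sum.inr l) * A k l
  let vB : EuclideanSpace ℝ (ι ⊕ κ) → κ → ℝ := fun x l => ∑ k, x (Sum.inl k) * B k l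
  -- The joint logit response. It is smooth and bounded on the whole Euclidean space, so no fixed
  -- point theorem on a simplex is needed; by the choice of β its fixed points are ε-equilibria.
  let f : EuclideanSpace ℝ (ι ⊕ κ) → EuclideanSpace ℝ (ι ⊕ κ) := fun x =>
    WithLp.toLp 2 (Sum.elim (logit β (vA x)) (logit β (vB x)))
  have hcoord : ∀ m : ι ⊕ κ, ContDiff ℝ 1 fun x : EuclideanSpace ℝ (ι ⊕ κ) => x m := fun m =>
    (contDiff_euclidean.1 contDiff_id) m
  have hf : ContDiff ℝ 1 f := by
    rw [contDiff_euclidean]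
    rintro (k | l)
    · refine ContDiff.div (ContDiff.exp (contDiff_const.mul ?_)) (ContDiff.sum fun j _ =>
        ContDiff.exp (contDiff_const.mul ?_)) fun x => (sum_exp_pos β (vA x)).ne' <;>
      exact ContDiff.sum fun l _ => (hcoord _).mul contDiff_const
    · refine ContDiff.div (ContDiff.exp (contDiff_const.mul ?_)) (ContDiff.sum fun j _ =>
        ContDiff.exp (contDiff_const.mul ?_)) fun x => (sum_exp_pos β (vB x)).ne' <;>
      exact ContDiff.sum fun l _ => (hcoord _).mul contDiff_const
  have hR : ∀ x, ‖f x‖ < Fintype.card (ι ⊕ κ) + 1 := by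
    intro x
    have h1 : ‖f x‖ ^ 2 ≤ Fintype.card (ι ⊕ κ) := by
      rw [EuclideanSpace.norm_sq_eq]
      calc ∑ m, ‖f x m‖ ^ 2 ≤ ∑ _m : ι ⊕ κ, (1 : ℝ) := by
            refine Finset.sum_le_sum fun m _ => ?_
            have : 0 ≤ f x m ∧ f x m ≤ 1 := by
              rcases m with k | l
              · exact ⟨logit_nonneg β _ k, logit_le_one β _ k⟩
              · exact ⟨logit_nonneg β _ l, logit_le_one β _ l⟩
            rw [Real.norm_of_nonneg this.1]
            exact pow_le_one₀ this.1 this.2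
        _ = _ := by simp
    have h2 : (0 : ℝ) ≤ Fintype.card (ι ⊕ κ) := by positivity
    nlinarith [norm_nonneg (f x)]
  obtain ⟨x, hx⟩ := exists_fixedPoint_of_contDiff hf (by positivity) hR
  have hp : ∀ k, x (Sum.inl k) = logit β (vA x) k := fun k =>
    (congrArg (fun y : EuclideanSpace ℝ (ι ⊕ κ) => y (Sum.inl k)) hx).symm
  have hq : ∀ l, x (Sum.inr l) = logit β (vB x) l := fun l =>
    (congrArg (fun y : EuclideanSpace ℝ (ι ⊕ κ) => y (Sum.inr l)) hx).symm
  refine ⟨logit β (vA x), logit β (vB x), logit_nonneg β _, sum_logit β _, logit_nonneg β _,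
    sum_logit β _, fun k => ?_, fun l => ?_⟩
  · have h := le_sum_logit_mul hβ (vA x) k
    have e : ∀ k, ∑ l, logit β (vB x) l * A k l = vA x k := fun k => by simp only [vA, hq]
    simp only [e]
    linarith
  · have h := le_sum_logit_mul hβ (vB x) l
    have e : ∀ l, ∑ k, logit β (vA x) k * B k l = vB x l := fun l => by simp only [vB, hp]
    simp only [e]
    linarith

end Bimatrix

/-! ### Discounted sums -/

section Discounting

/-- The normalised discounted sum of a sequence of stage payoffs. -/
noncomputable def discounted (δ : ℝ) (v : ℕ → ℝ) : ℝ := ∑' t, (1 - δ) * δ ^ t * v t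

variable {δ : ℝ}

theorem summable_discounted (h0 : 0 < δ) (h1 : δ < 1) {v : ℕ → ℝ} (hv : ∀ t, |v t| ≤ 1) :
    Summable fun t => (1 - δ) * δ ^ t * v t := by
  refine Summable.of_norm_bounded ((summable_geometric_of_lt_one h0.le h1).mul_left (1 - δ))
    fun t => ?_
  have : 0 ≤ (1 - δ) * δ ^ t := mul_nonneg (by linarith) (by positivity)
  rw [norm_mul, Real.norm_of_nonneg this]
  exact mul_le_of_le_one_right this (hv t)

theorem discounted_const (h0 : 0 < δ) (h1 : δ < 1) (b : ℝ) :
    discounted δ (fun _ => b) = b := by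
  have : (1 - δ) ≠ 0 := by linarith
  rw [discounted, tsum_mul_right, tsum_mul_left, tsum_geometric_of_lt_one h0.le h1,
    mul_inv_cancel₀ this, one_mul]

/-- The discounted weight of the periods from `n` on. -/
theorem hasSum_discounted_tail (h0 : 0 < δ) (h1 : δ < 1) (n : ℕ) (b : ℝ) :
    HasSum (fun t => (1 - δ) * δ ^ t * (if n ≤ t then b else 0)) (δ ^ n * b) := by
  have h2 : (1 - δ) ≠ 0 := by linarith
  have h3 : HasSum (fun t => (1 - δ) * δ ^ (t + n) * b) (δ ^ n * b) := by
    have := (((hasSum_geometric_of_lt_one h0.le h1).mul_left (1 - δ)).mul_right (δ ^ n * b))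
    rw [mul_inv_cancel₀ h2, one_mul] at this
    refine this.congr_fun fun t => ?_
    ring
  have h4 := (hasSum_nat_add_iff (f := fun t => (1 - δ) * δ ^ t * (if n ≤ t then b else 0)) n
    (g := δ ^ n * b)).1 (by simpa using h3)
  rw [Finset.sum_eq_zero (fun t ht => by
    simp [not_le.2 (Finset.mem_range.1 ht)]), add_zero] at h4
  exact h4

theorem discounted_mono (h0 : 0 < δ) (h1 : δ < 1) {v w : ℕ → ℝ} (hv : ∀ t, |v t| ≤ 1)
    (hw : ∀ t, |w t| ≤ 1) (h : ∀ t, v t ≤ w t) : discounted δ v ≤ discounted δ w := by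
  refine Summable.tsum_le_tsum (fun t => ?_) (summable_discounted h0 h1 hv)
    (summable_discounted h0 h1 hw)
  exact mul_le_mul_of_nonneg_left (h t) (mul_nonneg (by linarith) (by positivity))

theorem abs_discounted_le (h0 : 0 < δ) (h1 : δ < 1) {v : ℕ → ℝ} (hv : ∀ t, |v t| ≤ 1) :
    |discounted δ v| ≤ 1 := by
  rw [abs_le]
  constructor
  · rw [← discounted_const h0 h1 (-1)]
    exact discounted_mono h0 h1 (by simp) hv fun t => (abs_le.1 (hv t)).1
  · rw [← discounted_const h0 h1 1]
    exact discounted_mono h0 h1 hv (by simp) fun t => (abs_le.1 (hv t)).2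

/-- If `v` beats `w` by `d` in period `n` and loses at most `1` per period from `m > n` on, and
nothing in the other periods, then this bounds the difference of the discounted sums. -/
theorem discounted_sub_ge (h0 : 0 < δ) (h1 : δ < 1) {v w : ℕ → ℝ} (hv : ∀ t, |v t| ≤ 1)
    (hw : ∀ t, |w t| ≤ 1) {n m : ℕ} (hnm : n < m) {d : ℝ} (hn : w n + d ≤ v n)
    (hmid : ∀ t, t ≠ n → t < m → w t ≤ v t) (hlate : ∀ t, m ≤ t → w t - 1 ≤ v t) :
    (1 - δ) * δ ^ n * d - δ ^ m ≤ discounted δ v - discounted δ w := by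
  have hs1 := (hasSum_ite_eq n ((1 - δ) * δ ^ n * d))
  have hs2 := hasSum_discounted_tail h0 h1 m 1
  have hs := hs1.sub hs2
  rw [mul_one] at hs
  have hvw := (summable_discounted h0 h1 hv).hasSum.sub (summable_discounted h0 h1 hw).hasSum
  refine hasSum_le (fun t => ?_) hs hvw
  have hpos : 0 ≤ (1 - δ) * δ ^ t := mul_nonneg (by linarith) (by positivity)
  rw [← mul_sub]
  by_cases htn : t = n
  · subst htn
    simp only [if_pos, not_le.2 hnm, if_false, mul_zero, sub_zero]
    exact mul_le_mul_of_nonneg_left (by linarith) hpos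
  · simp only [htn, if_false, zero_sub]
    by_cases htm : m ≤ t
    · simp only [htm, if_true]
      rw [← mul_neg]
      exact mul_le_mul_of_nonneg_left (by linarith [hlate t htm]) hpos
    · simp only [htm, if_false, mul_zero, neg_zero]
      exact mul_nonneg hpos (by linarith [hmid t htn (not_le.1 htm)])

end Discounting

/-! ### Play of two pure strategies -/

section Basic

@[simp] theorem opp_opp (i : Fin 2) : opp (opp i) = i := by
  fin_cases i <;> rfl

theorem opp_ne (i : Fin 2) : opp i ≠ i := by
  fin_cases i <;> decide

theorem eq_or_eq_opp (i k : Fin 2) : k = i ∨ k = opp i := by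
  fin_cases i <;> fin_cases k <;> decide

theorem profile_ext {i : Fin 2} {a b : Profile} (h1 : a i = b i) (h2 : a (opp i) = b (opp i)) :
    a = b := by
  funext k
  rcases eq_or_eq_opp i k with rfl | rfl <;> assumption

theorem act_eq_I_or_N (b : Act) : b = Act.I ∨ b = Act.N := by cases b <;> simp

theorem act_ne_N_iff {b : Act} : b ≠ Act.N ↔ b = Act.I := by cases b <;> simp

theorem abs_stagePayoff_le {c : ℝ} (hc : c ∈ Set.Ioo (0 : ℝ) 1) (θ : State) (a : Profile)
    (i : Fin 2) : |stagePayoff c θ a i| ≤ 1 := by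
  obtain ⟨h0, h1⟩ := hc
  rw [abs_le]
  unfold stagePayoff
  split
  · constructor <;> norm_num
  · split_ifs <;> constructor <;> linarith

theorem stagePayoff_of_N {c : ℝ} {θ : State} {a : Profile} {i : Fin 2} (h : a i = Act.N) :
    stagePayoff c θ a i = 0 := by
  simp [stagePayoff, h]

theorem stagePayoff_of_I {c : ℝ} {θ : State} {a : Profile} {i : Fin 2} (h : a i = Act.I) :
    stagePayoff c θ a i = (if θ = State.H ∧ a (opp i) = Act.I then 1 else 0) - c := by
  simp [stagePayoff, h]

variable {X : Type*}

/-- The pure strategy profile in which player `i` uses `s` and the opponent uses `t`. -/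
def pair (i : Fin 2) (s t : PureStrategy X) : Fin 2 → PureStrategy X :=
  fun k => if k = i then s else t

@[simp] theorem pair_self (i : Fin 2) (s t : PureStrategy X) : pair i s t i = s := by simp [pair]

@[simp] theorem pair_opp (i : Fin 2) (s t : PureStrategy X) : pair i s t (opp i) = t := by
  simp [pair, opp_ne]

/-- The signals of player `i` up to period `n`. -/
def own (i : Fin 2) (n : ℕ) (x : ℕ → Fin 2 → X) : Fin n → X := fun k => x k i

theorem path_apply (s : Fin 2 → PureStrategy X) (x : ℕ → Fin 2 → X) (n : ℕ) (i : Fin 2) :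
    path s x n i = s i n (hist s x n) (own i (n + 1) x) := rfl

theorem hist_succ (s : Fin 2 → PureStrategy X) (x : ℕ → Fin 2 → X) (n : ℕ) :
    hist s x (n + 1) = Fin.snoc (α := fun _ => Profile) (hist s x n) (path s x n) := rfl

theorem hist_apply (s : Fin 2 → PureStrategy X) (x : ℕ → Fin 2 → X) (n : ℕ) (k : Fin n) :
    hist s x n k = path s x k := by
  induction n with
  | zero => exact k.elim0
  | succ n ih =>
    rw [hist_succ]
    refine Fin.lastCases ?_ (fun k => ?_) k
    · simp
    · simp [ih]

theorem take_hist (s : Fin 2 → PureStrategy X) (x : ℕ → Fin 2 → X) {k n : ℕ} (h : k ≤ n) :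
    Fin.take k h (hist s x n) = hist s x k := by
  funext j
  simp [Fin.take, hist_apply]

theorem consistent_hist (s : Fin 2 → PureStrategy X) (x : ℕ → Fin 2 → X) (n : ℕ) (i : Fin 2) :
    Consistent i (hist s x n) (own i (n + 1) x) (s i) := by
  intro k
  rw [take_hist, hist_apply, path_apply]
  rfl

/-- Reaching a history splits into one condition per player, each on own signals only. With
independent signals this makes the weights of the two players factor. -/
theorem hist_eq_iff (i : Fin 2) (s t : PureStrategy X) (x : ℕ → Fin 2 → X) {n : ℕ}
    (a : Fin n → Profile) : hist (pair i s t) x n = a ↔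
      Consistent i a (own i (n + 1) x) s ∧ Consistent (opp i) a (own (opp i) (n + 1) x) t := by
  constructor
  · rintro rfl
    have h1 := consistent_hist (pair i s t) x n i
    have h2 := consistent_hist (pair i s t) x n (opp i)
    simp only [pair_self, pair_opp] at h1 h2
    exact ⟨h1, h2⟩
  · rintro ⟨h1, h2⟩
    have key : ∀ k (hk : k ≤ n), hist (pair i s t) x k = Fin.take k hk a := by
      intro k
      induction k with
      | zero => intro _; exact Subsingleton.elim _ _
      | succ k ih =>
        intro hk
        have ih' := ih (by omega)
        rw [hist_succ, ih']
        funext j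
        refine Fin.lastCases ?_ (fun j => ?_) j
        · rw [Fin.snoc_last]
          refine profile_ext (i := i) ?_ ?_
          · rw [path_apply, ih', pair_self]
            exact h1 ⟨k, hk⟩
          · rw [path_apply, ih', pair_opp]
            exact h2 ⟨k, hk⟩
        · rw [Fin.snoc_castSucc]
          rfl
    exact key n le_rfl

theorem longRunPayoff_eq (c δ : ℝ) (i : Fin 2) (θ : State) (x : ℕ → Fin 2 → X)
    (p : ℕ → Profile) :
    longRunPayoff c δ i (θ, x, p) = discounted δ fun t => stagePayoff c θ (p t) i := rfl

end Basic

/-! ### Continuity and measurability of payoffs -/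

section Payoffs

variable {X : Type*}

/-- For fixed signals, play up to a given period depends on finitely many coordinates of the
strategies, which take discrete values. -/
theorem eventually_hist_eq (x : ℕ → Fin 2 → X) (s₀ : Fin 2 → PureStrategy X) (n : ℕ) :
    ∀ᶠ s in nhds s₀, hist s x n = hist s₀ x n ∧ path s x n = path s₀ x n := by
  have hact : ∀ (n : ℕ) (a : Fin n → Profile) (i : Fin 2) (y : Fin (n + 1) → X),
      ∀ᶠ s in nhds s₀, s i n a y = s₀ i n a y := by
    intro n a i y
    have : Continuous fun s : Fin 2 → PureStrategy X => s i n a y := by fun_prop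
    exact this.continuousAt.eventually (Filter.eventually_of_mem
      ((isOpen_discrete {s₀ i n a y}).mem_nhds rfl) fun _ h => h)
  have hpath : ∀ n, (∀ᶠ s in nhds s₀, hist s x n = hist s₀ x n) →
      ∀ᶠ s in nhds s₀, path s x n = path s₀ x n := by
    intro n h
    have h2 : ∀ᶠ s in nhds s₀, ∀ i, s i n (hist s₀ x n) (own i (n + 1) x)
        = s₀ i n (hist s₀ x n) (own i (n + 1) x) :=
      Filter.eventually_all.2 fun i => hact n _ i _
    filter_upwards [h, h2] with s hs hs2
    funext i
    rw [path_apply, path_apply, hs, hs2]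
  have hhist : ∀ᶠ s in nhds s₀, hist s x n = hist s₀ x n := by
    induction n with
    | zero => exact Filter.Eventually.of_forall fun s => rfl
    | succ n ih =>
      filter_upwards [ih, hpath n ih] with s hs hs2
      rw [hist_succ, hist_succ, hs, hs2]
  exact hhist.and (hpath n hhist)

theorem measurable_pair (i : Fin 2) :
    Measurable fun p : PureStrategy X × PureStrategy X => pair i p.1 p.2 := by
  refine measurable_pi_lambda _ fun k => ?_
  by_cases hk : k = i
  · simp only [pair, hk, if_true]; exact measurable_fst
  · simp only [pair, hk, if_false]; exact measurable_snd

theorem continuous_pair (i : Fin 2) :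
    Continuous fun p : PureStrategy X × PureStrategy X => pair i p.1 p.2 := by
  refine continuous_pi fun k => ?_
  by_cases hk : k = i
  · simp only [pair, hk, if_true]; exact continuous_fst
  · simp only [pair, hk, if_false]; exact continuous_snd

section Topology

variable [Finite X]

instance : SecondCountableTopology (PureStrategy X) := by
  have h : ∀ n, SecondCountableTopology ((Fin n → Profile) → (Fin (n + 1) → X) → Act) :=
    fun n => inferInstance
  infer_instance

instance : BorelSpace (PureStrategy X) := borelSpace_pureStrategy X

theorem integrable_of_continuous_pure {μ : Measure (Fin 2 → PureStrategy X)} [IsFiniteMeasure μ]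
    {g : (Fin 2 → PureStrategy X) → ℝ} (hg : Continuous g) : Integrable g μ := by
  obtain ⟨C, hC⟩ := (isCompact_univ (X := Fin 2 → PureStrategy X)).exists_bound_of_continuousOn
    hg.continuousOn
  exact Integrable.of_bound (C := C) hg.measurable.aestronglyMeasurable
    (Filter.Eventually.of_forall fun s => hC s trivial)

theorem map_pair (σ : Fin 2 → MixedStrategy X) (i : Fin 2) :
    ((σ i : Measure (PureStrategy X)).prod (σ (opp i))).map (fun p => pair i p.1 p.2) =
      Measure.pi fun k => (σ k : Measure (PureStrategy X)) := by
  refine (Measure.pi_eq fun B hB => ?_).symm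
  rw [Measure.map_apply (measurable_pair i) (MeasurableSet.univ_pi hB)]
  have h1 : (fun p : PureStrategy X × PureStrategy X => pair i p.1 p.2) ⁻¹' Set.univ.pi B
      = B i ×ˢ B (opp i) := by
    ext p
    simp only [Set.mem_preimage, Set.mem_pi, Set.mem_univ, forall_true_left, Set.mem_prod]
    constructor
    · intro h
      have h1 := h i
      have h2 := h (opp i)
      simp only [pair_self, pair_opp] at h1 h2
      exact ⟨h1, h2⟩
    · rintro ⟨h1, h2⟩ k
      rcases eq_or_eq_opp i k with rfl | rfl <;> simpa
  rw [h1, Measure.prod_prod]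
  have : (Finset.univ : Finset (Fin 2)) = {i, opp i} := by
    ext k; simpa using eq_or_eq_opp i k
  rw [this, Finset.prod_pair (opp_ne i).symm]

theorem integral_pi_eq (σ : Fin 2 → MixedStrategy X) (i : Fin 2)
    {g : (Fin 2 → PureStrategy X) → ℝ} (hg : Continuous g) :
    ∫ s, g s ∂(Measure.pi fun k => (σ k : Measure (PureStrategy X))) =
      ∫ s, ∫ t, g (pair i s t) ∂(σ (opp i) : Measure (PureStrategy X)) ∂(σ i : Measure _) := by
  rw [← map_pair σ i, integral_map (measurable_pair i).aemeasurable
    hg.measurable.aestronglyMeasurable, integral_prod]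
  have h := integrable_of_continuous_pure (μ := Measure.pi fun k => (σ k : Measure _)) hg
  rw [← map_pair σ i] at h
  exact h.comp_measurable (measurable_pair i)

end Topology

variable {c δ : ℝ}

theorem abs_longRunPayoff_le (hc : c ∈ Set.Ioo (0 : ℝ) 1) (h0 : 0 < δ) (h1 : δ < 1) (i : Fin 2)
    (ω : Outcome X) : |longRunPayoff c δ i ω| ≤ 1 :=
  abs_discounted_le h0 h1 fun _ => abs_stagePayoff_le hc _ _ _

/-- By discounting, a uniformly convergent series of locally constant functions. -/
theorem continuous_longRunPayoff_path (hc : c ∈ Set.Ioo (0 : ℝ) 1) (h0 : 0 < δ) (h1 : δ < 1)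
    (i : Fin 2) (θ : State) (x : ℕ → Fin 2 → X) :
    Continuous fun s : Fin 2 → PureStrategy X => longRunPayoff c δ i (θ, x, path s x) := by
  refine continuous_tsum (u := fun t => (1 - δ) * δ ^ t) (fun t => ?_)
    ((summable_geometric_of_lt_one h0.le h1).mul_left (1 - δ)) fun t s => ?_
  · refine continuous_const.mul (continuous_iff_continuousAt.2 fun s₀ => ?_)
    refine continuousAt_const.congr (f := fun _ => stagePayoff c θ (path s₀ x t) i) ?_
    filter_upwards [eventually_hist_eq x s₀ t] with s hs
    simp only [hs.2]
  · have : 0 ≤ (1 - δ) * δ ^ t := mul_nonneg (by linarith) (by positivity)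
    rw [norm_mul, Real.norm_of_nonneg this]
    exact mul_le_of_le_one_right this (abs_stagePayoff_le hc _ _ _)

variable [MeasurableSpace X]

theorem measurable_longRunPayoff (hc : c ∈ Set.Ioo (0 : ℝ) 1) (h0 : 0 < δ) (h1 : δ < 1)
    (i : Fin 2) : Measurable (longRunPayoff c δ i : Outcome X → ℝ) := by
  have hterm : ∀ t : ℕ, Measurable fun ω : Outcome X =>
      (1 - δ) * δ ^ t * stagePayoff c ω.1 (ω.2.2 t) i := by
    intro t
    refine measurable_const.mul ?_
    have hm : Measurable fun ω : Outcome X => (ω.1, ω.2.2 t) := by fun_prop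
    have h2 : Measurable fun q : State × Profile => stagePayoff c q.1 q.2 i := by
      have : Finite State := ⟨⟨fun s => match s with | .H => (0 : Fin 2) | .L => 1,
        fun k => if k = 0 then .H else .L, fun s => by cases s <;> rfl,
        fun k => by fin_cases k <;> rfl⟩⟩
      have : MeasurableSingletonClass State := ⟨fun _ => trivial⟩
      exact measurable_of_finite _
    exact h2.comp hm
  refine measurable_of_tendsto_metrizable
    (f := fun n ω => ∑ t ∈ Finset.range n, (1 - δ) * δ ^ t * stagePayoff c ω.1 (ω.2.2 t) i)
    (fun n => Finset.measurable_sum _ fun t _ => hterm t) ?_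
  rw [tendsto_pi_nhds]
  intro ω
  exact (summable_discounted h0 h1 fun t => abs_stagePayoff_le hc _ _ _).hasSum.tendsto_sum_nat

variable [Finite X] [MeasurableSingletonClass X]

theorem measurable_longRunPayoff_path (hc : c ∈ Set.Ioo (0 : ℝ) 1) (h0 : 0 < δ) (h1 : δ < 1)
    (i : Fin 2) (θ : State) :
    Measurable fun p : (Fin 2 → PureStrategy X) × (ℕ → Fin 2 → X) =>
      longRunPayoff c δ i (θ, p.2, path p.1 p.2) :=
  (measurable_longRunPayoff hc h0 h1 i).comp
    (measurable_const.prodMk (measurable_snd.prodMk measurable_path))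

instance (f : State → PMF X) (θ : State) : IsProbabilityMeasure (signalLaw f θ) := by
  unfold signalLaw; infer_instance

/-- Expected payoff of player `i` in state `θ` under a pure profile. -/
noncomputable def pureValue (f : State → PMF X) (c δ : ℝ) (θ : State) (i : Fin 2)
    (s : Fin 2 → PureStrategy X) : ℝ :=
  ∫ x, longRunPayoff c δ i (θ, x, path s x) ∂(signalLaw f θ)

theorem integrable_longRunPayoff_path (hc : c ∈ Set.Ioo (0 : ℝ) 1) (h0 : 0 < δ) (h1 : δ < 1)
    (i : Fin 2) (θ : State) (s : Fin 2 → PureStrategy X) (μ : Measure (ℕ → Fin 2 → X))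
    [IsFiniteMeasure μ] : Integrable (fun x => longRunPayoff c δ i (θ, x, path s x)) μ := by
  refine Integrable.of_bound (C := 1) ?_ (Filter.Eventually.of_forall fun x =>
    abs_longRunPayoff_le hc h0 h1 i _)
  exact ((measurable_longRunPayoff_path hc h0 h1 i θ).comp
    (measurable_const.prodMk measurable_id)).aestronglyMeasurable

theorem continuous_pureValue (f : State → PMF X) (hc : c ∈ Set.Ioo (0 : ℝ) 1) (h0 : 0 < δ)
    (h1 : δ < 1) (θ : State) (i : Fin 2) : Continuous (pureValue f c δ θ i) := by
  refine continuous_of_dominated (bound := fun _ => 1)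
    (fun s => (integrable_longRunPayoff_path hc h0 h1 i θ s _).aestronglyMeasurable)
    (fun s => Filter.Eventually.of_forall fun x => abs_longRunPayoff_le hc h0 h1 i _)
    (integrable_const _)
    (Filter.Eventually.of_forall fun x => continuous_longRunPayoff_path hc h0 h1 i θ x)

theorem payoffInState_eq (f : State → PMF X) (hc : c ∈ Set.Ioo (0 : ℝ) 1) (h0 : 0 < δ)
    (h1 : δ < 1) (σ : Fin 2 → MixedStrategy X) (θ : State) (i : Fin 2) :
    payoffInState f c δ σ θ i =
      ∫ s, pureValue f c δ θ i s ∂(Measure.pi fun k => (σ k : Measure (PureStrategy X))) := by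
  have hmeas : Measurable fun p : (Fin 2 → PureStrategy X) × (ℕ → Fin 2 → X) =>
      ((θ, p.2, path p.1 p.2) : Outcome X) :=
    measurable_const.prodMk (measurable_snd.prodMk measurable_path)
  rw [payoffInState, outcomeLawGiven, integral_map hmeas.aemeasurable
    (measurable_longRunPayoff hc h0 h1 i).aestronglyMeasurable, integral_prod]
  · rfl
  · exact Integrable.of_bound (C := 1)
      (measurable_longRunPayoff_path hc h0 h1 i θ).aestronglyMeasurable
      (Filter.Eventually.of_forall fun x => abs_longRunPayoff_le hc h0 h1 i _)

instance (f : State → PMF X) (σ : Fin 2 → MixedStrategy X) (θ : State) :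
    IsProbabilityMeasure (outcomeLawGiven f σ θ) := by
  unfold outcomeLawGiven
  refine Measure.isProbabilityMeasure_map (Measurable.aemeasurable ?_)
  exact measurable_const.prodMk (measurable_snd.prodMk measurable_path)

theorem payoff_eq (f : State → PMF X) (hc : c ∈ Set.Ioo (0 : ℝ) 1) (h0 : 0 < δ)
    (h1 : δ < 1) {p₀ : ℝ} (hp : p₀ ∈ Set.Ioo (0 : ℝ) 1) (σ : Fin 2 → MixedStrategy X)
    (i : Fin 2) : payoff p₀ f c δ σ i =
      p₀ * payoffInState f c δ σ State.H i + (1 - p₀) * payoffInState f c δ σ State.L i := by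
  have hint : ∀ θ, Integrable (longRunPayoff c δ i) (outcomeLawGiven f σ θ) := fun θ =>
    Integrable.of_bound (C := 1) (measurable_longRunPayoff hc h0 h1 i).aestronglyMeasurable
      (Filter.Eventually.of_forall fun x => abs_longRunPayoff_le hc h0 h1 i _)
  rw [payoff, outcomeLaw, integral_add_measure ((hint _).smul_measure ENNReal.ofReal_ne_top)
    ((hint _).smul_measure ENNReal.ofReal_ne_top), integral_smul_measure, integral_smul_measure,
    ENNReal.toReal_ofReal hp.1.le, ENNReal.toReal_ofReal (by linarith [hp.2])]
  rfl

/-- Ex-ante expected payoff of player `i` under a pure profile. -/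
noncomputable def exAnteValue (p₀ : ℝ) (f : State → PMF X) (c δ : ℝ) (i : Fin 2)
    (s : Fin 2 → PureStrategy X) : ℝ :=
  p₀ * pureValue f c δ State.H i s + (1 - p₀) * pureValue f c δ State.L i s

theorem continuous_exAnteValue (p₀ : ℝ) (f : State → PMF X) (hc : c ∈ Set.Ioo (0 : ℝ) 1)
    (h0 : 0 < δ) (h1 : δ < 1) (i : Fin 2) : Continuous (exAnteValue p₀ f c δ i) :=
  ((continuous_pureValue f hc h0 h1 _ i).const_mul _).add
    ((continuous_pureValue f hc h0 h1 _ i).const_mul _)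

theorem payoff_eq_integral (f : State → PMF X) (hc : c ∈ Set.Ioo (0 : ℝ) 1) (h0 : 0 < δ)
    (h1 : δ < 1) {p₀ : ℝ} (hp : p₀ ∈ Set.Ioo (0 : ℝ) 1) (σ : Fin 2 → MixedStrategy X)
    (i : Fin 2) : payoff p₀ f c δ σ i =
      ∫ s, exAnteValue p₀ f c δ i s ∂(Measure.pi fun k => (σ k : Measure (PureStrategy X))) := by
  rw [payoff_eq f hc h0 h1 hp, payoffInState_eq f hc h0 h1, payoffInState_eq f hc h0 h1]
  simp only [exAnteValue]
  rw [integral_add, integral_const_mul, integral_const_mul]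
  · exact (integrable_of_continuous_pure (continuous_pureValue f hc h0 h1 _ i)).const_mul _
  · exact (integrable_of_continuous_pure (continuous_pureValue f hc h0 h1 _ i)).const_mul _

end Payoffs

/-! ### Equilibria in restricted sets of mixed strategies -/

section Restricted

variable {X : Type*} [Finite X]

theorem integrable_of_continuous {μ : Measure (PureStrategy X)} [IsFiniteMeasure μ]
    {g : PureStrategy X → ℝ} (hg : Continuous g) : Integrable g μ := by
  obtain ⟨C, hC⟩ := (isCompact_univ (X := PureStrategy X)).exists_bound_of_continuousOn
    hg.continuousOn
  exact Integrable.of_bound (C := C) hg.measurable.aestronglyMeasurable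
    (Filter.Eventually.of_forall fun s => hC s trivial)

theorem continuous_integral_pair (i : Fin 2) {g : (Fin 2 → PureStrategy X) → ℝ}
    (hg : Continuous g) (ν : MixedStrategy X) :
    Continuous fun s => ∫ t, g (pair i s t) ∂(ν : Measure (PureStrategy X)) := by
  obtain ⟨C, hC⟩ := (isCompact_univ (X := Fin 2 → PureStrategy X)).exists_bound_of_continuousOn
    hg.continuousOn
  have h1 : ∀ s, Continuous fun t => g (pair i s t) := fun s =>
    hg.comp ((continuous_pair i).comp (continuous_const.prodMk continuous_id))
  have h2 : ∀ t, Continuous fun s => g (pair i s t) := fun t =>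
    hg.comp ((continuous_pair i).comp (continuous_id.prodMk continuous_const))
  exact continuous_of_dominated (bound := fun _ => C)
    (fun s => (h1 s).measurable.aestronglyMeasurable)
    (fun s => Filter.Eventually.of_forall fun t => hC _ trivial) (integrable_const _)
    (Filter.Eventually.of_forall fun t => h2 t)

/-- The mixture of finitely many mixed strategies. -/
noncomputable def mixture {ι : Type*} [Fintype ι] (p : ι → ℝ) (hp : ∀ k, 0 ≤ p k)
    (hs : ∑ k, p k = 1) (τ : ι → MixedStrategy X) : MixedStrategy X :=
  ⟨∑ k, ENNReal.ofReal (p k) • (τ k : Measure (PureStrategy X)), ⟨by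
    simp [← ENNReal.ofReal_sum_of_nonneg fun k _ => hp k, hs]⟩⟩

variable {ι : Type*} [Fintype ι] {p : ι → ℝ} (hp : ∀ k, 0 ≤ p k) (hs : ∑ k, p k = 1)
  (τ : ι → MixedStrategy X)

theorem integral_mixture {g : PureStrategy X → ℝ} (hg : Continuous g) :
    ∫ s, g s ∂(mixture p hp hs τ : Measure (PureStrategy X)) =
      ∑ k, p k * ∫ s, g s ∂(τ k : Measure (PureStrategy X)) := by
  change ∫ s, g s ∂(∑ k, ENNReal.ofReal (p k) • (τ k : Measure (PureStrategy X))) = _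
  rw [integral_finsetSum_measure fun k _ =>
    (integrable_of_continuous hg).smul_measure ENNReal.ofReal_ne_top]
  refine Finset.sum_congr rfl fun k _ => ?_
  rw [integral_smul_measure, ENNReal.toReal_ofReal (hp k), smul_eq_mul]

omit [Finite X] in
theorem real_mixture (S : Set (PureStrategy X)) :
    (mixture p hp hs τ : Measure (PureStrategy X)).real S =
      ∑ k, p k * (τ k : Measure (PureStrategy X)).real S := by
  change (∑ k, ENNReal.ofReal (p k) • (τ k : Measure (PureStrategy X))).real S = _
  rw [measureReal_def, Measure.finsetSum_apply, ENNReal.toReal_sum]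
  · refine Finset.sum_congr rfl fun k _ => ?_
    simp [measureReal_def, ENNReal.toReal_ofReal (hp k)]
  · intro k _
    simp [ENNReal.mul_eq_top]

/-- The expectation of `g` under a mixed profile. -/
noncomputable def mixedValue (g : (Fin 2 → PureStrategy X) → ℝ) (σ : Fin 2 → MixedStrategy X) :
    ℝ :=
  ∫ s, g s ∂(Measure.pi fun k => (σ k : Measure (PureStrategy X)))

theorem continuous_mixedValue {g : (Fin 2 → PureStrategy X) → ℝ} (hg : Continuous g) :
    Continuous (mixedValue g) := by
  have h1 := ProbabilityMeasure.continuous_integral_continuousMap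
    (X := Fin 2 → PureStrategy X) (⟨g, hg⟩ : C(Fin 2 → PureStrategy X, ℝ))
  exact h1.comp ProbabilityMeasure.continuous_pi

theorem mixedValue_eq {g : (Fin 2 → PureStrategy X) → ℝ} (hg : Continuous g) (i : Fin 2)
    (σ : Fin 2 → MixedStrategy X) : mixedValue g σ =
      ∫ s, ∫ t, g (pair i s t) ∂(σ (opp i) : Measure (PureStrategy X)) ∂(σ i : Measure _) :=
  integral_pi_eq σ i hg

theorem mixedValue_update_eq {g : (Fin 2 → PureStrategy X) → ℝ} (hg : Continuous g) (i : Fin 2)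
    (σ : Fin 2 → MixedStrategy X) (τ : MixedStrategy X) :
    mixedValue g (Function.update σ i τ) =
      ∫ s, ∫ t, g (pair i s t) ∂(σ (opp i) : Measure (PureStrategy X)) ∂(τ : Measure _) := by
  rw [mixedValue_eq hg i, Function.update_self, Function.update_of_ne (opp_ne i)]

theorem mixedValue_mixture {κ : Type*} [Fintype κ] {q : κ → ℝ} (hq : ∀ l, 0 ≤ q l)
    (hqs : ∑ l, q l = 1) (ρ : κ → MixedStrategy X) {g : (Fin 2 → PureStrategy X) → ℝ}
    (hg : Continuous g) (i : Fin 2) :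
    ∫ s, ∫ t, g (pair i s t) ∂(mixture q hq hqs ρ : Measure (PureStrategy X))
        ∂(mixture p hp hs τ : Measure (PureStrategy X)) =
      ∑ k, p k * ∑ l, q l * ∫ s, ∫ t, g (pair i s t) ∂(ρ l : Measure (PureStrategy X))
        ∂(τ k : Measure (PureStrategy X)) := by
  rw [integral_mixture hp hs τ (continuous_integral_pair i hg _)]
  refine Finset.sum_congr rfl fun k _ => ?_
  congr 1
  have h1 : ∀ s, Continuous fun t => g (pair i s t) := fun s =>
    hg.comp ((continuous_pair i).comp (continuous_const.prodMk continuous_id))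
  simp only [integral_mixture hq hqs ρ (h1 _)]
  rw [integral_finsetSum _ fun l _ =>
    (integrable_of_continuous (continuous_integral_pair i hg _)).const_mul _]
  exact Finset.sum_congr rfl fun l _ => integral_const_mul _ _

theorem integral_pair_mixture {κ : Type*} [Fintype κ] {q : κ → ℝ} (hq : ∀ l, 0 ≤ q l)
    (hqs : ∑ l, q l = 1) (ρ : κ → MixedStrategy X) {g : (Fin 2 → PureStrategy X) → ℝ}
    (hg : Continuous g) (i : Fin 2) (τ : MixedStrategy X) :
    ∫ s, ∫ t, g (pair i s t) ∂(mixture q hq hqs ρ : Measure (PureStrategy X))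
        ∂(τ : Measure (PureStrategy X)) =
      ∑ l, q l * ∫ s, ∫ t, g (pair i s t) ∂(ρ l : Measure (PureStrategy X))
        ∂(τ : Measure (PureStrategy X)) := by
  have h1 : ∀ s, Continuous fun t => g (pair i s t) := fun s =>
    hg.comp ((continuous_pair i).comp (continuous_const.prodMk continuous_id))
  simp only [integral_mixture hq hqs ρ (h1 _)]
  rw [integral_finsetSum _ fun l _ =>
    (integrable_of_continuous (continuous_integral_pair i hg _)).const_mul _]
  exact Finset.sum_congr rfl fun l _ => integral_const_mul _ _

/-- Approximate equilibria against finitely many deviations. -/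
theorem exists_approx_equilibrium [Nonempty ι] {G : Fin 2 → (Fin 2 → PureStrategy X) → ℝ}
    (hG : ∀ i, Continuous (G i)) {K : Fin 2 → Set (MixedStrategy X)}
    (hmix : ∀ (i : Fin 2) (p : ι → ℝ) (hp : ∀ k, 0 ≤ p k) (hs : ∑ k, p k = 1)
      (τ : ι → MixedStrategy X), (∀ k, τ k ∈ K i) → mixture p hp hs τ ∈ K i)
    (τ : Fin 2 → ι → MixedStrategy X) (hτ : ∀ i k, τ i k ∈ K i) {ε : ℝ} (hε : 0 < ε) :
    ∃ σ : Fin 2 → MixedStrategy X, (∀ i, σ i ∈ K i) ∧ ∀ i k,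
      mixedValue (G i) (Function.update σ i (τ i k)) ≤ mixedValue (G i) σ + ε := by
  -- The given mixed strategies become the pure actions of a bimatrix game. Its approximate
  -- equilibria are mixtures of them and stay in `K`.
  let A : ι → ι → ℝ := fun k l =>
    ∫ s, ∫ t, G 0 (pair 0 s t) ∂(τ 1 l : Measure (PureStrategy X)) ∂(τ 0 k : Measure _)
  let B : ι → ι → ℝ := fun k l =>
    ∫ s, ∫ t, G 1 (pair 1 s t) ∂(τ 0 k : Measure (PureStrategy X)) ∂(τ 1 l : Measure _)
  obtain ⟨p, q, hp, hps, hq, hqs, hA, hB⟩ := exists_approx_bimatrix_nash A B hε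
  let σ : Fin 2 → MixedStrategy X := fun i =>
    if i = 0 then mixture p hp hps (τ 0) else mixture q hq hqs (τ 1)
  have h0 : σ 0 = mixture p hp hps (τ 0) := rfl
  have h1 : σ 1 = mixture q hq hqs (τ 1) := rfl
  have o0 : opp 0 = 1 := rfl
  have o1 : opp 1 = 0 := rfl
  refine ⟨σ, fun i => ?_, fun i k => ?_⟩
  · fin_cases i
    · exact hmix 0 p hp hps _ fun k => hτ 0 k
    · exact hmix 1 q hq hqs _ fun k => hτ 1 k
  · rw [mixedValue_update_eq (hG i), mixedValue_eq (hG i) i]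
    fin_cases i
    · simp only [Fin.zero_eta, o0, h0, h1]
      rw [mixedValue_mixture hp hps (τ 0) hq hqs (τ 1) (hG 0),
        integral_pair_mixture hq hqs (τ 1) (hG 0)]
      exact hA k
    · simp only [Fin.mk_one, o1, h0, h1]
      rw [mixedValue_mixture hq hqs (τ 1) hp hps (τ 0) (hG 1),
        integral_pair_mixture hp hps (τ 0) (hG 1)]
      exact hB k

/-- Continuous payoffs have an equilibrium in closed sets of mixed strategies that are closed under
mixtures. -/
theorem exists_restricted_equilibrium {G : Fin 2 → (Fin 2 → PureStrategy X) → ℝ}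
    (hG : ∀ i, Continuous (G i)) {K : Fin 2 → Set (MixedStrategy X)}
    (hclosed : ∀ i, IsClosed (K i)) (hne : ∀ i, (K i).Nonempty)
    (hmix : ∀ {ι : Type} [Fintype ι] (i : Fin 2) (p : ι → ℝ) (hp : ∀ k, 0 ≤ p k)
      (hs : ∑ k, p k = 1) (τ : ι → MixedStrategy X), (∀ k, τ k ∈ K i) →
      mixture p hp hs τ ∈ K i) :
    ∃ σ : Fin 2 → MixedStrategy X, (∀ i, σ i ∈ K i) ∧ ∀ i, ∀ τ ∈ K i,
      mixedValue (G i) (Function.update σ i τ) ≤ mixedValue (G i) σ := by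
  choose base hbase using hne
  let S : Set (Fin 2 → MixedStrategy X) := {σ | ∀ i, σ i ∈ K i}
  have hS : IsCompact S := by
    have : IsClosed S := by
      have : S = ⋂ i, (fun σ : Fin 2 → MixedStrategy X => σ i) ⁻¹' K i := by
        ext σ; simp [S]
      rw [this]
      exact isClosed_iInter fun i => (hclosed i).preimage (continuous_apply i)
    exact this.isCompact
  -- An index is a pair of deviations with a tolerance 1/(n+1). Finitely many indices are handled by
  -- one approximate equilibrium at the smallest tolerance, and compactness gives a profile that
  -- satisfies all of them.
  let J := ((i : Fin 2) → K i) × ℕ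
  let C : J → Set (Fin 2 → MixedStrategy X) := fun j => {σ | ∀ i,
    mixedValue (G i) (Function.update σ i (j.1 i)) ≤ mixedValue (G i) σ + 1 / ((j.2 : ℝ) + 1)}
  have hC : ∀ j, IsClosed (C j) := by
    intro j
    have : C j = ⋂ i, {σ | mixedValue (G i) (Function.update σ i (j.1 i))
        ≤ mixedValue (G i) σ + 1 / ((j.2 : ℝ) + 1)} := by
      ext σ; simp [C]
    rw [this]
    refine isClosed_iInter fun i => isClosed_le ?_ ?_
    · exact (continuous_mixedValue (hG i)).comp (continuous_id.update i continuous_const)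
    · exact (continuous_mixedValue (hG i)).add continuous_const
  obtain ⟨σ, hσS, hσC⟩ := hS.inter_iInter_nonempty C hC fun u => by
    let N := u.sup fun j => j.2
    -- An extra index, so that the list of deviations is nonempty even when `u` is empty.
    let b : J := (fun i => ⟨base i, hbase i⟩, 0)
    let fam : Fin (u.toList.length + 1) → J := fun k => (b :: u.toList).get (k.cast (by simp))
    obtain ⟨σ, h1, h2⟩ := exists_approx_equilibrium (ι := Fin (u.toList.length + 1)) hG hmix
      (fun i k => ((fam k).1 i : MixedStrategy X)) (fun i k => ((fam k).1 i).2)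
      (ε := 1 / ((N : ℝ) + 1)) (by positivity)
    refine ⟨σ, h1, ?_⟩
    simp only [Set.mem_iInter]
    intro j hj i
    obtain ⟨k, hk⟩ : ∃ k, fam k = j := by
      have : j ∈ b :: u.toList := List.mem_cons_of_mem _ (Finset.mem_toList.2 hj)
      obtain ⟨k, hk⟩ := List.mem_iff_get.1 this
      exact ⟨k.cast (by simp), hk⟩
    have h3 := h2 i k
    rw [hk] at h3
    refine h3.trans ?_
    have : j.2 ≤ N := Finset.le_sup (f := fun j : J => j.2) hj
    gcongr
  refine ⟨σ, hσS, fun i τ hτ => le_of_forall_pos_le_add fun ε hε => ?_⟩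
  obtain ⟨n, hn⟩ := exists_nat_one_div_lt hε
  have h4 := Set.mem_iInter.1 hσC (Function.update (fun i => ⟨base i, hbase i⟩) i ⟨τ, hτ⟩, n) i
  simp only [Function.update_self] at h4
  linarith

end Restricted

/-! ### Cool-off strategies as a closed convex set -/

section CoolOffSet

variable {X : Type*}

theorem isClopen_act (n : ℕ) (a : Fin n → Profile) (x : Fin (n + 1) → X) (b : Act) :
    IsClopen {s : PureStrategy X | s n a x = b} :=
  (isClopen_discrete {b}).preimage (f := fun s : PureStrategy X => s n a x) (by fun_prop)

theorem isClopen_consistent (i : Fin 2) {n : ℕ} (a : Fin n → Profile) (x : Fin (n + 1) → X) :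
    IsClopen {s : PureStrategy X | Consistent i a x s} := by
  have : {s : PureStrategy X | Consistent i a x s} = ⋂ k : Fin n,
      {s | s k (Fin.take k k.is_lt.le a) (Fin.take (k + 1) (by omega) x) = a k i} := by
    ext s; simp [Consistent]
  rw [this]
  exact isClopen_iInter_of_finite fun k => isClopen_act _ _ _ _

theorem isClopen_consistent_act (i : Fin 2) {n : ℕ} (a : Fin n → Profile) (x : Fin (n + 1) → X)
    (b : Act) : IsClopen {s : PureStrategy X | Consistent i a x s ∧ s n a x = b} :=
  (isClopen_consistent i a x).inter (isClopen_act n a x b)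

theorem consistent_succ_iff (i : Fin 2) {n : ℕ} (a : Fin (n + 1) → Profile)
    (x : Fin (n + 2) → X) (s : PureStrategy X) :
    Consistent i a x s ↔ Consistent i (Fin.init a) (Fin.init x) s ∧
      s n (Fin.init a) (Fin.init x) = a (Fin.last n) i := by
  constructor
  · intro h
    exact ⟨fun k => h k.castSucc, h (Fin.last n)⟩
  · rintro ⟨h1, h2⟩ k
    refine Fin.lastCases ?_ (fun k => ?_) k
    · exact h2
    · exact h1 k

/-- The actions recorded in a history telescope to the probability of consistency. -/
theorem prod_actionProb (i : Fin 2) (σ : MixedStrategy X) : ∀ {n : ℕ} (a : Fin n → Profile)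
    (x : Fin (n + 1) → X),
    ∏ k : Fin n, actionProb i σ (Fin.take k k.is_lt.le a) (Fin.take (k + 1) (by omega) x) (a k i)
      = (σ : Measure (PureStrategy X)).real {s | Consistent i a x s} := by
  intro n
  induction n with
  | zero =>
    intro a x
    have : {s : PureStrategy X | Consistent i a x s} = Set.univ := by
      ext s; simp [Consistent]
    simp [this]
  | succ n ih =>
    intro a x
    rw [Fin.prod_univ_castSucc]
    have h1 := ih (Fin.init a) (Fin.init x)
    have h2 : ∏ k : Fin n, actionProb i σ (Fin.take k.castSucc k.castSucc.is_lt.le a)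
        (Fin.take (k.castSucc + 1) (by omega) x) (a k.castSucc i)
        = (σ : Measure (PureStrategy X)).real {s | Consistent i (Fin.init a) (Fin.init x) s} := h1
    rw [h2]
    have h3 : actionProb i σ (Fin.take (Fin.last n) (Fin.last n).is_lt.le a)
        (Fin.take (Fin.last n + 1) (by omega) x) (a (Fin.last n) i)
        = (σ : Measure (PureStrategy X)).real {s | Consistent i a x s} /
          (σ : Measure (PureStrategy X)).real {s | Consistent i (Fin.init a) (Fin.init x) s} := by
      simp only [consistent_succ_iff i a x]
      rfl
    rw [h3]
    -- If the shorter history has probability 0, then `actionProb` is 0 through division by zero;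
    -- the longer history also has probability 0.
    by_cases h0 : (σ : Measure (PureStrategy X)).real
        {s | Consistent i (Fin.init a) (Fin.init x) s} = 0
    · rw [h0, zero_mul]
      refine (le_antisymm ?_ measureReal_nonneg).symm
      rw [← h0]
      exact measureReal_mono fun s hs => ((consistent_succ_iff i a x s).1 hs).1
    · rw [mul_div_cancel₀ _ h0]

/-- The probability of the signals `u` in state `θ`. -/
noncomputable def signalWeight (f : State → PMF X) (θ : State) {n : ℕ} (u : Fin n → X) : ℝ :=
  ∏ k, (f θ (u k)).toReal

theorem signalWeight_nonneg (f : State → PMF X) (θ : State) {n : ℕ} (u : Fin n → X) :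
    0 ≤ signalWeight f θ u := Finset.prod_nonneg fun _ _ => ENNReal.toReal_nonneg

theorem toReal_pmf_pos {f : State → PMF X} (hf : ∀ θ x, 0 < f θ x) (θ : State) (x : X) :
    0 < (f θ x).toReal := ENNReal.toReal_pos (hf θ x).ne' ((f θ).apply_ne_top x)

theorem signalWeight_pos {f : State → PMF X} (hf : ∀ θ x, 0 < f θ x) (θ : State) {n : ℕ}
    (u : Fin n → X) : 0 < signalWeight f θ u := Finset.prod_pos fun _ _ => toReal_pmf_pos hf _ _

variable [Fintype X]

/-- The probability in state `θ` that player `i` takes the actions recorded in `a`, if the opponent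
does. -/
noncomputable def reachProb (f : State → PMF X) (θ : State) (i : Fin 2) (σ : MixedStrategy X)
    {n : ℕ} (a : Fin n → Profile) : ℝ :=
  ∑ x : Fin (n + 1) → X, signalWeight f θ x *
    (σ : Measure (PureStrategy X)).real {s | Consistent i a x s}

/-- The probability in state `θ` that player `i` takes the actions recorded in `a` and then
invests, if the opponent takes the actions recorded in `a`. -/
noncomputable def reachInvestProb (f : State → PMF X) (θ : State) (i : Fin 2)
    (σ : MixedStrategy X) {n : ℕ} (a : Fin n → Profile) : ℝ :=
  ∑ x : Fin (n + 1) → X, signalWeight f θ x *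
    (σ : Measure (PureStrategy X)).real {s | Consistent i a x s ∧ s n a x = Act.I}

theorem reachProb_nonneg (f : State → PMF X) (θ : State) (i : Fin 2) (σ : MixedStrategy X)
    {n : ℕ} (a : Fin n → Profile) : 0 ≤ reachProb f θ i σ a :=
  Finset.sum_nonneg fun _ _ => mul_nonneg (signalWeight_nonneg _ _ _) measureReal_nonneg

/-- The behavioural products telescope, so numerator and denominator are both linear in σ. This is
what makes the investment condition a linear inequality. -/
theorem investProbH_eq (f : State → PMF X) (i : Fin 2) (σ : MixedStrategy X) {n : ℕ}
    (a : Fin n → Profile) :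
    investProbH f i σ a = reachInvestProb f State.H i σ a / reachProb f State.H i σ a := by
  have hw : ∀ x, weightH f i σ a x = signalWeight f State.H x *
      (σ : Measure (PureStrategy X)).real {s | Consistent i a x s} := by
    intro x
    rw [weightH, prod_actionProb]
    rfl
  rw [investProbH]
  simp only [hw, reachProb, reachInvestProb]
  congr 1
  refine Finset.sum_congr rfl fun x _ => ?_
  rw [mul_assoc]
  congr 1
  rw [actionProb]
  by_cases h0 : (σ : Measure (PureStrategy X)).real {s | Consistent i a x s} = 0
  · rw [h0, zero_mul]
    refine (le_antisymm ?_ measureReal_nonneg).symm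
    rw [← h0]
    exact measureReal_mono fun s hs => hs.1
  · rw [mul_div_cancel₀ _ h0]

/-- All signals have positive weight, and a consistency event, being open, has positive measure as
soon as it meets the support. -/
theorem consistentMixed_iff {f : State → PMF X} (hf : ∀ θ x, 0 < f θ x) (θ : State) (i : Fin 2)
    (σ : MixedStrategy X) {n : ℕ} (a : Fin n → Profile) :
    ConsistentMixed i σ a ↔ 0 < reachProb f θ i σ a := by
  constructor
  · rintro ⟨x, s, hs, hc⟩
    refine Finset.sum_pos' (fun _ _ => mul_nonneg (signalWeight_nonneg _ _ _) measureReal_nonneg)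
      ⟨x, Finset.mem_univ _, mul_pos (signalWeight_pos hf _ _) ?_⟩
    rw [measureReal_def]
    exact ENNReal.toReal_pos ((Measure.mem_support_iff_forall s).1 hs _
      ((isClopen_consistent i a x).isOpen.mem_nhds hc)).ne' (measure_ne_top _ _)
  · intro h
    obtain ⟨x, -, hx⟩ := Finset.exists_ne_zero_of_sum_ne_zero h.ne'
    have h1 : 0 < (σ : Measure (PureStrategy X)) {s | Consistent i a x s} := by
      rw [pos_iff_ne_zero]
      intro h0
      apply hx
      rw [measureReal_def, h0]
      simp
    obtain ⟨s, hs, hs2⟩ := Measure.nonempty_inter_support_of_pos h1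
    exact ⟨x, s, hs2, hs⟩

theorem ae_mem_pureCoolOff {T : ℕ → ℕ} {σ : MixedStrategy X} (h : σ ∈ mixedCoolOff X T) :
    ∀ᵐ s ∂(σ : Measure (PureStrategy X)), s ∈ pureCoolOff X T :=
  Filter.mem_of_superset Measure.support_mem_ae h

/-- Replaces the support by null events of single coordinates, which are clopen, so that the
condition is visibly closed and stable under mixtures. -/
theorem mem_mixedCoolOff_iff (T : ℕ → ℕ) (σ : MixedStrategy X) :
    σ ∈ mixedCoolOff X T ↔ ∀ (n : ℕ) (a : Fin n → Profile) (x : Fin (n + 1) → X),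
      IsCoolOff T a ∨ HasViolation T a →
      (σ : Measure (PureStrategy X)).real {s | s n a x = Act.I} = 0 := by
  constructor
  · intro h n a x hax
    rw [measureReal_eq_zero_iff]
    refine measure_mono_null ?_ (ae_mem_pureCoolOff h)
    rintro s hs hs2
    have h2 : s n a x = Act.N := hax.elim (hs2.1 n a x) (hs2.2 n a x)
    exact absurd (h2.symm.trans hs) (by simp)
  · intro h s hs
    have key : ∀ (n : ℕ) (a : Fin n → Profile) (x : Fin (n + 1) → X),
        IsCoolOff T a ∨ HasViolation T a → s n a x = Act.N := by
      intro n a x hax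
      by_contra hcon
      have h1 := (Measure.mem_support_iff_forall s).1 hs _
        ((isClopen_act n a x Act.I).isOpen.mem_nhds (act_ne_N_iff.1 hcon))
      have h2 := h n a x hax
      rw [measureReal_eq_zero_iff] at h2
      exact h1.ne' h2
    exact ⟨fun n a x ha => key n a x (Or.inl ha), fun n a x ha => key n a x (Or.inr ha)⟩

/-- With the denominator cleared, the restriction to consistent histories can be dropped: at the
others the left side is 0. -/
theorem mem_coolOffStrategies_iff {f : State → PMF X} (hf : ∀ θ x, 0 < f θ x) (T : ℕ → ℕ) (ε : ℝ)
    (i : Fin 2) (σ : MixedStrategy X) : σ ∈ coolOffStrategies f T ε i ↔ σ ∈ mixedCoolOff X T ∧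
      ∀ (n : ℕ) (a : Fin n → Profile), IsInvestment T a → ¬ HasViolation T a →
        (1 - ε) * reachProb f State.H i σ a ≤ reachInvestProb f State.H i σ a := by
  refine and_congr_right fun _ => forall_congr' fun n => forall_congr' fun a =>
    forall_congr' fun _ => forall_congr' fun _ => ?_
  rw [investProbH_eq, consistentMixed_iff hf State.H]
  constructor
  · intro h
    rcases (reachProb_nonneg f State.H i σ a).lt_or_eq with h0 | h0
    · exact (le_div_iff₀ h0).1 (h h0)
    · rw [← h0, mul_zero]
      exact Finset.sum_nonneg fun _ _ =>
        mul_nonneg (signalWeight_nonneg _ _ _) measureReal_nonneg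
  · intro h h0
    exact (le_div_iff₀ h0).2 h

/-- The indicator of a clopen set is continuous, so this is weak convergence tested on one function.
-/
theorem continuous_real_of_isClopen {S : Set (PureStrategy X)} (hS : IsClopen S) :
    Continuous fun σ : MixedStrategy X => (σ : Measure (PureStrategy X)).real S := by
  have h := ProbabilityMeasure.continuous_integral_continuousMap (X := PureStrategy X)
    (⟨LocallyConstant.charFn ℝ hS, (LocallyConstant.charFn ℝ hS).continuous⟩ :
      C(PureStrategy X, ℝ))
  convert! h using 2 with σ
  simp only [ContinuousMap.coe_mk, LocallyConstant.coe_charFn]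
  rw [← integral_indicator_one hS.isOpen.measurableSet]

theorem continuous_reachProb (f : State → PMF X) (θ : State) (i : Fin 2) {n : ℕ}
    (a : Fin n → Profile) : Continuous fun σ : MixedStrategy X => reachProb f θ i σ a :=
  continuous_finsetSum _ fun x _ =>
    (continuous_real_of_isClopen (isClopen_consistent i a x)).const_mul _

theorem continuous_reachInvestProb (f : State → PMF X) (θ : State) (i : Fin 2) {n : ℕ}
    (a : Fin n → Profile) : Continuous fun σ : MixedStrategy X => reachInvestProb f θ i σ a :=
  continuous_finsetSum _ fun x _ =>
    (continuous_real_of_isClopen (isClopen_consistent_act i a x Act.I)).const_mul _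

theorem isClosed_coolOffStrategies {f : State → PMF X} (hf : ∀ θ x, 0 < f θ x) (T : ℕ → ℕ)
    (ε : ℝ) (i : Fin 2) : IsClosed (coolOffStrategies f T ε i) := by
  have : coolOffStrategies f T ε i =
      (⋂ (n : ℕ) (a : Fin n → Profile) (x : Fin (n + 1) → X)
        (_ : IsCoolOff T a ∨ HasViolation T a),
        {σ : MixedStrategy X | (σ : Measure (PureStrategy X)).real {s | s n a x = Act.I} = 0}) ∩
      ⋂ (n : ℕ) (a : Fin n → Profile) (_ : IsInvestment T a) (_ : ¬ HasViolation T a),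
        {σ : MixedStrategy X |
          (1 - ε) * reachProb f State.H i σ a ≤ reachInvestProb f State.H i σ a} := by
    ext σ
    rw [mem_coolOffStrategies_iff hf, mem_mixedCoolOff_iff]
    simp only [Set.mem_inter_iff, Set.mem_iInter, Set.mem_ofPred_eq]
  rw [this]
  refine IsClosed.inter ?_ ?_
  · exact isClosed_iInter fun n => isClosed_iInter fun a => isClosed_iInter fun x =>
      isClosed_iInter fun _ => isClosed_eq
        (continuous_real_of_isClopen (isClopen_act n a x Act.I)) continuous_const
  · exact isClosed_iInter fun n => isClosed_iInter fun a => isClosed_iInter fun _ =>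
      isClosed_iInter fun _ => isClosed_le ((continuous_reachProb f _ i a).const_mul _)
        (continuous_reachInvestProb f _ i a)

theorem mixture_mem_coolOffStrategies {f : State → PMF X} (hf : ∀ θ x, 0 < f θ x) (T : ℕ → ℕ)
    (ε : ℝ) {ι : Type*} [Fintype ι] (i : Fin 2) (p : ι → ℝ) (hp : ∀ k, 0 ≤ p k)
    (hs : ∑ k, p k = 1) (τ : ι → MixedStrategy X) (hτ : ∀ k, τ k ∈ coolOffStrategies f T ε i) :
    mixture p hp hs τ ∈ coolOffStrategies f T ε i := by
  have h := fun k => (mem_coolOffStrategies_iff hf T ε i (τ k)).1 (hτ k)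
  rw [mem_coolOffStrategies_iff hf, mem_mixedCoolOff_iff]
  refine ⟨fun n a x hax => ?_, fun n a h1 h2 => ?_⟩
  · rw [real_mixture]
    exact Finset.sum_eq_zero fun k _ => by
      rw [(mem_mixedCoolOff_iff T (τ k)).1 (h k).1 n a x hax, mul_zero]
  · have e1 : reachProb f State.H i (mixture p hp hs τ) a =
        ∑ k, p k * reachProb f State.H i (τ k) a := by
      simp only [reachProb, real_mixture, Finset.mul_sum]
      rw [Finset.sum_comm]
      exact Finset.sum_congr rfl fun k _ => Finset.sum_congr rfl fun x _ => by ring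
    have e2 : reachInvestProb f State.H i (mixture p hp hs τ) a =
        ∑ k, p k * reachInvestProb f State.H i (τ k) a := by
      simp only [reachInvestProb, real_mixture, Finset.mul_sum]
      rw [Finset.sum_comm]
      exact Finset.sum_congr rfl fun k _ => Finset.sum_congr rfl fun x _ => by ring
    rw [e1, e2, Finset.mul_sum]
    refine Finset.sum_le_sum fun k _ => ?_
    rw [mul_left_comm]
    exact mul_le_mul_of_nonneg_left ((h k).2 n a h1 h2) (hp k)

/-- A pure strategy as a degenerate mixed strategy. -/
noncomputable def diracStrategy (s : PureStrategy X) : MixedStrategy X :=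
  ⟨Measure.dirac s, inferInstance⟩

open Classical in
theorem real_diracStrategy (s : PureStrategy X) {S : Set (PureStrategy X)} (hS : IsClopen S) :
    (diracStrategy s : Measure (PureStrategy X)).real S = if s ∈ S then 1 else 0 := by
  change (Measure.dirac s).real S = _
  rw [measureReal_def, Measure.dirac_apply' _ hS.isOpen.measurableSet]
  by_cases h : s ∈ S <;> simp [h]

theorem diracStrategy_mem_mixedCoolOff {T : ℕ → ℕ} {s : PureStrategy X}
    (hs : s ∈ pureCoolOff X T) : diracStrategy s ∈ mixedCoolOff X T := by
  classical
  rw [mem_mixedCoolOff_iff]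
  intro n a x hax
  have h2 : s n a x = Act.N := hax.elim (hs.1 n a x) (hs.2 n a x)
  rw [real_diracStrategy s (isClopen_act n a x Act.I), if_neg]
  simp [h2]

open Classical in
/-- Invest at every investment history without violation. -/
noncomputable def alwaysInvest (X : Type*) (T : ℕ → ℕ) : PureStrategy X := fun _ a _ =>
  if IsInvestment T a ∧ ¬ HasViolation T a then Act.I else Act.N

theorem nonempty_coolOffStrategies {f : State → PMF X} (hf : ∀ θ x, 0 < f θ x) (T : ℕ → ℕ)
    {ε : ℝ} (hε : 0 < ε) (i : Fin 2) : (coolOffStrategies f T ε i).Nonempty := by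
  classical
  refine ⟨diracStrategy (alwaysInvest X T), ?_⟩
  rw [mem_coolOffStrategies_iff hf]
  refine ⟨diracStrategy_mem_mixedCoolOff ⟨fun n a x h => ?_, fun n a x h => ?_⟩,
    fun n a h1 h2 => ?_⟩
  · exact if_neg fun h' => h h'.1
  · exact if_neg fun h' => h'.2 h
  · have : reachInvestProb f State.H i (diracStrategy (alwaysInvest X T)) a =
        reachProb f State.H i (diracStrategy (alwaysInvest X T)) a := by
      refine Finset.sum_congr rfl fun x _ => ?_
      congr 1
      rw [real_diracStrategy _ (isClopen_consistent i a x),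
        real_diracStrategy _ (isClopen_consistent_act i a x Act.I)]
      have h3 : alwaysInvest X T n a x = Act.I := if_pos ⟨h1, h2⟩
      simp [h3]
    rw [this]
    nlinarith [reachProb_nonneg f State.H i (diracStrategy (alwaysInvest X T)) a]

end CoolOffSet

/-! ### Laws of finitely many signals -/

section Signals

variable {X : Type*} [Fintype X] [MeasurableSpace X] [MeasurableSingletonClass X]

omit [Fintype X] [MeasurableSingletonClass X] in
theorem measurable_own (i : Fin 2) (n : ℕ) :
    Measurable (own i n : (ℕ → Fin 2 → X) → Fin n → X) := by
  unfold own
  fun_prop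

omit [Fintype X] in
theorem signalLaw_own (f : State → PMF X) (θ : State) (i : Fin 2) {n : ℕ} (u v : Fin n → X) :
    (signalLaw f θ).real {x | own i n x = u ∧ own (opp i) n x = v} =
      signalWeight f θ u * signalWeight f θ v := by
  classical
  let t : ℕ → Set (Fin 2 → X) := fun k =>
    if h : k < n then Set.univ.pi fun j => if j = i then {u ⟨k, h⟩} else {v ⟨k, h⟩} else Set.univ
  have h1 : {x : ℕ → Fin 2 → X | own i n x = u ∧ own (opp i) n x = v} =
      Set.pi (Finset.range n) t := by
    ext x
    constructor
    · rintro ⟨h1, h2⟩ k hk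
      have hk' : k < n := Finset.mem_range.1 hk
      simp only [t, hk', dif_pos, Set.mem_pi, Set.mem_univ, forall_true_left]
      intro j
      rcases eq_or_eq_opp i j with rfl | rfl
      · rw [if_pos rfl]
        exact congrFun h1 ⟨k, hk'⟩
      · rw [if_neg (opp_ne i)]
        exact congrFun h2 ⟨k, hk'⟩
    · intro h
      have key : ∀ k : Fin n, x k i = u k ∧ x k (opp i) = v k := by
        intro k
        have h3 := h k (Finset.mem_coe.2 (Finset.mem_range.2 k.is_lt))
        simp only [t, k.is_lt, dif_pos, Set.mem_pi, Set.mem_univ, forall_true_left] at h3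
        have h4 := h3 i
        have h5 := h3 (opp i)
        rw [if_pos rfl] at h4
        rw [if_neg (opp_ne i)] at h5
        exact ⟨h4, h5⟩
      exact ⟨funext fun k => (key k).1, funext fun k => (key k).2⟩
  have hmeas : ∀ k ∈ Finset.range n, MeasurableSet (t k) := by
    intro k hk
    simp only [t, Finset.mem_range.1 hk, dif_pos]
    exact MeasurableSet.univ_pi fun j => by
      by_cases hj : j = i <;> simp [hj]
  rw [h1, measureReal_def, signalLaw, Measure.infinitePi_pi _ hmeas, ENNReal.toReal_prod,
    Finset.prod_range, signalWeight, signalWeight, ← Finset.prod_mul_distrib]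
  refine Finset.prod_congr rfl fun k _ => ?_
  simp only [t, k.is_lt, dif_pos]
  rw [Measure.pi_pi]
  have h2 : (Finset.univ : Finset (Fin 2)) = {i, opp i} := by
    ext k; simpa using eq_or_eq_opp i k
  rw [h2, Finset.prod_pair (opp_ne i).symm, if_pos rfl, if_neg (opp_ne i),
    PMF.toMeasure_apply_singleton _ _ (measurableSet_singleton _),
    PMF.toMeasure_apply_singleton _ _ (measurableSet_singleton _), ENNReal.toReal_mul]

theorem integral_own (f : State → PMF X) (θ : State) (i : Fin 2) {n : ℕ}
    (g : (Fin n → X) → (Fin n → X) → ℝ) :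
    ∫ x, g (own i n x) (own (opp i) n x) ∂(signalLaw f θ) =
      ∑ u, ∑ v, signalWeight f θ u * signalWeight f θ v * g u v := by
  have hm : Measurable fun x : ℕ → Fin 2 → X => (own i n x, own (opp i) n x) :=
    (measurable_own i n).prodMk (measurable_own (opp i) n)
  have hmap := integral_map (μ := signalLaw f θ) hm.aemeasurable
    (f := fun p : (Fin n → X) × (Fin n → X) => g p.1 p.2)
    (measurable_of_finite _).aestronglyMeasurable
  have : IsProbabilityMeasure ((signalLaw f θ).map fun x => (own i n x, own (opp i) n x)) :=
    Measure.isProbabilityMeasure_map hm.aemeasurable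
  rw [← hmap, integral_fintype (Integrable.of_finite), Fintype.sum_prod_type]
  refine Finset.sum_congr rfl fun u _ => Finset.sum_congr rfl fun v _ => ?_
  rw [map_measureReal_apply hm (measurableSet_singleton _), smul_eq_mul, ← signalLaw_own f θ i]
  congr 2
  ext x
  simp [Prod.ext_iff]

omit [MeasurableSpace X] [MeasurableSingletonClass X] in
theorem sum_toReal_pmf (q : PMF X) : ∑ x, (q x).toReal = 1 := by
  rw [← ENNReal.toReal_sum fun x _ => q.apply_ne_top x, ← tsum_fintype (L := .unconditional _),
    q.tsum_coe, ENNReal.toReal_one]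

omit [MeasurableSpace X] [MeasurableSingletonClass X] in
theorem sum_prod_pi (w : X → ℝ) (n : ℕ) :
    ∑ u : Fin n → X, ∏ k, w (u k) = (∑ x, w x) ^ n := by
  classical
  have := Finset.prod_univ_sum (fun _ : Fin n => (Finset.univ : Finset X)) (fun _ x => w x)
  simp only [Finset.prod_const, Finset.card_univ, Fintype.card_fin, Fintype.piFinset_univ] at this
  exact this.symm

omit [MeasurableSpace X] [MeasurableSingletonClass X] in
theorem sum_signalWeight (f : State → PMF X) (θ : State) (n : ℕ) :
    ∑ u : Fin n → X, signalWeight f θ u = 1 := by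
  simp only [signalWeight]
  rw [sum_prod_pi (fun x => (f θ x).toReal), sum_toReal_pmf, one_pow]

end Signals

/-! ### One-shot deviations -/

section OneShot

/-- After a failure to invest jointly in an investment phase there are `T` cool-off periods. -/
theorem lastInvestment_of_failure (T : ℕ → ℕ) {n : ℕ} : ∀ {k : ℕ} (a : Fin k → Profile)
    (hnk : n < k), IsInvestment T (Fin.take n hnk.le a) → a ⟨n, hnk⟩ ≠ (fun _ => Act.I) →
    k ≤ max (n + 1) (n + T (n + 1)) → lastInvestment T k a = some n := by
  intro k
  induction k with
  | zero => intro a hnk; omega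
  | succ k ih =>
    intro a hnk hinv hne hk
    rcases Nat.lt_succ_iff_lt_or_eq.1 hnk with h | h
    · have h1 := ih (Fin.init a) h hinv hne (by omega)
      simp only [lastInvestment, h1]
      rw [if_neg h.ne, if_pos (by omega)]
    · subst h
      have h1 : lastInvestment T n (Fin.init a) = some n := hinv
      simp only [lastInvestment, h1]
      rw [if_pos trivial, if_neg (show ¬ a (Fin.last n) = _ from hne)]

variable {X : Type*}

open Classical in
/-- The strategy that follows `s`, except that at the private history `(a, y)` it invests, and
after that never again. -/
noncomputable def deviate (s : PureStrategy X) {n : ℕ} (a : Fin n → Profile)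
    (y : Fin (n + 1) → X) : PureStrategy X := fun k b x =>
  if ∃ h : n ≤ k, Fin.take n h b = a ∧ Fin.take (n + 1) (by omega) x = y then
    (if k = n then Act.I else Act.N) else s k b x

variable (i : Fin 2) (s t : PureStrategy X) {n : ℕ} (a : Fin n → Profile) (y : Fin (n + 1) → X)
  (x : ℕ → Fin 2 → X)

theorem path_congr_of_hist {s s' t : PureStrategy X} {k : ℕ}
    (hh : hist (pair i s' t) x k = hist (pair i s t) x k)
    (ha : s' k (hist (pair i s t) x k) (own i (k + 1) x) =
      s k (hist (pair i s t) x k) (own i (k + 1) x)) :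
    path (pair i s' t) x k = path (pair i s t) x k := by
  refine profile_ext (i := i) ?_ ?_
  · rw [path_apply, path_apply, hh, pair_self, pair_self, ha]
  · rw [path_apply, path_apply, hh, pair_opp, pair_opp]

theorem hist_deviate_of_le {k : ℕ} (hk : k ≤ n) :
    hist (pair i (deviate s a y) t) x k = hist (pair i s t) x k := by
  induction k with
  | zero => rfl
  | succ k ih =>
    have ih' := ih (by omega)
    rw [hist_succ, hist_succ, ih', path_congr_of_hist i x ih' ?_]
    rw [deviate, if_neg]
    rintro ⟨h, -⟩
    omega

theorem hist_deviate_of_ne (h : ¬ (own i (n + 1) x = y ∧ hist (pair i s t) x n = a)) (k : ℕ) :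
    hist (pair i (deviate s a y) t) x k = hist (pair i s t) x k ∧
      path (pair i (deviate s a y) t) x k = path (pair i s t) x k := by
  have hp : ∀ k, hist (pair i (deviate s a y) t) x k = hist (pair i s t) x k →
      path (pair i (deviate s a y) t) x k = path (pair i s t) x k := by
    intro k hk
    refine path_congr_of_hist i x hk ?_
    rw [deviate, if_neg]
    rintro ⟨h1, h2, h3⟩
    rw [take_hist] at h2
    exact h ⟨h3, h2⟩
  have hh : hist (pair i (deviate s a y) t) x k = hist (pair i s t) x k := by
    induction k with
    | zero => rfl
    | succ k ih => rw [hist_succ, hist_succ, ih, hp k ih]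
  exact ⟨hh, hp k hh⟩

theorem path_deviate_of_eq (h : own i (n + 1) x = y ∧ hist (pair i s t) x n = a) {k : ℕ}
    (hk : n ≤ k) : path (pair i (deviate s a y) t) x k i = if k = n then Act.I else Act.N := by
  rw [path_apply, pair_self, deviate, if_pos]
  refine ⟨hk, ?_, h.1⟩
  rw [take_hist, hist_deviate_of_le i s t a y x le_rfl]
  exact h.2

variable {c δ : ℝ} {T : ℕ → ℕ}

open Classical in
/-- Payoff gain from deviating at an investment history at which `s` does not invest. -/
theorem longRunPayoff_deviate_sub (hc : c ∈ Set.Ioo (0 : ℝ) 1) (h0 : 0 < δ) (h1 : δ < 1)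
    (θ : State) (hs : s ∈ pureCoolOff X T) (ha : IsInvestment T a)
    (hcons : Consistent i a y s) (hN : s n a y = Act.N) :
    (if own i (n + 1) x = y then
      (if Consistent (opp i) a (own (opp i) (n + 1) x) t then
        (1 - δ) * δ ^ n * ((if θ = State.H ∧ t n a (own (opp i) (n + 1) x) = Act.I then 1 else 0)
          - c) - δ ^ (n + T (n + 1) + 1) else 0) else 0) ≤
      longRunPayoff c δ i (θ, x, path (pair i (deviate s a y) t) x) -
        longRunPayoff c δ i (θ, x, path (pair i s t) x) := by
  by_cases hx : own i (n + 1) x = y ∧ hist (pair i s t) x n = a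
  · obtain ⟨hx1, hx2⟩ := hx
    have hc2 := ((hist_eq_iff i s t x a).1 hx2).2
    rw [if_pos hx1, if_pos hc2]
    simp only [longRunPayoff_eq]
    have hpn : path (pair i s t) x n i = Act.N := by
      rw [path_apply, pair_self, hx2, hx1, hN]
    have hpn' : path (pair i (deviate s a y) t) x n i = Act.I := by
      rw [path_deviate_of_eq i s t a y x ⟨hx1, hx2⟩ le_rfl, if_pos rfl]
    have hlater : ∀ k, n < k →
        stagePayoff c θ (path (pair i (deviate s a y) t) x k) i = 0 := by
      intro k hk
      apply stagePayoff_of_N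
      rw [path_deviate_of_eq i s t a y x ⟨hx1, hx2⟩ hk.le, if_neg hk.ne']
    refine discounted_sub_ge h0 h1 (fun _ => abs_stagePayoff_le hc _ _ _)
      (fun _ => abs_stagePayoff_le hc _ _ _) (by omega) ?_ ?_ ?_
    · rw [stagePayoff_of_N hpn, stagePayoff_of_I hpn', zero_add, path_apply _ _ _ (opp i),
        pair_opp, hist_deviate_of_le i s t a y x le_rfl, hx2]
    · intro k hkn hkm
      rcases lt_or_gt_of_ne hkn with hk | hk
      · have e1 := hist_deviate_of_le i s t a y x hk.le
        have e2 : path (pair i (deviate s a y) t) x k = path (pair i s t) x k := by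
          refine path_congr_of_hist i x e1 ?_
          rw [deviate, if_neg]
          rintro ⟨h, -⟩
          omega
        rw [e2]
      · rw [hlater k hk, stagePayoff_of_N]
        rw [path_apply, pair_self]
        -- The failure of `s` to invest at `a` starts a cool-off phase, during which `s` itself
        -- plays `N` and earns 0, just like the deviation.
        refine hs.1 k _ _ ?_
        have hlast := lastInvestment_of_failure T (hist (pair i s t) x k) hk
          (by rw [take_hist, hx2]; exact ha)
          (by
            rw [hist_apply]
            intro h
            have := congrFun h i
            simp only [hpn] at this
            exact absurd this (by simp))
          (by omega)
        intro hinv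
        rw [IsInvestment, hlast] at hinv
        exact hk.ne (Option.some.inj hinv)
    -- After that phase the deviation earns 0 and `s` at most 1 per period; no control of the
    -- continuation is needed.
    · intro k hk
      rw [hlater k (by omega)]
      linarith [(abs_le.1 (abs_stagePayoff_le hc θ (path (pair i s t) x k) i)).2]
  · have e : path (pair i (deviate s a y) t) x = path (pair i s t) x :=
      funext fun k => (hist_deviate_of_ne i s t a y x hx k).2
    rw [e, sub_self]
    by_cases hx1 : own i (n + 1) x = y
    · have hx2 : ¬ Consistent (opp i) a (own (opp i) (n + 1) x) t := fun hx2 =>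
        hx ⟨hx1, (hist_eq_iff i s t x a).2 ⟨by rw [hx1]; exact hcons, hx2⟩⟩
      rw [if_pos hx1, if_neg hx2]
    · rw [if_neg hx1]

variable [Fintype X] [MeasurableSpace X] [MeasurableSingletonClass X]

-- Given the state, own signals are independent of the opponent's. The weight of `y` factors out,
-- and the opponent enters only through signals at which `t` is consistent with `a`.
open Classical in
theorem pureValue_deviate_sub (f : State → PMF X) (hc : c ∈ Set.Ioo (0 : ℝ) 1) (h0 : 0 < δ)
    (h1 : δ < 1) (θ : State) (hs : s ∈ pureCoolOff X T) (ha : IsInvestment T a)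
    (hcons : Consistent i a y s) (hN : s n a y = Act.N) :
    signalWeight f θ y * ∑ v : Fin (n + 1) → X, signalWeight f θ v *
      (if Consistent (opp i) a v t then
        (1 - δ) * δ ^ n * ((if θ = State.H ∧ t n a v = Act.I then 1 else 0)
          - c) - δ ^ (n + T (n + 1) + 1) else 0) ≤
      pureValue f c δ θ i (pair i (deviate s a y) t) - pureValue f c δ θ i (pair i s t) := by
  have h2 := integral_own f θ i (n := n + 1) fun u v => if u = y then
      (if Consistent (opp i) a v t then
        (1 - δ) * δ ^ n * ((if θ = State.H ∧ t n a v = Act.I then 1 else 0)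
          - c) - δ ^ (n + T (n + 1) + 1) else 0) else 0
  have h3 : ∑ u, ∑ v, signalWeight f θ u * signalWeight f θ v * (if u = y then
      (if Consistent (opp i) a v t then
        (1 - δ) * δ ^ n * ((if θ = State.H ∧ t n a v = Act.I then 1 else 0)
          - c) - δ ^ (n + T (n + 1) + 1) else 0) else 0) =
      signalWeight f θ y * ∑ v : Fin (n + 1) → X, signalWeight f θ v *
      (if Consistent (opp i) a v t then
        (1 - δ) * δ ^ n * ((if θ = State.H ∧ t n a v = Act.I then 1 else 0)
          - c) - δ ^ (n + T (n + 1) + 1) else 0) := by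
    rw [Finset.sum_eq_single y]
    · rw [Finset.mul_sum]
      simp only [if_true, mul_assoc]
    · intro u _ hu
      simp [hu]
    · simp
  rw [← h3, ← h2, pureValue, pureValue, ← integral_sub
    (integrable_longRunPayoff_path hc h0 h1 i θ _ _)
    (integrable_longRunPayoff_path hc h0 h1 i θ _ _)]
  refine integral_mono ?_ ?_ fun x => longRunPayoff_deviate_sub i s t a y x hc h0 h1 θ hs ha hcons hN
  · have hm : Measurable fun x : ℕ → Fin 2 → X => (own i (n + 1) x, own (opp i) (n + 1) x) :=
      (measurable_own i _).prodMk (measurable_own (opp i) _)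
    have : IsProbabilityMeasure ((signalLaw f θ).map
        fun x => (own i (n + 1) x, own (opp i) (n + 1) x)) :=
      Measure.isProbabilityMeasure_map hm.aemeasurable
    have hint : Integrable (fun p : (Fin (n + 1) → X) × (Fin (n + 1) → X) => if p.1 = y then
      (if Consistent (opp i) a p.2 t then
        (1 - δ) * δ ^ n * ((if θ = State.H ∧ t n a p.2 = Act.I then 1 else 0)
          - c) - δ ^ (n + T (n + 1) + 1) else 0) else 0)
        ((signalLaw f θ).map fun x => (own i (n + 1) x, own (opp i) (n + 1) x)) :=
      Integrable.of_finite
    exact hint.comp_measurable hm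
  · exact (integrable_longRunPayoff_path hc h0 h1 i θ _ _).sub
      (integrable_longRunPayoff_path hc h0 h1 i θ _ _)

end OneShot

/-! ### Best responses and beliefs -/

section BestResponse

variable {X : Type*} [Fintype X] [MeasurableSpace X] [MeasurableSingletonClass X]

/-- Ex-ante payoff of player `i` from the pure strategy `s` against the mixed strategy `ν`. -/
noncomputable def valueAgainst (p₀ : ℝ) (f : State → PMF X) (c δ : ℝ) (i : Fin 2)
    (ν : MixedStrategy X) (s : PureStrategy X) : ℝ :=
  ∫ t, exAnteValue p₀ f c δ i (pair i s t) ∂(ν : Measure (PureStrategy X))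

/-- `s` is a best response of player `i` to `ν`. -/
def IsBestResponse (p₀ : ℝ) (f : State → PMF X) (c δ : ℝ) (i : Fin 2) (ν : MixedStrategy X)
    (s : PureStrategy X) : Prop :=
  ∀ s', valueAgainst p₀ f c δ i ν s' ≤ valueAgainst p₀ f c δ i ν s

variable {c δ p₀ : ℝ} {T : ℕ → ℕ}

omit [MeasurableSpace X] [MeasurableSingletonClass X] in
open Classical in
theorem integral_gain (f : State → PMF X) (θ : State) (j : Fin 2) (ν : MixedStrategy X) {n : ℕ}
    (a : Fin n → Profile) (A B c : ℝ) :
    Integrable (fun t => ∑ v : Fin (n + 1) → X, signalWeight f θ v *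
      (if Consistent j a v t then
      A * ((if θ = State.H ∧ t n a v = Act.I then 1 else 0) - c) - B else 0))
      (ν : Measure (PureStrategy X)) ∧
    ∫ t, ∑ v : Fin (n + 1) → X, signalWeight f θ v * (if Consistent j a v t then
      A * ((if θ = State.H ∧ t n a v = Act.I then 1 else 0) - c) - B else 0)
      ∂(ν : Measure (PureStrategy X)) =
    A * ((if θ = State.H then 1 else 0) * reachInvestProb f θ j ν a)
      - (A * c + B) * reachProb f θ j ν a := by
  have hI : ∀ v : Fin (n + 1) → X, Integrable
      (({s : PureStrategy X | Consistent j a v s ∧ s n a v = Act.I}).indicator (1 : PureStrategy X → ℝ))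
      (ν : Measure (PureStrategy X)) := fun v =>
    (integrable_const (1 : ℝ)).indicator (isClopen_consistent_act j a v Act.I).isOpen.measurableSet
  have hC : ∀ v : Fin (n + 1) → X, Integrable
      (({s : PureStrategy X | Consistent j a v s}).indicator (1 : PureStrategy X → ℝ))
      (ν : Measure (PureStrategy X)) := fun v =>
    (integrable_const (1 : ℝ)).indicator (isClopen_consistent j a v).isOpen.measurableSet
  have hpt : ∀ (v : Fin (n + 1) → X) (t : PureStrategy X), (if Consistent j a v t then
      A * ((if θ = State.H ∧ t n a v = Act.I then 1 else 0) - c) - B else 0) =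
      A * (if θ = State.H then 1 else 0) *
        ({s : PureStrategy X | Consistent j a v s ∧ s n a v = Act.I}).indicator (1 : PureStrategy X → ℝ) t -
      (A * c + B) * ({s : PureStrategy X | Consistent j a v s}).indicator (1 : PureStrategy X → ℝ) t := by
    intro v t
    by_cases h1 : Consistent j a v t <;> by_cases h2 : t n a v = Act.I <;>
      by_cases h3 : θ = State.H <;> simp [h1, h2, h3]
    all_goals ring
  simp only [hpt]
  refine ⟨integrable_finsetSum _ fun v _ =>
    (((hI v).const_mul _).sub ((hC v).const_mul _)).const_mul _, ?_⟩
  rw [integral_finsetSum]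
  · simp only [reachInvestProb, reachProb, Finset.mul_sum, ← Finset.sum_sub_distrib]
    refine Finset.sum_congr rfl fun v _ => ?_
    rw [integral_const_mul, integral_sub ((hI v).const_mul _) ((hC v).const_mul _),
      integral_const_mul, integral_const_mul,
      integral_indicator_one (isClopen_consistent_act j a v Act.I).isOpen.measurableSet,
      integral_indicator_one (isClopen_consistent j a v).isOpen.measurableSet]
    ring
  · exact fun v _ => (((hI v).const_mul _).sub ((hC v).const_mul _)).const_mul _

omit [Fintype X] [MeasurableSpace X] [MeasurableSingletonClass X] in
theorem continuous_pair_right (i : Fin 2) (s : PureStrategy X) :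
    Continuous fun t : PureStrategy X => pair i s t :=
  (continuous_pair i).comp (continuous_const.prodMk continuous_id)

/-- The change in value from a deviation that invests once at `(a, y)` and never afterwards. -/
theorem valueAgainst_deviate_sub (f : State → PMF X) (hc : c ∈ Set.Ioo (0 : ℝ) 1) (h0 : 0 < δ)
    (h1 : δ < 1) (hp : p₀ ∈ Set.Ioo (0 : ℝ) 1) (i : Fin 2) (ν : MixedStrategy X)
    {s : PureStrategy X} (hs : s ∈ pureCoolOff X T) {n : ℕ} {a : Fin n → Profile}
    (ha : IsInvestment T a) {y : Fin (n + 1) → X} (hcons : Consistent i a y s)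
    (hN : s n a y = Act.N) :
    p₀ * (signalWeight f State.H y * ((1 - δ) * δ ^ n * reachInvestProb f State.H (opp i) ν a -
        ((1 - δ) * δ ^ n * c + δ ^ (n + T (n + 1) + 1)) * reachProb f State.H (opp i) ν a)) +
      (1 - p₀) * (signalWeight f State.L y *
        (-((1 - δ) * δ ^ n * c + δ ^ (n + T (n + 1) + 1)) * reachProb f State.L (opp i) ν a)) ≤
      valueAgainst p₀ f c δ i ν (deviate s a y) - valueAgainst p₀ f c δ i ν s := by
  classical
  have hint : ∀ θ s', Integrable (fun t => pureValue f c δ θ i (pair i s' t))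
      (ν : Measure (PureStrategy X)) := fun θ s' =>
    integrable_of_continuous ((continuous_pureValue f hc h0 h1 θ i).comp
      (continuous_pair_right i s'))
  have hθ : ∀ θ, signalWeight f θ y * ((1 - δ) * δ ^ n * ((if θ = State.H then 1 else 0) *
      reachInvestProb f θ (opp i) ν a) - ((1 - δ) * δ ^ n * c + δ ^ (n + T (n + 1) + 1)) *
      reachProb f θ (opp i) ν a) ≤ ∫ t, pureValue f c δ θ i (pair i (deviate s a y) t)
        ∂(ν : Measure (PureStrategy X)) -
        ∫ t, pureValue f c δ θ i (pair i s t) ∂(ν : Measure (PureStrategy X)) := by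
    intro θ
    obtain ⟨hg, hg2⟩ := integral_gain f θ (opp i) ν a ((1 - δ) * δ ^ n)
      (δ ^ (n + T (n + 1) + 1)) c
    rw [← hg2, ← integral_const_mul, ← integral_sub (hint _ _) (hint _ _)]
    exact integral_mono (hg.const_mul _) ((hint _ _).sub (hint _ _)) fun t =>
      pureValue_deviate_sub i s t a y f hc h0 h1 θ hs ha hcons hN
  have hV : ∀ s', valueAgainst p₀ f c δ i ν s' =
      p₀ * ∫ t, pureValue f c δ State.H i (pair i s' t) ∂(ν : Measure (PureStrategy X)) +
      (1 - p₀) * ∫ t, pureValue f c δ State.L i (pair i s' t) ∂(ν : Measure (PureStrategy X)) := by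
    intro s'
    simp only [valueAgainst, exAnteValue]
    rw [integral_add ((hint _ _).const_mul _) ((hint _ _).const_mul _), integral_const_mul,
      integral_const_mul]
  have hH := mul_le_mul_of_nonneg_left (hθ State.H) hp.1.le
  have hL := mul_le_mul_of_nonneg_left (hθ State.L) (show 0 ≤ 1 - p₀ by linarith [hp.2])
  rw [hV, hV]
  simp only [if_true, one_mul, reduceCtorEq, if_false, zero_mul, mul_zero, zero_sub] at hH hL
  rw [neg_mul]
  linarith

/-- If a best response does not invest at an investment history, the private belief is low. -/
theorem belief_le_of_not_invest (f : State → PMF X) (hc : c ∈ Set.Ioo (0 : ℝ) 1) (h0 : 0 < δ)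
    (h1 : δ < 1) (hp : p₀ ∈ Set.Ioo (0 : ℝ) 1) {ε η : ℝ} (i : Fin 2) {ν : MixedStrategy X}
    {s : PureStrategy X} (hs : s ∈ pureCoolOff X T) (hbr : IsBestResponse p₀ f c δ i ν s)
    {n : ℕ} {a : Fin n → Profile} (ha : IsInvestment T a)
    (hν : (1 - ε) * reachProb f State.H (opp i) ν a ≤ reachInvestProb f State.H (opp i) ν a)
    (hT : δ ^ (T (n + 1) + 1) ≤ η * (1 - δ)) {y : Fin (n + 1) → X} (hcons : Consistent i a y s)
    (hN : s n a y = Act.N) :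
    p₀ * (1 - ε - c - η) * (signalWeight f State.H y * reachProb f State.H (opp i) ν a) ≤
      (1 - p₀) * (c + η) * (signalWeight f State.L y * reachProb f State.L (opp i) ν a) := by
  have h2 := valueAgainst_deviate_sub f hc h0 h1 hp i ν hs ha hcons hN
  have h3 := hbr (deviate s a y)
  set A := (1 - δ) * δ ^ n with hA
  have hApos : 0 < A := mul_pos (by linarith) (by positivity)
  -- Everything after the cool-off phase is worth at most η times the weight of the current period.
  have hB : δ ^ (n + T (n + 1) + 1) ≤ A * η := by
    rw [add_assoc, pow_add, hA]
    calc δ ^ n * δ ^ (T (n + 1) + 1) ≤ δ ^ n * (η * (1 - δ)) := by gcongr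
      _ = _ := by ring
  set B := δ ^ (n + T (n + 1) + 1)
  have hwH := signalWeight_nonneg f State.H y
  have hwL := signalWeight_nonneg f State.L y
  have hrH := reachProb_nonneg f State.H (opp i) ν a
  have hrL := reachProb_nonneg f State.L (opp i) ν a
  set wH := signalWeight f State.H y
  set wL := signalWeight f State.L y
  set rH := reachProb f State.H (opp i) ν a
  set rL := reachProb f State.L (opp i) ν a
  set rI := reachInvestProb f State.H (opp i) ν a
  have e1 : A * ((1 - ε - c - η) * rH) ≤ A * rI - (A * c + B) * rH := by
    have := mul_le_mul_of_nonneg_left hν hApos.le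
    have := mul_le_mul_of_nonneg_right hB hrH
    linarith
  have e2 : -(A * ((c + η) * rL)) ≤ -(A * c + B) * rL := by
    have := mul_le_mul_of_nonneg_right hB hrL
    linarith
  have e3 := mul_le_mul_of_nonneg_left (mul_le_mul_of_nonneg_left e1 hwH) hp.1.le
  have e4 := mul_le_mul_of_nonneg_left (mul_le_mul_of_nonneg_left e2 hwL)
    (show 0 ≤ 1 - p₀ by linarith [hp.2])
  have e5 : A * (p₀ * (1 - ε - c - η) * (wH * rH)) ≤ A * ((1 - p₀) * (c + η) * (wL * rL)) := by
    linarith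
  exact le_of_mul_le_mul_left e5 hApos

end BestResponse

/-! ### Phases of the cool-off scheme -/

section Phases

variable {T : ℕ → ℕ}

theorem not_hasViolation_take {n : ℕ} {a : Fin n → Profile} (h : ¬ HasViolation T a) {k : ℕ}
    (hk : k ≤ n) : ¬ HasViolation T (Fin.take k hk a) := by
  rintro ⟨j, i, h1, h2⟩
  exact h ⟨⟨j, by omega⟩, i, h1, h2⟩

theorem act_eq_N_of_not_hasViolation {n : ℕ} {a : Fin n → Profile} (h : ¬ HasViolation T a)
    (k : Fin n) (hk : IsCoolOff T (Fin.take k k.is_lt.le a)) (i : Fin 2) : a k i = Act.N := by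
  by_contra hcon
  exact h ⟨k, i, hk, act_ne_N_iff.1 hcon⟩

/-- The data of the current investment phase: `b` periods precede the last cool-off phase, and the
investment phase starts at length `m`. -/
structure IsPhase (T : ℕ → ℕ) {n : ℕ} (a : Fin n → Profile) (b m : ℕ) : Prop where
  -- For the first phase b = 0 and the cool-off length is T(1). For a later one b = s = r + 1, where
  -- r is the length of the last investment history before it, and the length is T(b).
  le_start : b + T (max b 1) ≤ m
  start_pos : 1 ≤ m
  start_le : m ≤ n
  coolOff : ∀ k (hk : k ≤ n), b ≤ k → k < m → IsCoolOff T (Fin.take k hk a)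
  investment : ∀ k (hk : k ≤ n), m ≤ k → IsInvestment T (Fin.take k hk a)
  invest : ∀ k : Fin n, m ≤ k → a k = fun _ => Act.I

theorem IsPhase.take {n : ℕ} {a : Fin n → Profile} {b m : ℕ} (h : IsPhase T a b m) {k : ℕ}
    (hmk : m ≤ k) (hk : k ≤ n) : IsPhase T (Fin.take k hk a) b m where
  le_start := h.le_start
  start_pos := h.start_pos
  start_le := hmk
  coolOff j hj := h.coolOff j (hj.trans hk)
  investment j hj := h.investment j (hj.trans hk)
  invest j := h.invest ⟨j, by omega⟩

theorem exists_isPhase : ∀ {n : ℕ} (a : Fin n → Profile), IsInvestment T a →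
    ∃ b m, IsPhase T a b m := by
  intro n
  induction n with
  | zero => intro a ha; exact absurd ha (isCoolOff_zero T a)
  | succ n ih =>
    intro a ha
    by_cases hinit : IsInvestment T (Fin.init a)
    · obtain ⟨b, m, h⟩ := ih (Fin.init a) hinit
      refine ⟨b, m, h.le_start, h.start_pos, h.start_le.trans n.le_succ, ?_, ?_, ?_⟩
      · intro k hk hbk hkm
        exact h.coolOff k (by have := h.start_le; omega) hbk hkm
      · intro k hk hmk
        rcases Nat.lt_or_ge n k with hlt | hle
        · obtain rfl : k = n + 1 := by omega
          exact ha
        · exact h.investment k hle hmk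
      · intro k hmk
        rcases Nat.lt_succ_iff_lt_or_eq.1 k.is_lt with hlt | heq
        · exact h.invest ⟨k, hlt⟩ hmk
        · have : k = Fin.last n := Fin.ext heq
          rw [this]
          exact (isInvestment_succ_of_isInvestment T a hinit).1 ha
    · obtain ⟨l1, l2⟩ := lastInvestment_spec T n (Fin.init a)
      have hself : ∀ k (hk : k ≤ n + 1), n + 1 ≤ k → IsInvestment T (Fin.take k hk a) := by
        intro k hk hnk
        obtain rfl : k = n + 1 := by omega
        exact ha
      cases hl : lastInvestment T n (Fin.init a) with
      | none =>
        have hcool : ∀ k (hk : k ≤ n), IsCoolOff T (Fin.take k hk (Fin.init a)) := by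
          intro k hk hinv
          obtain ⟨m, hm, -⟩ := l2 k hk hinv
          rw [hl] at hm
          exact absurd hm (by simp)
        have h1 := (isInvestment_succ_of_none T a hcool).1 ha
        refine ⟨0, n + 1, by simpa using h1.le, by omega, le_rfl, ?_, hself, ?_⟩
        · intro k hk _ hkn
          exact hcool k (by omega)
        · intro k hk
          omega
      | some r =>
        obtain ⟨hr1, hr2⟩ := l1 r hl
        have hmax : ∀ k (hk : k ≤ n), IsInvestment T (Fin.take k hk (Fin.init a)) → k ≤ r := by
          intro k hk hinv
          obtain ⟨m, hm, hkm⟩ := l2 k hk hinv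
          rw [hl] at hm
          exact hkm.trans (Option.some.inj hm).ge
        have h1 := (isInvestment_succ_of_longest T a hinit hr1 hr2 hmax).1 ha
        -- The failed investment takes place in period r + 1 and may be informative, so that period
        -- counts towards b. Actions are forced only from length r + 1 on.
        refine ⟨r + 1, n + 1, ?_, by omega, le_rfl, ?_, hself, ?_⟩
        · rw [max_eq_left (by omega)]
          omega
        · intro k hk hrk hkn hinv
          have := hmax k (by omega) hinv
          omega
        · intro k hk
          omega

end Phases

/-! ### Likelihood ratios -/

section Likelihood

variable {X : Type*}

/-- The geometric mean of the probabilities of the signals `u` in the two states. -/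
noncomputable def rootWeight (f : State → PMF X) {n : ℕ} (u : Fin n → X) : ℝ :=
  ∏ k, √((f State.H (u k)).toReal * (f State.L (u k)).toReal)

theorem rootWeight_nonneg (f : State → PMF X) {n : ℕ} (u : Fin n → X) : 0 ≤ rootWeight f u :=
  Finset.prod_nonneg fun _ _ => Real.sqrt_nonneg _

theorem rootWeight_sq (f : State → PMF X) {n : ℕ} (u : Fin n → X) :
    rootWeight f u ^ 2 = signalWeight f State.H u * signalWeight f State.L u := by
  rw [rootWeight, signalWeight, signalWeight, ← Finset.prod_pow, ← Finset.prod_mul_distrib]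
  exact Finset.prod_congr rfl fun k _ =>
    Real.sq_sqrt (mul_nonneg ENNReal.toReal_nonneg ENNReal.toReal_nonneg)

variable [Fintype X]

/-- The Bhattacharyya coefficient of the two signal laws. -/
noncomputable def affinity (f : State → PMF X) : ℝ :=
  ∑ x, √((f State.H x).toReal * (f State.L x).toReal)

theorem affinity_nonneg (f : State → PMF X) : 0 ≤ affinity f :=
  Finset.sum_nonneg fun _ _ => Real.sqrt_nonneg _

/-- The arithmetic–geometric mean inequality for each signal, strict where the two laws differ. -/
theorem affinity_lt_one {f : State → PMF X} (hne : f State.H ≠ f State.L) : affinity f < 1 := by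
  obtain ⟨x, hx⟩ : ∃ x, (f State.H x).toReal ≠ (f State.L x).toReal := by
    by_contra! hcon
    exact hne (PMF.ext fun x =>
      (ENNReal.toReal_eq_toReal_iff' ((f _).apply_ne_top x) ((f _).apply_ne_top x)).1 (hcon x))
  have hkey : ∀ p q : ℝ, 0 ≤ p → 0 ≤ q → √(p * q) = (p + q) / 2 - (√p - √q) ^ 2 / 2 := by
    intro p q hp hq
    rw [Real.sqrt_mul hp, sub_sq, Real.sq_sqrt hp, Real.sq_sqrt hq]
    ring
  have hsum : ∑ x, ((f State.H x).toReal + (f State.L x).toReal) / 2 = 1 := by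
    rw [← Finset.sum_div, Finset.sum_add_distrib, sum_toReal_pmf, sum_toReal_pmf]
    norm_num
  rw [← hsum]
  refine Finset.sum_lt_sum (fun z _ => ?_) ⟨x, Finset.mem_univ _, ?_⟩
  · rw [hkey _ _ ENNReal.toReal_nonneg ENNReal.toReal_nonneg]
    linarith [sq_nonneg (√(f State.H z).toReal - √(f State.L z).toReal)]
  · rw [hkey _ _ ENNReal.toReal_nonneg ENNReal.toReal_nonneg]
    have : √(f State.H x).toReal - √(f State.L x).toReal ≠ 0 := by
      intro h
      exact hx ((Real.sqrt_inj ENNReal.toReal_nonneg ENNReal.toReal_nonneg).1 (sub_eq_zero.1 h))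
    have := sq_pos_iff.2 this
    linarith

/-- Summing out the last coordinates of a product weight. -/
theorem sum_prod_mul_take (w : X → ℝ) {b N : ℕ} (hb : b ≤ N) (g : (Fin b → X) → ℝ) :
    ∑ y : Fin N → X, (∏ k, w (y k)) * g (Fin.take b hb y) =
      (∑ x, w x) ^ (N - b) * ∑ u : Fin b → X, (∏ k, w (u k)) * g u := by
  obtain ⟨l, rfl⟩ := Nat.exists_eq_add_of_le hb
  rw [← (Fin.appendEquiv b l).sum_comp, Fintype.sum_prod_type, Nat.add_sub_cancel_left,
    ← sum_prod_pi, Finset.mul_sum]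
  refine Finset.sum_congr rfl fun u _ => ?_
  rw [Finset.sum_mul]
  refine Finset.sum_congr rfl fun v _ => ?_
  have h1 : Fin.take b hb (Fin.appendEquiv b l (u, v)) = u := by
    funext k
    exact Fin.append_left u v k
  rw [h1, Fin.prod_univ_add]
  simp only [Fin.appendEquiv, Equiv.coe_fn_mk, Fin.append_left, Fin.append_right]
  ring

theorem sum_signalWeight_mul_take (f : State → PMF X) (θ : State) {b N : ℕ} (hb : b ≤ N)
    (g : (Fin b → X) → ℝ) :
    ∑ y : Fin N → X, signalWeight f θ y * g (Fin.take b hb y) =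
      ∑ u : Fin b → X, signalWeight f θ u * g u := by
  have := sum_prod_mul_take (fun x => (f θ x).toReal) hb g
  rw [sum_toReal_pmf, one_pow, one_mul] at this
  exact this

theorem sum_rootWeight_mul_take (f : State → PMF X) {b N : ℕ} (hb : b ≤ N)
    (g : (Fin b → X) → ℝ) :
    ∑ y : Fin N → X, rootWeight f y * g (Fin.take b hb y) =
      affinity f ^ (N - b) * ∑ u : Fin b → X, rootWeight f u * g u :=
  sum_prod_mul_take (fun x => √((f State.H x).toReal * (f State.L x).toReal)) hb g

/-- A bound for the square root of the likelihood ratio of one signal. -/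
theorem exists_ratio_bound {f : State → PMF X} (hf : ∀ θ x, 0 < f θ x) :
    ∃ D : ℝ, 1 ≤ D ∧ ∀ x, (f State.L x).toReal ≤ D ^ 2 * (f State.H x).toReal := by
  refine ⟨1 + ∑ x, 1 / (f State.H x).toReal, ?_, fun x => ?_⟩
  · have : 0 ≤ ∑ x, 1 / (f State.H x).toReal :=
      Finset.sum_nonneg fun x _ => div_nonneg zero_le_one ENNReal.toReal_nonneg
    linarith
  · have h1 := toReal_pmf_pos hf State.H x
    have h2 : 1 / (f State.H x).toReal ≤ ∑ x, 1 / (f State.H x).toReal :=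
      Finset.single_le_sum (f := fun x => 1 / (f State.H x).toReal)
        (fun x _ => div_nonneg zero_le_one ENNReal.toReal_nonneg) (Finset.mem_univ x)
    have h3 : (f State.L x).toReal ≤ 1 := by
      rw [← sum_toReal_pmf (f State.L)]
      exact Finset.single_le_sum (f := fun x => ((f State.L) x).toReal)
        (fun x _ => ENNReal.toReal_nonneg) (Finset.mem_univ x)
    set S := ∑ x, 1 / (f State.H x).toReal
    have h4 : 1 ≤ S * (f State.H x).toReal := by
      rwa [div_le_iff₀ h1] at h2
    have h5 : 0 ≤ S := le_trans (by positivity) h2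
    nlinarith [mul_nonneg h5 h1.le, mul_nonneg h5 (mul_nonneg h5 h1.le)]

omit [Fintype X] in
theorem signalWeight_L_le {f : State → PMF X} {D : ℝ}
    (hD : ∀ x, (f State.L x).toReal ≤ D ^ 2 * (f State.H x).toReal) {n : ℕ} (u : Fin n → X) :
    signalWeight f State.L u ≤ (D ^ n) ^ 2 * signalWeight f State.H u := by
  calc signalWeight f State.L u ≤ ∏ k, (D ^ 2 * (f State.H (u k)).toReal) :=
        Finset.prod_le_prod (fun _ _ => ENNReal.toReal_nonneg) fun k _ => hD (u k)
    _ = _ := by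
        rw [Finset.prod_mul_distrib]
        simp [signalWeight, ← pow_mul, mul_comm]

omit [Fintype X] in
theorem rootWeight_le {f : State → PMF X} {D : ℝ} (hD1 : 1 ≤ D)
    (hD : ∀ x, (f State.L x).toReal ≤ D ^ 2 * (f State.H x).toReal) {n : ℕ} (u : Fin n → X) :
    rootWeight f u ≤ D ^ n * signalWeight f State.H u := by
  have h1 := signalWeight_L_le hD u
  have h2 := signalWeight_nonneg f State.H u
  refine abs_le_of_sq_le_sq' ?_ (by positivity) |>.2
  rw [rootWeight_sq]
  nlinarith [mul_le_mul_of_nonneg_left h1 h2]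

variable {T : ℕ → ℕ} {f : State → PMF X} {j : Fin 2} {ν : MixedStrategy X}

/-- `reachProb` at length k + 1 averages over k + 2 signals. The last one does not affect
consistency and sums out. -/
theorem reachProb_take_succ (θ : State) (j : Fin 2) (ν : MixedStrategy X) {n : ℕ}
    (a : Fin n → Profile) (k : Fin n) :
    reachProb f θ j ν (Fin.take (k + 1) k.is_lt a) =
      ∑ x : Fin (k + 1) → X, signalWeight f θ x * (ν : Measure (PureStrategy X)).real
        {s | Consistent j (Fin.take k k.is_lt.le a) x s ∧
          s k (Fin.take k k.is_lt.le a) x = a k j} := by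
  have h1 := sum_signalWeight_mul_take f θ (b := k + 1) (N := k + 1 + 1) (by omega) fun x =>
    (ν : Measure (PureStrategy X)).real {s | Consistent j (Fin.take k k.is_lt.le a) x s ∧
          s k (Fin.take k k.is_lt.le a) x = a k j}
  rw [← h1, reachProb]
  refine Finset.sum_congr rfl fun x _ => ?_
  congr 2
  ext s
  exact consistent_succ_iff j _ x s

theorem reachProb_take_succ_le (θ : State) (j : Fin 2) (ν : MixedStrategy X) {n : ℕ}
    (a : Fin n → Profile) (k : Fin n) :
    reachProb f θ j ν (Fin.take (k + 1) k.is_lt a) ≤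
      reachProb f θ j ν (Fin.take k k.is_lt.le a) := by
  rw [reachProb_take_succ]
  exact Finset.sum_le_sum fun x _ => mul_le_mul_of_nonneg_left
    (measureReal_mono fun s hs => hs.1) (signalWeight_nonneg _ _ _)

theorem reachProb_take_mono (θ : State) (j : Fin 2) (ν : MixedStrategy X) {n : ℕ}
    (a : Fin n → Profile) {k : ℕ} (hk : k ≤ n) :
    reachProb f θ j ν a ≤ reachProb f θ j ν (Fin.take k hk a) := by
  have key : ∀ l (hl : l ≤ n), k ≤ l →
      reachProb f θ j ν (Fin.take l hl a) ≤ reachProb f θ j ν (Fin.take k hk a) := by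
    intro l
    induction l with
    | zero =>
      intro hl hkl
      obtain rfl : k = 0 := by omega
      exact le_rfl
    | succ l ih =>
      intro hl hkl
      rcases hkl.lt_or_eq with h | h
      · exact (reachProb_take_succ_le θ j ν a ⟨l, hl⟩).trans (ih (by omega) (by omega))
      · subst h
        exact le_rfl
  exact key n le_rfl hk

/-- The action `N` is certain during a cool-off phase, so observing it reveals nothing about the
state. -/
theorem reachProb_take_succ_of_coolOff (θ : State) (hν : ν ∈ mixedCoolOff X T) {n : ℕ}
    {a : Fin n → Profile} (hviol : ¬ HasViolation T a) (k : Fin n)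
    (hcool : IsCoolOff T (Fin.take k k.is_lt.le a)) :
    reachProb f θ j ν (Fin.take (k + 1) k.is_lt a) =
      reachProb f θ j ν (Fin.take k k.is_lt.le a) := by
  rw [reachProb_take_succ, act_eq_N_of_not_hasViolation hviol k hcool]
  refine Finset.sum_congr rfl fun x _ => ?_
  congr 1
  refine measureReal_congr ?_
  filter_upwards [ae_mem_pureCoolOff hν] with s hs
  exact propext ⟨fun h => h.1, fun h => ⟨h, hs.1 k _ x hcool⟩⟩

theorem reachProb_take_succ_of_invest (θ : State) {n : ℕ} {a : Fin n → Profile} (k : Fin n)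
    (hI : a k j = Act.I) : reachProb f θ j ν (Fin.take (k + 1) k.is_lt a) =
      reachInvestProb f θ j ν (Fin.take k k.is_lt.le a) := by
  rw [reachProb_take_succ, hI]
  rfl

/-- The likelihood ratio of the actions of a player who uses a cool-off strategy. -/
theorem reachProb_L_le (hf : ∀ θ x, 0 < f θ x) {D : ℝ}
    (hD : ∀ x, (f State.L x).toReal ≤ D ^ 2 * (f State.H x).toReal) {γ : ℝ} (hγ0 : 0 < γ)
    (hγ1 : γ < 1) (hν : ν ∈ coolOffStrategies f T (1 - γ ^ 2) j) {n : ℕ} {a : Fin n → Profile}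
    (hviol : ¬ HasViolation T a) {b m : ℕ} (hph : IsPhase T a b m) :
    (γ ^ (n - m)) ^ 2 * reachProb f State.L j ν a ≤
      (D ^ (b + 1)) ^ 2 * reachProb f State.H j ν a := by
  rw [mem_coolOffStrategies_iff hf] at hν
  have key : ∀ k (hk : k ≤ n), b ≤ k →
      (γ ^ (k - m)) ^ 2 * reachProb f State.L j ν (Fin.take k hk a) ≤
        (D ^ (b + 1)) ^ 2 * reachProb f State.H j ν (Fin.take k hk a) := by
    -- The crude bound of D² per signal. The exponent is b + 1 because `reachProb` also carries the
    -- current signal.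
    have hbase : ∀ hb : b ≤ n, reachProb f State.L j ν (Fin.take b hb a) ≤
        (D ^ (b + 1)) ^ 2 * reachProb f State.H j ν (Fin.take b hb a) := by
      intro hb
      rw [reachProb, reachProb, Finset.mul_sum]
      refine Finset.sum_le_sum fun x _ => ?_
      rw [← mul_assoc]
      exact mul_le_mul_of_nonneg_right (signalWeight_L_le hD x) measureReal_nonneg
    intro k
    induction k with
    | zero =>
      intro hk hbk
      obtain rfl : b = 0 := by omega
      simpa using hbase hk
    | succ k ih =>
      intro hk hbk
      rcases hbk.lt_or_eq with h | h
      · have ih' := ih (by omega) (by omega)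
        have hL := reachProb_take_succ_le (f := f) State.L j ν a ⟨k, hk⟩
        have hL0 := reachProb_nonneg f State.L j ν (Fin.take (k + 1) hk a)
        by_cases hkm : k < m
        · have hH := reachProb_take_succ_of_coolOff (f := f) (j := j) State.H hν.1 hviol ⟨k, hk⟩
            (hph.coolOff k (by omega) (by omega) hkm)
          rw [Nat.sub_eq_zero_of_le hkm, pow_zero, one_pow, one_mul]
          rw [Nat.sub_eq_zero_of_le hkm.le, pow_zero, one_pow, one_mul] at ih'
          simp only at hH hL
          rw [hH]
          exact hL.trans ih'
        -- A joint investment keeps at least the fraction γ² of the H-probability, while the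
        -- L-probability can only fall.
        · have hH := reachProb_take_succ_of_invest (f := f) (j := j) (ν := ν) (a := a) State.H ⟨k, hk⟩
            (congrFun (hph.invest ⟨k, hk⟩ (not_lt.1 hkm)) j)
          have hI := hν.2 k (Fin.take k (by omega) a) (hph.investment k (by omega) (not_lt.1 hkm))
            (not_hasViolation_take hviol _)
          simp only at hH hL
          rw [hH]
          have e : k + 1 - m = (k - m) + 1 := by omega
          rw [e, pow_succ γ (k - m), mul_pow]
          have h3 : 0 ≤ (γ ^ (k - m)) ^ 2 * γ ^ 2 := by positivity
          calc (γ ^ (k - m)) ^ 2 * γ ^ 2 * reachProb f State.L j ν (Fin.take (k + 1) hk a)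
              ≤ (γ ^ (k - m)) ^ 2 * γ ^ 2 * reachProb f State.L j ν (Fin.take k (by omega) a) :=
                mul_le_mul_of_nonneg_left hL h3
            _ = γ ^ 2 * ((γ ^ (k - m)) ^ 2 *
                  reachProb f State.L j ν (Fin.take k (by omega) a)) := by ring
            _ ≤ γ ^ 2 * ((D ^ (b + 1)) ^ 2 *
                  reachProb f State.H j ν (Fin.take k (by omega) a)) := by gcongr
            _ = (D ^ (b + 1)) ^ 2 * ((1 - (1 - γ ^ 2)) *
                  reachProb f State.H j ν (Fin.take k (by omega) a)) := by ring
            _ ≤ _ := by gcongr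
      · subst h
        have h4 : γ ^ (k + 1 - m) ≤ 1 := pow_le_one₀ hγ0.le hγ1.le
        have h5 : (γ ^ (k + 1 - m)) ^ 2 ≤ 1 := pow_le_one₀ (by positivity) h4
        calc _ ≤ 1 * reachProb f State.L j ν (Fin.take (k + 1) hk a) :=
              mul_le_mul_of_nonneg_right h5 (reachProb_nonneg _ _ _ _ _)
          _ ≤ _ := by rw [one_mul]; exact hbase hk
  exact key n le_rfl (by have := hph.le_start; have := hph.start_le; omega)

end Likelihood

/-! ### Best responses invest with high probability -/

section Estimate

variable {X : Type*} [Fintype X] {T : ℕ → ℕ} {f : State → PMF X}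

/-- The own actions along `a` agree with those of `s` at the signals `u`. -/
def FollowsOwn (i : Fin 2) (s : PureStrategy X) {n : ℕ} (a : Fin n → Profile) (u : Fin n → X) :
    Prop :=
  ∀ k : Fin n, s k (Fin.take k k.is_lt.le a) (Fin.take (k + 1) k.is_lt u) = a k i

omit [Fintype X] in
theorem FollowsOwn.of_consistent {i : Fin 2} {s : PureStrategy X} {n : ℕ} {a : Fin n → Profile}
    {x : Fin (n + 1) → X} (h : Consistent i a x s) {b : ℕ} (hb : b ≤ n) :
    FollowsOwn i s (Fin.take b hb a) (Fin.take b (by omega) x) :=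
  fun k => h ⟨k, by omega⟩

omit [Fintype X] in
/-- A player who does not fail to invest during the current phase follows the history and
invests. -/
theorem consistent_or_exists_not_invest {i : Fin 2} {s : PureStrategy X} (hs : s ∈ pureCoolOff X T)
    {n : ℕ} {a : Fin n → Profile} (hviol : ¬ HasViolation T a) {b m : ℕ} (hph : IsPhase T a b m)
    (hb : b ≤ n) (x : Fin (n + 1) → X)
    (hx : FollowsOwn i s (Fin.take b hb a) (Fin.take b (by omega) x)) :
    (Consistent i a x s ∧ s n a x = Act.I) ∨ ∃ k, ∃ hk : k ≤ n, m ≤ k ∧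
      Consistent i (Fin.take k hk a) (Fin.take (k + 1) (by omega) x) s ∧
      s k (Fin.take k hk a) (Fin.take (k + 1) (by omega) x) = Act.N := by
  by_contra! hcon
  obtain ⟨h1, h2⟩ := hcon
  have key : ∀ k (hk : k ≤ n), b ≤ k →
      Consistent i (Fin.take k hk a) (Fin.take (k + 1) (by omega) x) s := by
    intro k
    induction k with
    | zero => intro _ _ l; exact l.elim0
    | succ k ih =>
      intro hk hbk
      rcases hbk.lt_or_eq with h | h
      · have ih' := ih (by omega) (by omega)
        refine (consistent_succ_iff i _ _ s).2 ⟨ih', ?_⟩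
        change s k (Fin.take k (by omega) a) (Fin.take (k + 1) (by omega) x) = a ⟨k, hk⟩ i
        by_cases hkm : k < m
        · have hcool := hph.coolOff k (by omega) (by omega) hkm
          rw [hs.1 k _ _ hcool, act_eq_N_of_not_hasViolation hviol ⟨k, hk⟩ hcool]
        · rw [hph.invest ⟨k, hk⟩ (not_lt.1 hkm)]
          exact act_ne_N_iff.1 (h2 k (by omega) (not_lt.1 hkm) ih')
      · subst h
        exact fun l => hx l
  have hcons := key n le_rfl hb
  exact h1 hcons (act_ne_N_iff.1 (h2 n le_rfl hph.start_le hcons))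

open Classical in
/-- If private beliefs are low whenever `s` fails to invest, then failures are unlikely. -/
theorem followsOwn_mul_le {D : ℝ} (hD1 : 1 ≤ D)
    (hD : ∀ x, (f State.L x).toReal ≤ D ^ 2 * (f State.H x).toReal) {γ : ℝ} (hγ0 : 0 < γ)
    (hγ : affinity f < γ) (hρ : affinity f < 1) {i : Fin 2} {s : PureStrategy X}
    (hs : s ∈ pureCoolOff X T) {n : ℕ} {a : Fin n → Profile} (hviol : ¬ HasViolation T a)
    {b m : ℕ} (hph : IsPhase T a b m) (hb : b ≤ n) {M : ℝ} (hM : 0 ≤ M)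
    (hlow : ∀ k (hk : k ≤ n), m ≤ k → ∀ y : Fin (k + 1) → X,
      Consistent i (Fin.take k hk a) y s → s k (Fin.take k hk a) y = Act.N →
      γ ^ (k - m) * signalWeight f State.H y ≤ M * rootWeight f y) :
    (1 - M * D ^ b * affinity f ^ (m - b) / (1 - affinity f / γ)) *
      ∑ u : Fin b → X, signalWeight f State.H u *
        (if FollowsOwn i s (Fin.take b hb a) u then 1 else 0) ≤
      ∑ x : Fin (n + 1) → X, signalWeight f State.H x *
        (if Consistent i a x s ∧ s n a x = Act.I then 1 else 0) := by
  set ρ := affinity f with hρdef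
  have hρ0 : 0 ≤ ρ := affinity_nonneg f
  set F := ∑ u : Fin b → X, signalWeight f State.H u *
        (if FollowsOwn i s (Fin.take b hb a) u then 1 else 0) with hF
  have hF0 : 0 ≤ F := Finset.sum_nonneg fun u _ =>
    mul_nonneg (signalWeight_nonneg _ _ _) (by split_ifs <;> norm_num)
  have hbm : b ≤ m := by have := hph.le_start; omega
  have hD0 : 0 < D := by linarith
  -- The H-probability of following `a` up to length k and failing to invest there. A union bound
  -- over k in the current phase controls all failures.
  let S : ℕ → ℝ := fun k => ∑ x : Fin (n + 1) → X, signalWeight f State.H x *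
    (if ∃ hk : k ≤ n, Consistent i (Fin.take k hk a) (Fin.take (k + 1) (by omega) x) s ∧
      s k (Fin.take k hk a) (Fin.take (k + 1) (by omega) x) = Act.N then 1 else 0)
  have hcover : F ≤ (∑ x : Fin (n + 1) → X, signalWeight f State.H x *
        (if Consistent i a x s ∧ s n a x = Act.I then 1 else 0)) +
      ∑ k ∈ Finset.Icc m n, S k := by
    have hF' := sum_signalWeight_mul_take f State.H (b := b) (N := n + 1) (by omega)
      fun u => if FollowsOwn i s (Fin.take b hb a) u then 1 else 0
    rw [hF, ← hF', Finset.sum_comm, ← Finset.sum_add_distrib]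
    refine Finset.sum_le_sum fun x _ => ?_
    rw [← Finset.mul_sum, ← mul_add]
    refine mul_le_mul_of_nonneg_left ?_ (signalWeight_nonneg _ _ _)
    have hnn : ∀ k ∈ Finset.Icc m n, (0 : ℝ) ≤ if ∃ hk : k ≤ n,
        Consistent i (Fin.take k hk a) (Fin.take (k + 1) (by omega) x) s ∧
        s k (Fin.take k hk a) (Fin.take (k + 1) (by omega) x) = Act.N then 1 else 0 := by
      intro k _
      split_ifs <;> norm_num
    have hnn' := Finset.sum_nonneg hnn
    by_cases hx : FollowsOwn i s (Fin.take b hb a) (Fin.take b (by omega) x)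
    · rw [if_pos hx]
      rcases consistent_or_exists_not_invest hs hviol hph hb x hx with h | ⟨k, hk, hmk, h⟩
      · rw [if_pos h]
        linarith
      · have h3 := Finset.single_le_sum hnn (Finset.mem_Icc.2 ⟨hmk, hk⟩)
        rw [if_pos ⟨hk, h⟩] at h3
        have h4 : (0 : ℝ) ≤ if Consistent i a x s ∧ s n a x = Act.I then 1 else 0 := by
          split_ifs <;> norm_num
        linarith
    · rw [if_neg hx]
      have h4 : (0 : ℝ) ≤ if Consistent i a x s ∧ s n a x = Act.I then 1 else 0 := by
        split_ifs <;> norm_num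
      linarith
  -- Low beliefs bound H-weights by geometric means. The k + 1 - b signals received after period b
  -- then sum to a power of ρ, while the first b signals cost D^b relative to `F`. This beats the
  -- factor γ^(k-m) because ρ < γ.
  have hS : ∀ k ∈ Finset.Icc m n, S k ≤ M * D ^ b * ρ ^ (m - b) * F * (ρ / γ) ^ (k - m) := by
    intro k hk
    obtain ⟨hmk, hkn⟩ := Finset.mem_Icc.1 hk
    have h1 := sum_signalWeight_mul_take f State.H (b := k + 1) (N := n + 1) (by omega)
      fun y => if Consistent i (Fin.take k hkn a) y s ∧ s k (Fin.take k hkn a) y = Act.N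
        then 1 else 0
    have h2 : S k = ∑ y : Fin (k + 1) → X, signalWeight f State.H y *
        if Consistent i (Fin.take k hkn a) y s ∧ s k (Fin.take k hkn a) y = Act.N
        then 1 else 0 := by
      rw [← h1]
      refine Finset.sum_congr rfl fun x _ => ?_
      congr 1
      exact if_congr ⟨fun ⟨_, h⟩ => h, fun h => ⟨hkn, h⟩⟩ rfl rfl
    have hγk : 0 < γ ^ (k - m) := by positivity
    have h3 : γ ^ (k - m) * S k ≤ M * ∑ y : Fin (k + 1) → X, rootWeight f y *
        if FollowsOwn i s (Fin.take b hb a) (Fin.take b (by omega) y) then 1 else 0 := by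
      rw [h2, Finset.mul_sum, Finset.mul_sum]
      refine Finset.sum_le_sum fun y _ => ?_
      by_cases hy : Consistent i (Fin.take k hkn a) y s ∧ s k (Fin.take k hkn a) y = Act.N
      · have hfo : FollowsOwn i s (Fin.take b hb a) (Fin.take b (by omega) y) :=
          FollowsOwn.of_consistent hy.1 (b := b) (by omega)
        rw [if_pos hy, if_pos hfo, mul_one, mul_one]
        exact hlow k hkn hmk y hy.1 hy.2
      · rw [if_neg hy, mul_zero, mul_zero]
        exact mul_nonneg hM (mul_nonneg (rootWeight_nonneg _ _) (by split_ifs <;> norm_num))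
    have h4 := sum_rootWeight_mul_take f (b := b) (N := k + 1) (by omega)
      fun u => if FollowsOwn i s (Fin.take b hb a) u then 1 else 0
    rw [h4] at h3
    have h5 : ∑ u : Fin b → X, rootWeight f u *
        (if FollowsOwn i s (Fin.take b hb a) u then 1 else 0) ≤ D ^ b * F := by
      rw [hF, Finset.mul_sum]
      refine Finset.sum_le_sum fun u _ => ?_
      rw [← mul_assoc]
      exact mul_le_mul_of_nonneg_right (rootWeight_le hD1 hD u) (by split_ifs <;> norm_num)
    have h6 : ρ ^ (k + 1 - b) ≤ ρ ^ (m - b) * ρ ^ (k - m) := by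
      rw [← pow_add]
      exact pow_le_pow_of_le_one hρ0 hρ.le (by omega)
    have h7 : γ ^ (k - m) * S k ≤ M * (ρ ^ (m - b) * ρ ^ (k - m) * (D ^ b * F)) := by
      refine h3.trans (mul_le_mul_of_nonneg_left ?_ hM)
      exact mul_le_mul h6 h5 (Finset.sum_nonneg fun u _ =>
        mul_nonneg (rootWeight_nonneg _ _) (by split_ifs <;> norm_num)) (by positivity)
    rw [div_pow, mul_div_assoc', le_div_iff₀ hγk]
    linarith
  have hgeom : ∑ k ∈ Finset.Icc m n, (ρ / γ) ^ (k - m) ≤ 1 / (1 - ρ / γ) := by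
    have hq0 : 0 ≤ ρ / γ := by positivity
    have hq1 : ρ / γ < 1 := (div_lt_one hγ0).2 hγ
    have h1 : ∑ k ∈ Finset.Icc m n, (ρ / γ) ^ (k - m) =
        ∑ l ∈ Finset.range (n + 1 - m), (ρ / γ) ^ l := by
      rw [← Finset.Ico_add_one_right_eq_Icc, Finset.sum_Ico_eq_sum_range]
      refine Finset.sum_congr rfl fun l _ => ?_
      rw [Nat.add_sub_cancel_left]
    rw [h1, one_div, ← tsum_geometric_of_lt_one hq0 hq1]
    exact (summable_geometric_of_lt_one hq0 hq1).sum_le_tsum _ fun l _ => by positivity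
  have hsum : ∑ k ∈ Finset.Icc m n, S k ≤ M * D ^ b * ρ ^ (m - b) * F * (1 / (1 - ρ / γ)) := by
    refine (Finset.sum_le_sum hS).trans ?_
    rw [← Finset.mul_sum]
    exact mul_le_mul_of_nonneg_left hgeom (by positivity)
  have e : M * D ^ b * ρ ^ (m - b) / (1 - ρ / γ) * F =
      M * D ^ b * ρ ^ (m - b) * F * (1 / (1 - ρ / γ)) := by ring
  rw [sub_mul, one_mul, e]
  linarith

end Estimate

/-! ### Best responses to cool-off strategies are cool-off strategies -/

section CoolOffBestResponse

variable {X : Type*} [Fintype X] [MeasurableSpace X] [MeasurableSingletonClass X]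

/-- Bound for the likelihood ratio of private beliefs below which a player may stop to invest. -/
noncomputable def beliefBound (p₀ c η γ : ℝ) : ℝ :=
  √((1 - p₀) * (c + η) / (p₀ * (γ ^ 2 - c - η)))

/-- Bound for the probability of failing to invest in a phase that follows a cool-off phase of
length `l` after period `b`. -/
noncomputable def failureBound (f : State → PMF X) (p₀ c η γ D : ℝ) (b l : ℕ) : ℝ :=
  beliefBound p₀ c η γ * D ^ (b + 1) * D ^ b * affinity f ^ l / (1 - affinity f / γ)

/-- Standing assumptions on the parameters of the cool-off scheme. -/
structure IsAdmissible (p₀ : ℝ) (f : State → PMF X) (c δ η γ D : ℝ) (T : ℕ → ℕ) : Prop where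
  pos : ∀ θ x, 0 < f θ x
  prior : p₀ ∈ Set.Ioo (0 : ℝ) 1
  cost : c ∈ Set.Ioo (0 : ℝ) 1
  discount_pos : 0 < δ
  discount_lt : δ < 1
  eta_pos : 0 < η
  gamma_pos : 0 < γ
  gamma_lt : γ < 1
  margin : 0 < γ ^ 2 - c - η
  affinity_lt_one : affinity f < 1
  affinity_lt : affinity f < γ
  one_le : 1 ≤ D
  ratio : ∀ x, (f State.L x).toReal ≤ D ^ 2 * (f State.H x).toReal
  -- Investment histories have length at least 1, so T(1) is exempt and can stay bounded as δ tends
  -- to 1.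
  punishment : ∀ n, 1 ≤ n → δ ^ (T (n + 1) + 1) ≤ η * (1 - δ)
  failure : ∀ b, failureBound f p₀ c η γ D b (T (max b 1)) ≤ 1 - γ ^ 2

variable {T : ℕ → ℕ} {f : State → PMF X} {p₀ c δ η γ D : ℝ}

-- Supplies the low-belief hypothesis of the failure estimate. A failure to invest gives w_H r_H ≤
-- κ² w_L r_L for the own weights w and the opponent's reach probabilities r, and the drift bound on
-- r_L / r_H eliminates r, which is possible since r_H > 0.
open Classical in
theorem IsAdmissible.followsOwn_mul_le (h : IsAdmissible p₀ f c δ η γ D T) {i : Fin 2}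
    {s : PureStrategy X} (hs : s ∈ pureCoolOff X T) {ν : MixedStrategy X}
    (hν : ν ∈ coolOffStrategies f T (1 - γ ^ 2) (opp i))
    (hbr : IsBestResponse p₀ f c δ i ν s) {n : ℕ} {a : Fin n → Profile}
    (hviol : ¬ HasViolation T a) {b m : ℕ} (hph : IsPhase T a b m) (hb : b ≤ n)
    (hpos : 0 < reachProb f State.H (opp i) ν a) :
    (1 - failureBound f p₀ c η γ D b (T (max b 1))) *
      ∑ u : Fin b → X, signalWeight f State.H u *
        (if FollowsOwn i s (Fin.take b hb a) u then 1 else 0) ≤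
      ∑ x : Fin (n + 1) → X, signalWeight f State.H x *
        (if Consistent i a x s ∧ s n a x = Act.I then 1 else 0) := by
  set κ := beliefBound p₀ c η γ with hκ
  have hκ0 : 0 ≤ κ := Real.sqrt_nonneg _
  have hD0 : 0 < D := by linarith [h.one_le]
  have hp0 := h.prior.1
  have hp1 : 0 < 1 - p₀ := by linarith [h.prior.2]
  have hcη : 0 < c + η := by linarith [h.cost.1, h.eta_pos]
  have hden : 0 < p₀ * (γ ^ 2 - c - η) := mul_pos hp0 h.margin
  have hκ2 : κ ^ 2 * (p₀ * (γ ^ 2 - c - η)) = (1 - p₀) * (c + η) := by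
    rw [hκ, beliefBound, Real.sq_sqrt (by positivity), div_mul_cancel₀ _ hden.ne']
  have hν' := (mem_coolOffStrategies_iff h.pos _ _ _ _).1 hν
  have hlow : ∀ k (hk : k ≤ n), m ≤ k → ∀ y : Fin (k + 1) → X,
      Consistent i (Fin.take k hk a) y s → s k (Fin.take k hk a) y = Act.N →
      γ ^ (k - m) * signalWeight f State.H y ≤ (κ * D ^ (b + 1)) * rootWeight f y := by
    intro k hk hmk y hy hyN
    have hinv := hph.investment k hk hmk
    have h1 := belief_le_of_not_invest f h.cost h.discount_pos h.discount_lt h.prior (η := η) i hs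
      hbr hinv (hν'.2 k _ hinv (not_hasViolation_take hviol hk))
      (h.punishment k (hph.start_pos.trans hmk)) hy hyN
    have h2 := reachProb_L_le h.pos h.ratio h.gamma_pos h.gamma_lt hν
      (not_hasViolation_take hviol hk) (hph.take hmk hk)
    have h3 : 0 < reachProb f State.H (opp i) ν (Fin.take k hk a) :=
      hpos.trans_le (reachProb_take_mono _ _ _ a hk)
    set rH := reachProb f State.H (opp i) ν (Fin.take k hk a)
    set rL := reachProb f State.L (opp i) ν (Fin.take k hk a)
    have hwH := signalWeight_nonneg f State.H y
    have hwL := signalWeight_nonneg f State.L y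
    have hr := rootWeight_sq f y
    have hr0 := rootWeight_nonneg f y
    set wH := signalWeight f State.H y
    set wL := signalWeight f State.L y
    set g := γ ^ (k - m) with hg
    have hg0 : 0 < g := by have := h.gamma_pos; positivity
    rw [show 1 - (1 - γ ^ 2) - c - η = γ ^ 2 - c - η by ring, ← hκ2] at h1
    have h4 : wH * rH ≤ κ ^ 2 * (wL * rL) := by
      refine le_of_mul_le_mul_left ?_ hden
      linarith
    have h5 : g ^ 2 * wH * rH ≤ κ ^ 2 * (D ^ (b + 1)) ^ 2 * wL * rH := by
      have e1 := mul_le_mul_of_nonneg_left h4 (sq_nonneg g)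
      have e2 := mul_le_mul_of_nonneg_left h2 (mul_nonneg (sq_nonneg κ) hwL)
      linarith
    have h6 := le_of_mul_le_mul_right h5 h3
    -- Multiplying by wH and taking roots turns the bound on the likelihood ratio into one by √(wH
    -- wL), whose sum over signals is a power of the affinity.
    refine abs_le_of_sq_le_sq' ?_ (by positivity) |>.2
    rw [mul_pow, mul_pow, hr, mul_pow]
    have e3 := mul_le_mul_of_nonneg_left h6 hwH
    linarith
  have hmain := InvestmentGame.followsOwn_mul_le h.one_le h.ratio h.gamma_pos h.affinity_lt
    h.affinity_lt_one hs hviol hph hb (by positivity) hlow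
  refine le_trans (mul_le_mul_of_nonneg_right ?_ (Finset.sum_nonneg fun u _ =>
    mul_nonneg (signalWeight_nonneg _ _ _) (by split_ifs <;> norm_num))) hmain
  have hq : 0 < 1 - affinity f / γ := by
    rw [sub_pos, div_lt_one h.gamma_pos]
    exact h.affinity_lt
  have hle : affinity f ^ (m - b) ≤ affinity f ^ (T (max b 1)) :=
    pow_le_pow_of_le_one (affinity_nonneg f) h.affinity_lt_one.le
      (by have := hph.le_start; omega)
  rw [failureBound, ← hκ]
  gcongr

/-- At histories that the opponent can produce, the failure estimate applies; beliefs there are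
disciplined by optimality. Elsewhere optimality says nothing, and `hinv` makes investment certain.
-/
theorem IsAdmissible.diracStrategy_mem (h : IsAdmissible p₀ f c δ η γ D T) {i : Fin 2}
    {s : PureStrategy X} (hs : s ∈ pureCoolOff X T) {ν : MixedStrategy X}
    (hν : ν ∈ coolOffStrategies f T (1 - γ ^ 2) (opp i)) (hbr : IsBestResponse p₀ f c δ i ν s)
    (hinv : ∀ (n : ℕ) (a : Fin n → Profile) (y : Fin (n + 1) → X), IsInvestment T a →
      ¬ HasViolation T a → ¬ ConsistentMixed (opp i) ν a → s n a y = Act.I) :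
    diracStrategy s ∈ coolOffStrategies f T (1 - γ ^ 2) i := by
  classical
  rw [mem_coolOffStrategies_iff h.pos]
  refine ⟨diracStrategy_mem_mixedCoolOff hs, fun n a ha hviol => ?_⟩
  have e1 : reachProb f State.H i (diracStrategy s) a =
      ∑ x : Fin (n + 1) → X, signalWeight f State.H x * (if Consistent i a x s then 1 else 0) := by
    refine Finset.sum_congr rfl fun x _ => ?_
    rw [real_diracStrategy s (isClopen_consistent i a x)]
    rfl
  have e2 : reachInvestProb f State.H i (diracStrategy s) a =
      ∑ x : Fin (n + 1) → X, signalWeight f State.H x *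
        (if Consistent i a x s ∧ s n a x = Act.I then 1 else 0) := by
    refine Finset.sum_congr rfl fun x _ => ?_
    rw [real_diracStrategy s (isClopen_consistent_act i a x Act.I)]
    by_cases hx : Consistent i a x s ∧ s n a x = Act.I
    · rw [if_pos hx, if_pos (show s ∈ {s | Consistent i a x s ∧ s n a x = Act.I} from hx)]
    · rw [if_neg hx, if_neg (show s ∉ {s | Consistent i a x s ∧ s n a x = Act.I} from hx)]
  rw [sub_sub_cancel]
  by_cases hcm : ConsistentMixed (opp i) ν a
  · have hpos := (consistentMixed_iff h.pos State.H (opp i) ν a).1 hcm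
    obtain ⟨b, m, hph⟩ := exists_isPhase a ha
    have hb : b ≤ n := by have := hph.le_start; have := hph.start_le; omega
    have hmain := h.followsOwn_mul_le hs hν hbr hviol hph hb hpos
    rw [e2]
    refine le_trans ?_ hmain
    have hF : reachProb f State.H i (diracStrategy s) a ≤
        ∑ u : Fin b → X, signalWeight f State.H u *
          (if FollowsOwn i s (Fin.take b hb a) u then 1 else 0) := by
      have hF' := sum_signalWeight_mul_take f State.H (b := b) (N := n + 1) (by omega)
        fun u => if FollowsOwn i s (Fin.take b hb a) u then 1 else 0
      rw [e1, ← hF']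
      refine Finset.sum_le_sum fun x _ =>
        mul_le_mul_of_nonneg_left ?_ (signalWeight_nonneg _ _ _)
      by_cases hx : Consistent i a x s
      · have hfo : FollowsOwn i s (Fin.take b hb a) (Fin.take b (by omega) x) :=
          FollowsOwn.of_consistent hx hb
        rw [if_pos hx, if_pos hfo]
      · rw [if_neg hx]
        split_ifs <;> norm_num
    have hfail := h.failure b
    exact mul_le_mul (by linarith) hF (reachProb_nonneg _ _ _ _ _)
      (by linarith [sq_nonneg γ])
  · have : reachInvestProb f State.H i (diracStrategy s) a =
        reachProb f State.H i (diracStrategy s) a := by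
      rw [e1, e2]
      refine Finset.sum_congr rfl fun x _ => ?_
      simp only [hinv n a x ha hviol hcm, and_true]
    rw [this]
    have h1 := reachProb_nonneg f State.H i (diracStrategy s) a
    have h2 : γ ^ 2 ≤ 1 := pow_le_one₀ h.gamma_pos.le h.gamma_lt.le
    nlinarith

end CoolOffBestResponse

/-! ### Existence of equilibria in cool-off strategies -/

section Existence

variable {X : Type*} {T : ℕ → ℕ}

/-- Along the private history `(b, y)` the strategy `s` planned to invest in a cool-off phase. -/
def PlansViolation (T : ℕ → ℕ) (s : PureStrategy X) {k : ℕ} (b : Fin k → Profile)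
    (y : Fin (k + 1) → X) : Prop :=
  ∃ l, ∃ hl : l < k, IsCoolOff T (Fin.take l hl.le b) ∧
    s l (Fin.take l hl.le b) (Fin.take (l + 1) (by omega) y) = Act.I

open Classical in
/-- The strategy `s`, modified so that it respects the cool-off phases, gives up after a planned
violation, and invests at the investment histories outside of `C`. -/
noncomputable def respectful (T : ℕ → ℕ) (C : ∀ {n : ℕ}, (Fin n → Profile) → Prop)
    (s : PureStrategy X) : PureStrategy X := fun _ b y =>
  if IsCoolOff T b ∨ HasViolation T b then Act.N
  -- `C` will be consistency with the opponent. Where it fails the payoff is unaffected, and `I`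
  -- secures the required investment probability.
  else if ¬ C b then Act.I
  -- The modified strategy never commits the violation, so the history does not record it; the plan
  -- of `s` has to be checked instead.
  else if PlansViolation T s b y then Act.N else s _ b y

theorem respectful_mem (C : ∀ {n : ℕ}, (Fin n → Profile) → Prop) (s : PureStrategy X) :
    respectful T C s ∈ pureCoolOff X T :=
  ⟨fun _ _ _ h => if_pos (Or.inl h), fun _ _ _ h => if_pos (Or.inr h)⟩

theorem respectful_of_not (C : ∀ {n : ℕ}, (Fin n → Profile) → Prop) (s : PureStrategy X) {n : ℕ}
    {a : Fin n → Profile} (y : Fin (n + 1) → X) (h1 : IsInvestment T a) (h2 : ¬ HasViolation T a)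
    (h3 : ¬ C a) : respectful T C s n a y = Act.I := by
  rw [respectful, if_neg, if_pos h3]
  rintro (h | h)
  · exact h h1
  · exact h2 h

variable {C : ∀ {n : ℕ}, (Fin n → Profile) → Prop} {i : Fin 2} {s t : PureStrategy X}
  {x : ℕ → Fin 2 → X}

/-- Until `s` first invests in a cool-off phase, none of the modifying clauses changes its action on
the path of play. -/
theorem hist_respectful (ht : t ∈ pureCoolOff X T)
    (hC : ∀ (s' : PureStrategy X) (n : ℕ), C (hist (pair i s' t) x n)) (k : ℕ)
    (hk : ∀ l < k, IsCoolOff T (hist (pair i s t) x l) → path (pair i s t) x l i = Act.N) :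
    hist (pair i (respectful T C s) t) x k = hist (pair i s t) x k := by
  induction k with
  | zero => rfl
  | succ k ih =>
    have ih' := ih fun l hl => hk l (by omega)
    rw [hist_succ, hist_succ, ih', path_congr_of_hist i x ih']
    by_cases hcool : IsCoolOff T (hist (pair i s t) x k)
    · have h1 := hk k (by omega) hcool
      rw [path_apply, pair_self] at h1
      rw [h1, respectful, if_pos (Or.inl hcool)]
    · rw [respectful, if_neg, if_neg (not_not.2 (hC s k)), if_neg]
      · rintro ⟨l, hl, h1, h2⟩
        rw [take_hist] at h1 h2
        have h3 := hk l (by omega) h1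
        rw [path_apply, pair_self] at h3
        exact absurd (h2.symm.trans h3) (by simp)
      · rintro (h | ⟨l, j, h1, h2⟩)
        · exact hcool h
        · rw [take_hist] at h1
          rw [hist_apply] at h2
          rcases eq_or_eq_opp i j with rfl | rfl
          · exact absurd (h2.symm.trans (hk l (by omega) h1)) (by simp)
          · rw [path_apply, pair_opp, ht.1 _ _ _ h1] at h2
            exact absurd h2 (by simp)

/-- From the first violation of `s` on, the opponent plays `N`, first because of the cool-off phase
and then because of the violation. So `s` earns at most 0 there, while the modification earns
exactly 0. -/
theorem stagePayoff_respectful {c : ℝ} (hc : c ∈ Set.Ioo (0 : ℝ) 1) (θ : State)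
    (ht : t ∈ pureCoolOff X T)
    (hC : ∀ (s' : PureStrategy X) (n : ℕ), C (hist (pair i s' t) x n)) (k : ℕ) :
    stagePayoff c θ (path (pair i s t) x k) i ≤
      stagePayoff c θ (path (pair i (respectful T C s) t) x k) i := by
  classical
  by_cases hk : ∀ l < k + 1, IsCoolOff T (hist (pair i s t) x l) →
      path (pair i s t) x l i = Act.N
  · have h1 := hist_respectful ht hC (k + 1) hk
    have h2 : path (pair i (respectful T C s) t) x k = path (pair i s t) x k := by
      have := congrFun h1 (Fin.last k)
      rwa [hist_apply, hist_apply] at this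
    rw [h2]
  · push Not at hk
    have hex : ∃ l, l < k + 1 ∧ IsCoolOff T (hist (pair i s t) x l) ∧
      path (pair i s t) x l i ≠ Act.N := hk
    obtain ⟨l, ⟨hlk, hlcool, hlI⟩, hmin⟩ : ∃ l, (l < k + 1 ∧ IsCoolOff T (hist (pair i s t) x l) ∧
        path (pair i s t) x l i ≠ Act.N) ∧ ∀ l' < l, ¬ (l' < k + 1 ∧
        IsCoolOff T (hist (pair i s t) x l') ∧ path (pair i s t) x l' i ≠ Act.N) :=
      ⟨Nat.find hex, Nat.find_spec hex, fun l' hl' => Nat.find_min hex hl'⟩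
    have hlI' := act_ne_N_iff.1 hlI
    have hh : hist (pair i (respectful T C s) t) x l = hist (pair i s t) x l := by
      refine hist_respectful ht hC l fun l' hl' hcool => ?_
      by_contra hcon
      exact hmin l' hl' ⟨by omega, hcool, hcon⟩
    have hN : path (pair i (respectful T C s) t) x k i = Act.N := by
      rw [path_apply, pair_self, respectful]
      rcases Nat.lt_succ_iff_lt_or_eq.1 hlk with hlt | rfl
      · split_ifs with h1 h2 h3
        · rfl
        · rfl
        · refine absurd ⟨l, hlt, ?_⟩ h3
          rw [take_hist, hh]
          refine ⟨hlcool, ?_⟩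
          rw [path_apply, pair_self] at hlI'
          exact hlI'
        · exact absurd (hC _ k) h2
      · rw [hh, if_pos (Or.inl hlcool)]
    have hopp : path (pair i s t) x k (opp i) = Act.N := by
      rw [path_apply, pair_opp]
      rcases Nat.lt_succ_iff_lt_or_eq.1 hlk with hlt | rfl
      · refine ht.2 _ _ _ ⟨⟨l, hlt⟩, i, ?_, ?_⟩
        · rw [take_hist]
          exact hlcool
        · rw [hist_apply]
          exact hlI'
      · exact ht.1 _ _ _ hlcool
    rw [stagePayoff_of_N hN]
    rcases act_eq_I_or_N (path (pair i s t) x k i) with h | h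
    · rw [stagePayoff_of_I h, hopp]
      have := hc.1
      simp [this.le]
    · rw [stagePayoff_of_N h]

variable [Fintype X] [MeasurableSpace X] [MeasurableSingletonClass X]
  {f : State → PMF X} {p₀ c δ η γ D : ℝ}

theorem continuous_valueAgainst (p₀ : ℝ) (f : State → PMF X) (hc : c ∈ Set.Ioo (0 : ℝ) 1)
    (h0 : 0 < δ) (h1 : δ < 1) (i : Fin 2) (ν : MixedStrategy X) :
    Continuous (valueAgainst p₀ f c δ i ν) :=
  continuous_integral_pair i (continuous_exAnteValue p₀ f hc h0 h1 i) ν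

theorem valueAgainst_respectful (hp : p₀ ∈ Set.Ioo (0 : ℝ) 1) (hc : c ∈ Set.Ioo (0 : ℝ) 1)
    (h0 : 0 < δ) (h1 : δ < 1) {ν : MixedStrategy X} (hν : ν ∈ mixedCoolOff X T)
    (s : PureStrategy X) : valueAgainst p₀ f c δ i ν s ≤
      valueAgainst p₀ f c δ i ν (respectful T (ConsistentMixed (opp i) ν) s) := by
  have hcont := fun s => (continuous_exAnteValue p₀ f hc h0 h1 i).comp
    (continuous_pair_right i s)
  refine integral_mono_ae (integrable_of_continuous (hcont _))
    (integrable_of_continuous (hcont _)) ?_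
  -- Every history produced against a strategy in the support is consistent with `ν`, so the default
  -- clause is never used on the path of play.
  have hsupp : ∀ᵐ t ∂(ν : Measure (PureStrategy X)), t ∈ (ν : Measure (PureStrategy X)).support :=
    Measure.support_mem_ae
  filter_upwards [ae_mem_pureCoolOff hν, hsupp] with t ht hts
  have hθ : ∀ θ, pureValue f c δ θ i (pair i s t) ≤
      pureValue f c δ θ i (pair i (respectful T (ConsistentMixed (opp i) ν) s) t) := by
    intro θ
    refine integral_mono (integrable_longRunPayoff_path hc h0 h1 i θ _ _)
      (integrable_longRunPayoff_path hc h0 h1 i θ _ _) fun x => ?_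
    simp only [longRunPayoff_eq]
    refine discounted_mono h0 h1 (fun _ => abs_stagePayoff_le hc _ _ _)
      (fun _ => abs_stagePayoff_le hc _ _ _) fun k => ?_
    refine stagePayoff_respectful hc θ ht (fun s' n => ?_) k
    have := consistent_hist (pair i s' t) x n (opp i)
    rw [pair_opp] at this
    exact ⟨own (opp i) (n + 1) x, t, hts, this⟩
  exact add_le_add (mul_le_mul_of_nonneg_left (hθ _) hp.1.le)
    (mul_le_mul_of_nonneg_left (hθ _) (by linarith [hp.2]))

/-- Every profile of cool-off strategies admits best responses in cool-off strategies. -/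
theorem IsAdmissible.exists_bestResponse (h : IsAdmissible p₀ f c δ η γ D T) (i : Fin 2)
    {ν : MixedStrategy X} (hν : ν ∈ coolOffStrategies f T (1 - γ ^ 2) (opp i)) :
    ∃ s, IsBestResponse p₀ f c δ i ν s ∧
      diracStrategy s ∈ coolOffStrategies f T (1 - γ ^ 2) i := by
  obtain ⟨x₀⟩ : Nonempty X := (f State.H).support_nonempty.to_type
  obtain ⟨s, -, hs⟩ := (isCompact_univ (X := PureStrategy X)).exists_isMaxOn
    ⟨fun _ _ _ => Act.N, trivial⟩
    (continuous_valueAgainst p₀ f h.cost h.discount_pos h.discount_lt i ν).continuousOn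
  have hbr : IsBestResponse p₀ f c δ i ν (respectful T (ConsistentMixed (opp i) ν) s) :=
    fun s' => (hs (Set.mem_univ s')).trans
      (valueAgainst_respectful h.prior h.cost h.discount_pos h.discount_lt hν.1 s)
  exact ⟨_, hbr, h.diracStrategy_mem (respectful_mem _ s) hν hbr fun n a y h1 h2 h3 =>
    respectful_of_not _ s y h1 h2 h3⟩

theorem payoff_update_eq (f : State → PMF X) (hp : p₀ ∈ Set.Ioo (0 : ℝ) 1)
    (hc : c ∈ Set.Ioo (0 : ℝ) 1) (h0 : 0 < δ) (h1 : δ < 1) (σ : Fin 2 → MixedStrategy X)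
    (i : Fin 2) (τ : MixedStrategy X) : payoff p₀ f c δ (Function.update σ i τ) i =
      ∫ s, valueAgainst p₀ f c δ i (σ (opp i)) s ∂(τ : Measure (PureStrategy X)) := by
  rw [payoff_eq_integral f hc h0 h1 hp]
  exact mixedValue_update_eq (continuous_exAnteValue p₀ f hc h0 h1 i) i σ τ

theorem payoff_update_dirac (f : State → PMF X) (hp : p₀ ∈ Set.Ioo (0 : ℝ) 1)
    (hc : c ∈ Set.Ioo (0 : ℝ) 1) (h0 : 0 < δ) (h1 : δ < 1) (σ : Fin 2 → MixedStrategy X)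
    (i : Fin 2) (s : PureStrategy X) :
    payoff p₀ f c δ (Function.update σ i (diracStrategy s)) i =
      valueAgainst p₀ f c δ i (σ (opp i)) s := by
  rw [payoff_update_eq f hp hc h0 h1]
  exact integral_dirac' _ _
    (continuous_valueAgainst p₀ f hc h0 h1 i _).measurable.stronglyMeasurable

/-- There is an equilibrium in cool-off strategies. -/
theorem IsAdmissible.exists_nash (h : IsAdmissible p₀ f c δ η γ D T) :
    ∃ σ ∈ coolOffProfiles f T (1 - γ ^ 2), IsNash p₀ f c δ σ := by
  have hε : 0 < 1 - γ ^ 2 := by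
    have := pow_lt_one₀ h.gamma_pos.le h.gamma_lt two_ne_zero
    linarith
  obtain ⟨σ, hσ, hnash⟩ := exists_restricted_equilibrium
    (G := fun i => exAnteValue p₀ f c δ i)
    (fun i => continuous_exAnteValue p₀ f h.cost h.discount_pos h.discount_lt i)
    (K := coolOffStrategies f T (1 - γ ^ 2))
    (isClosed_coolOffStrategies h.pos T _) (nonempty_coolOffStrategies h.pos T hε)
    (fun i p hp hs τ hτ => mixture_mem_coolOffStrategies h.pos T _ i p hp hs τ hτ)
  refine ⟨σ, hσ, fun i τ => ?_⟩
  -- An unrestricted best response lies in the restricted set, so no deviation beats the restricted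
  -- equilibrium.
  obtain ⟨s, hbr, hs⟩ := h.exists_bestResponse i (hσ (opp i))
  have h1 := hnash i _ hs
  have h2 := payoff_update_dirac f h.prior h.cost h.discount_pos h.discount_lt σ i s
  have e : ∀ σ', mixedValue (exAnteValue p₀ f c δ i) σ' = payoff p₀ f c δ σ' i := fun σ' =>
    (payoff_eq_integral f h.cost h.discount_pos h.discount_lt h.prior σ' i).symm
  rw [e, e, h2] at h1
  refine le_trans ?_ h1
  rw [payoff_update_eq f h.prior h.cost h.discount_pos h.discount_lt]
  calc ∫ s', valueAgainst p₀ f c δ i (σ (opp i)) s' ∂(τ : Measure (PureStrategy X))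
      ≤ ∫ _s', valueAgainst p₀ f c δ i (σ (opp i)) s ∂(τ : Measure (PureStrategy X)) :=
        integral_mono (integrable_of_continuous (continuous_valueAgainst p₀ f h.cost
          h.discount_pos h.discount_lt i _)) (integrable_const _) fun s' => hbr s'
    _ = _ := by simp

end Existence

/-! ### The first investment phase -/

section FirstPhase

/-- The history without investments up to the end of the first cool-off phase, and with joint
investments afterwards. -/
def firstPhase (T : ℕ → ℕ) (n : ℕ) : Fin n → Profile := fun k _ =>
  -- The lengths 0, …, T 1 are cool-off lengths, so there are T 1 + 1 periods of `N` and the first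
  -- joint investment is entry T 1 + 1.
  if (k : ℕ) ≤ T 1 then Act.N else Act.I

variable {T : ℕ → ℕ}

theorem take_firstPhase {k n : ℕ} (hk : k ≤ n) : Fin.take k hk (firstPhase T n) = firstPhase T k :=
  rfl

theorem lastInvestment_firstPhase (T : ℕ → ℕ) (n : ℕ) :
    lastInvestment T n (firstPhase T n) = if n ≤ T 1 then none else some n := by
  induction n with
  | zero => simp [lastInvestment]
  | succ n ih =>
    have h1 : lastInvestment T n (Fin.init (firstPhase T (n + 1))) =
        if n ≤ T 1 then none else some n := ih
    by_cases hn : n ≤ T 1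
    · rw [if_pos hn] at h1
      simp only [lastInvestment, h1]
    · rw [if_neg hn] at h1
      have h2 : firstPhase T (n + 1) (Fin.last n) = fun _ => Act.I := by
        funext j
        simp [firstPhase, hn]
      simp only [lastInvestment, h1, h2, if_true]
      rw [if_neg (by omega)]

theorem isInvestment_firstPhase_iff {n : ℕ} : IsInvestment T (firstPhase T n) ↔ T 1 < n := by
  rw [IsInvestment, lastInvestment_firstPhase]
  split_ifs with h
  · simp [h]
  · simpa using h

theorem not_hasViolation_firstPhase (n : ℕ) : ¬ HasViolation T (firstPhase T n) := by
  rintro ⟨k, i, h1, h2⟩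
  rw [take_firstPhase, IsCoolOff, isInvestment_firstPhase_iff] at h1
  rw [firstPhase, if_pos (not_lt.1 h1)] at h2
  exact absurd h2 (by simp)

theorem isPhase_firstPhase {n : ℕ} (hn : T 1 < n) : IsPhase T (firstPhase T n) 0 (T 1 + 1) where
  le_start := by simp
  start_pos := by omega
  start_le := hn
  coolOff k hk _ hkm := by
    rw [take_firstPhase, IsCoolOff, isInvestment_firstPhase_iff]
    omega
  investment k hk hmk := by
    rw [take_firstPhase, isInvestment_firstPhase_iff]
    omega
  invest k hmk := by
    funext j
    rw [firstPhase, if_neg (by omega)]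

variable {X : Type*} [Fintype X] {f : State → PMF X}

/-- Each cool-off period preserves the probability and each investment keeps at least the fraction
γ². Thus the whole first phase is consistent with the opponent, and the belief estimates apply along
it. -/
theorem reachProb_firstPhase_pos (hf : ∀ θ x, 0 < f θ x) {γ : ℝ} (hγ0 : 0 < γ) {j : Fin 2}
    {ν : MixedStrategy X} (hν : ν ∈ coolOffStrategies f T (1 - γ ^ 2) j) (n : ℕ) :
    0 < reachProb f State.H j ν (firstPhase T n) := by
  have hν' := (mem_coolOffStrategies_iff hf _ _ _ _).1 hν
  induction n with
  | zero =>
    have h1 : ∀ x : Fin 1 → X,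
        {s : PureStrategy X | Consistent j (firstPhase T 0) x s} = Set.univ := by
      intro x; ext s; simp [Consistent]
    simp only [reachProb, h1, probReal_univ, mul_one]
    rw [sum_signalWeight]
    exact one_pos
  | succ n ih =>
    by_cases hn : n ≤ T 1
    · have := reachProb_take_succ_of_coolOff (f := f) (j := j) State.H hν'.1
        (not_hasViolation_firstPhase (n + 1)) (Fin.last n)
        (by
          rw [take_firstPhase, IsCoolOff, isInvestment_firstPhase_iff]
          exact not_lt.2 hn)
      exact this.symm ▸ ih
    · have h1 := reachProb_take_succ_of_invest (f := f) (j := j) (ν := ν)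
        (a := firstPhase T (n + 1)) State.H (Fin.last n) (by simp [firstPhase, hn])
      have h2 := hν'.2 n (firstPhase T n) (isInvestment_firstPhase_iff.2 (not_le.1 hn))
        (not_hasViolation_firstPhase n)
      rw [sub_sub_cancel] at h2
      have h3 : reachProb f State.H j ν (firstPhase T (n + 1)) =
        reachInvestProb f State.H j ν (firstPhase T n) := h1
      rw [h3]
      exact lt_of_lt_of_le (by positivity) h2

variable [MeasurableSpace X] [MeasurableSingletonClass X] {p₀ c δ η γ D : ℝ}

open Classical in
/-- Against cool-off strategies, best responses invest throughout the first phase with high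
probability. -/
theorem IsAdmissible.firstPhase_mass (h : IsAdmissible p₀ f c δ η γ D T) {i : Fin 2}
    {s : PureStrategy X} (hs : s ∈ pureCoolOff X T) {ν : MixedStrategy X}
    (hν : ν ∈ coolOffStrategies f T (1 - γ ^ 2) (opp i))
    (hbr : IsBestResponse p₀ f c δ i ν s) {n : ℕ} (hn : T 1 < n) :
    1 - failureBound f p₀ c η γ D 0 (T 1) ≤
      ∑ x : Fin (n + 1) → X, signalWeight f State.H x *
        (if Consistent i (firstPhase T n) x s ∧ s n (firstPhase T n) x = Act.I then 1 else 0) := by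
  have h1 := h.followsOwn_mul_le hs hν hbr (not_hasViolation_firstPhase n)
    (isPhase_firstPhase hn) (Nat.zero_le n) (reachProb_firstPhase_pos h.pos h.gamma_pos hν n)
  have h2 : ∑ u : Fin 0 → X, signalWeight f State.H u *
      (if FollowsOwn i s (Fin.take 0 (Nat.zero_le n) (firstPhase T n)) u then 1 else 0) = 1 := by
    refine (Finset.sum_congr rfl fun u _ => ?_).trans (sum_signalWeight f State.H 0)
    have hfo : FollowsOwn i s (Fin.take 0 (Nat.zero_le n) (firstPhase T n)) u := fun k => k.elim0
    rw [if_pos hfo, mul_one]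
  rw [h2, mul_one] at h1
  simpa using h1

end FirstPhase

/-! ### Efficiency -/

section Efficiency

/-- After period index `N` nothing is assumed; the factor 2 covers the drop from d ≤ 1 to -1. -/
theorem discounted_ge_of_le {δ : ℝ} (h0 : 0 < δ) (h1 : δ < 1) {v : ℕ → ℝ} (hv : ∀ t, |v t| ≤ 1)
    {d : ℝ} (hd : d ≤ 1) {m N : ℕ} (h : ∀ t ≤ N, (if m ≤ t then d else 0) ≤ v t) :
    δ ^ m * d - δ ^ (N + 1) * 2 ≤ discounted δ v := by
  have hs := (hasSum_discounted_tail h0 h1 m d).sub (hasSum_discounted_tail h0 h1 (N + 1) 2)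
  refine hasSum_le (fun t => ?_) hs (summable_discounted h0 h1 hv).hasSum
  rw [← mul_sub]
  refine mul_le_mul_of_nonneg_left ?_ (mul_nonneg (by linarith) (by positivity))
  have hvt := (abs_le.1 (hv t)).1
  by_cases ht : t ≤ N
  · rw [if_neg (show ¬ N + 1 ≤ t by omega), sub_zero]
    exact h t ht
  · rw [if_pos (show N + 1 ≤ t by omega)]
    split_ifs <;> linarith

variable {X : Type*} {T : ℕ → ℕ} {f : State → PMF X}

open Classical in
/-- Invest along the first phase if the signals received before it are in favour of `H`. -/
noncomputable def cautious (T : ℕ → ℕ) (f : State → PMF X) : PureStrategy X := fun n a x =>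
  if ∃ h : T 1 < n, a = firstPhase T n ∧
    signalWeight f State.L (Fin.take (T 1 + 1) (by omega) x) ≤
      signalWeight f State.H (Fin.take (T 1 + 1) (by omega) x) then Act.I else Act.N

theorem consistent_cautious (i : Fin 2) {n : ℕ} (hn : T 1 < n) (x : Fin (n + 1) → X)
    (hx : signalWeight f State.L (Fin.take (T 1 + 1) (by omega) x) ≤
      signalWeight f State.H (Fin.take (T 1 + 1) (by omega) x)) :
    Consistent i (firstPhase T n) x (cautious T f) := by
  intro k
  rw [take_firstPhase, cautious]
  by_cases hk : (k : ℕ) ≤ T 1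
  · rw [if_neg, firstPhase, if_pos hk]
    rintro ⟨h, -⟩
    omega
  · rw [if_pos, firstPhase, if_neg hk]
    exact ⟨not_le.1 hk, rfl, hx⟩

variable {c δ : ℝ} {i : Fin 2} {t : PureStrategy X} {x : ℕ → Fin 2 → X}

theorem longRunPayoff_cautious_ge (hc : c ∈ Set.Ioo (0 : ℝ) 1) (h0 : 0 < δ) (h1 : δ < 1) {N : ℕ}
    (hN : T 1 < N)
    (hG : signalWeight f State.L (own i (T 1 + 1) x) ≤ signalWeight f State.H (own i (T 1 + 1) x))
    (hE : Consistent (opp i) (firstPhase T N) (own (opp i) (N + 1) x) t ∧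
      t N (firstPhase T N) (own (opp i) (N + 1) x) = Act.I) :
    δ ^ (T 1 + 1) * (1 - c) - δ ^ (N + 1) * 2 ≤
      longRunPayoff c δ i (State.H, x, path (pair i (cautious T f) t) x) := by
  rw [longRunPayoff_eq]
  refine discounted_ge_of_le h0 h1 (fun _ => abs_stagePayoff_le hc _ _ _) (by linarith [hc.1])
    fun k hk => ?_
  have hh : hist (pair i (cautious T f) t) x N = firstPhase T N :=
    (hist_eq_iff i _ _ _ _).2 ⟨consistent_cautious i hN _ hG, hE.1⟩
  have hhk : hist (pair i (cautious T f) t) x k = firstPhase T k := by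
    rw [← take_hist (pair i (cautious T f) t) x hk, hh, take_firstPhase]
  by_cases hmk : T 1 < k
  · rw [if_pos (show T 1 + 1 ≤ k from hmk)]
    have hi : path (pair i (cautious T f) t) x k i = Act.I := by
      rw [path_apply, pair_self, hhk, cautious, if_pos ⟨hmk, rfl, hG⟩]
    have hj : path (pair i (cautious T f) t) x k (opp i) = Act.I := by
      rcases hk.lt_or_eq with hlt | rfl
      · have := congrFun (congrFun hh ⟨k, hlt⟩) (opp i)
        rw [hist_apply] at this
        rw [this, firstPhase, if_neg (not_le.2 hmk)]
      · rw [path_apply, pair_opp, hhk]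
        exact hE.2
    rw [stagePayoff_of_I hi, if_pos ⟨rfl, hj⟩]
  · rw [if_neg (show ¬ T 1 + 1 ≤ k from hmk), stagePayoff_of_N]
    rw [path_apply, pair_self, cautious, if_neg]
    rintro ⟨h, -⟩
    exact hmk h

theorem longRunPayoff_cautious_eq_zero
    (hG : ¬ signalWeight f State.L (own i (T 1 + 1) x) ≤
      signalWeight f State.H (own i (T 1 + 1) x)) (θ : State) :
    longRunPayoff c δ i (θ, x, path (pair i (cautious T f) t) x) = 0 := by
  rw [longRunPayoff_eq, discounted]
  have : ∀ k, stagePayoff c θ (path (pair i (cautious T f) t) x k) i = 0 := by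
    intro k
    apply stagePayoff_of_N
    rw [path_apply, pair_self, cautious, if_neg]
    rintro ⟨h, -, h2⟩
    exact hG h2
  simp [this]

variable [Fintype X]

-- Where θ' is at least as likely as θ, the weight under θ is at most the geometric mean of both
-- weights, whose total is a power of the affinity.
open Classical in
theorem sum_signalWeight_misled_le (f : State → PMF X) (θ θ' : State) (hθ : θ ≠ θ') (n : ℕ) :
    ∑ u : Fin n → X, signalWeight f θ u *
      (if signalWeight f θ u ≤ signalWeight f θ' u then 1 else 0) ≤ affinity f ^ n := by
  have h1 := sum_prod_pi (fun x => √((f State.H x).toReal * (f State.L x).toReal)) n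
  change _ ≤ (∑ x, √((f State.H x).toReal * (f State.L x).toReal)) ^ n
  rw [← h1]
  refine Finset.sum_le_sum fun u _ => ?_
  change _ ≤ rootWeight f u
  split_ifs with h
  · rw [mul_one]
    refine abs_le_of_sq_le_sq' ?_ (rootWeight_nonneg _ _) |>.2
    have h2 : rootWeight f u ^ 2 = signalWeight f θ u * signalWeight f θ' u := by
      rw [rootWeight_sq]
      cases θ <;> cases θ' <;> first | rfl | exact mul_comm _ _ | exact absurd rfl hθ
    rw [h2, sq]
    exact mul_le_mul_of_nonneg_left h (signalWeight_nonneg _ _ _)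
  · rw [mul_zero]
    exact rootWeight_nonneg _ _

variable [MeasurableSpace X] [MeasurableSingletonClass X]

theorem integrable_own (f : State → PMF X) (θ : State) (i : Fin 2) {n : ℕ}
    (g : (Fin n → X) → (Fin n → X) → ℝ) :
    Integrable (fun x => g (own i n x) (own (opp i) n x)) (signalLaw f θ) := by
  have hm : Measurable fun x : ℕ → Fin 2 → X => (own i n x, own (opp i) n x) :=
    (measurable_own i _).prodMk (measurable_own (opp i) _)
  have : IsProbabilityMeasure ((signalLaw f θ).map fun x => (own i n x, own (opp i) n x)) :=
    Measure.isProbabilityMeasure_map hm.aemeasurable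
  have hint : Integrable (fun p : (Fin n → X) × (Fin n → X) => g p.1 p.2)
      ((signalLaw f θ).map fun x => (own i n x, own (opp i) n x)) := Integrable.of_finite
  exact hint.comp_measurable hm

-- If the own early signals favour `H` and the opponent invests up to `N`, the payoff is at least
-- the main term; otherwise it is at least -1. The two events concern different players' signals and
-- are independent given the state.
open Classical in
theorem pureValue_cautious_H_ge (hc : c ∈ Set.Ioo (0 : ℝ) 1) (h0 : 0 < δ) (h1 : δ < 1) {N : ℕ}
    (hN : T 1 < N) {e : ℝ}
    (hE : 1 - e ≤ ∑ x : Fin (N + 1) → X, signalWeight f State.H x *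
      (if Consistent (opp i) (firstPhase T N) x t ∧ t N (firstPhase T N) x = Act.I
        then 1 else 0)) (hδN : δ ^ (N + 1) * 2 ≤ 1) :
    δ ^ (T 1 + 1) * (1 - c) - δ ^ (N + 1) * 2 - 2 * (affinity f ^ (T 1 + 1) + e) ≤
      pureValue f c δ State.H i (pair i (cautious T f) t) := by
  set B := δ ^ (T 1 + 1) * (1 - c) - δ ^ (N + 1) * 2 with hB
  have hB1 : B ≤ 1 := by
    have e1 : δ ^ (T 1 + 1) ≤ 1 := pow_le_one₀ h0.le h1.le
    have e2 : 0 < δ ^ (T 1 + 1) := by positivity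
    have e3 : 0 < δ ^ (N + 1) := by positivity
    nlinarith [hc.1, hc.2]
  have hB0 : 0 ≤ B + 1 := by
    have e2 : 0 ≤ δ ^ (T 1 + 1) * (1 - c) := mul_nonneg (by positivity) (by linarith [hc.2])
    linarith
  let G : (Fin (N + 1) → X) → ℝ := fun u =>
    if signalWeight f State.L (Fin.take (T 1 + 1) (by omega) u) ≤
      signalWeight f State.H (Fin.take (T 1 + 1) (by omega) u) then 1 else 0
  let E : (Fin (N + 1) → X) → ℝ := fun v =>
    if Consistent (opp i) (firstPhase T N) v t ∧ t N (firstPhase T N) v = Act.I then 1 else 0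
  have hint := integral_own f State.H i (n := N + 1) fun u v => (B + 1) * (G u * E v) - 1
  have hle : ∫ x, ((B + 1) * (G (own i (N + 1) x) * E (own (opp i) (N + 1) x)) - 1)
      ∂(signalLaw f State.H) ≤ pureValue f c δ State.H i (pair i (cautious T f) t) := by
    refine integral_mono (integrable_own f State.H i fun u v => (B + 1) * (G u * E v) - 1)
      (integrable_longRunPayoff_path hc h0 h1 i _ _ _) fun x => ?_
    have hge := (abs_le.1 (abs_longRunPayoff_le hc h0 h1 i
      (State.H, x, path (pair i (cautious T f) t) x))).1
    by_cases hG : signalWeight f State.L (own i (T 1 + 1) x) ≤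
        signalWeight f State.H (own i (T 1 + 1) x)
    · by_cases hEx : Consistent (opp i) (firstPhase T N) (own (opp i) (N + 1) x) t ∧
          t N (firstPhase T N) (own (opp i) (N + 1) x) = Act.I
      · have e1 : G (own i (N + 1) x) = 1 := if_pos hG
        have e2 : E (own (opp i) (N + 1) x) = 1 := if_pos hEx
        simp only [e1, e2]
        have := longRunPayoff_cautious_ge (f := f) hc h0 h1 hN hG hEx
        linarith
      · have e2 : E (own (opp i) (N + 1) x) = 0 := if_neg hEx
        simp only [e2]
        linarith
    · have e1 : G (own i (N + 1) x) = 0 := if_neg hG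
      simp only [e1]
      linarith
  rw [hint] at hle
  have hsum : ∑ u : Fin (N + 1) → X, ∑ v, signalWeight f State.H u * signalWeight f State.H v *
      ((B + 1) * (G u * E v) - 1) = (B + 1) * ((∑ u, signalWeight f State.H u * G u) *
        ∑ v, signalWeight f State.H v * E v) - 1 := by
    have e1 : ∀ u v : Fin (N + 1) → X, signalWeight f State.H u * signalWeight f State.H v *
      ((B + 1) * (G u * E v) - 1) = (B + 1) * ((signalWeight f State.H u * G u) *
        (signalWeight f State.H v * E v)) - signalWeight f State.H u * signalWeight f State.H v :=
      fun u v => by ring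
    simp only [e1, Finset.sum_sub_distrib, ← Finset.mul_sum, ← Finset.sum_mul, sum_signalWeight,
      mul_one]
  rw [hsum] at hle
  have hGsum : 1 - affinity f ^ (T 1 + 1) ≤ ∑ u, signalWeight f State.H u * G u := by
    have e1 := sum_signalWeight_mul_take f State.H (b := T 1 + 1) (N := N + 1) (by omega)
      fun u => if signalWeight f State.L u ≤ signalWeight f State.H u then (1 : ℝ) else 0
    have e2 : ∑ u, signalWeight f State.H u * G u = _ := e1
    rw [e2]
    have e3 := sum_signalWeight_misled_le f State.H State.L (by simp) (T 1 + 1)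
    have e4 : (1 : ℝ) ≤ (∑ u : Fin (T 1 + 1) → X, signalWeight f State.H u *
        if signalWeight f State.L u ≤ signalWeight f State.H u then (1 : ℝ) else 0) +
        ∑ u : Fin (T 1 + 1) → X, signalWeight f State.H u *
        if signalWeight f State.H u ≤ signalWeight f State.L u then (1 : ℝ) else 0 := by
      rw [← Finset.sum_add_distrib]
      calc (1 : ℝ) = ∑ u : Fin (T 1 + 1) → X, signalWeight f State.H u :=
            (sum_signalWeight f State.H _).symm
        _ ≤ _ := Finset.sum_le_sum fun u _ => by
            have h3 := signalWeight_nonneg f State.H u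
            rcases le_total (signalWeight f State.L u) (signalWeight f State.H u) with h | h
            · rw [if_pos h]
              split_ifs <;> linarith
            · rw [if_pos h]
              split_ifs <;> linarith
    linarith
  have hbnd : ∀ g : (Fin (N + 1) → X) → ℝ, (∀ u, g u ≤ 1) →
      ∑ u, signalWeight f State.H u * g u ≤ 1 := by
    intro g hg
    rw [← sum_signalWeight f State.H (N + 1)]
    refine Finset.sum_le_sum fun u _ => ?_
    exact mul_le_of_le_one_right (signalWeight_nonneg _ _ _) (hg u)
  have hG1 := hbnd G fun u => by simp only [G]; split_ifs <;> norm_num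
  have hE1 := hbnd E fun u => by simp only [E]; split_ifs <;> norm_num
  have hE' : 1 - e ≤ ∑ v, signalWeight f State.H v * E v := hE
  set P := ∑ u, signalWeight f State.H u * G u
  set Q := ∑ v, signalWeight f State.H v * E v
  have hPQ : 1 - (affinity f ^ (T 1 + 1) + e) ≤ P * Q := by nlinarith
  have hPQ1 : P * Q ≤ 1 := by
    have hQ0 : 0 ≤ Q := Finset.sum_nonneg fun v _ => mul_nonneg (signalWeight_nonneg _ _ _)
      (by simp only [E]; split_ifs <;> norm_num)
    nlinarith
  nlinarith

-- Only misleading early signals make the strategy invest at all, and then the loss is at most 1.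
open Classical in
theorem pureValue_cautious_L_ge (hc : c ∈ Set.Ioo (0 : ℝ) 1) (h0 : 0 < δ) (h1 : δ < 1) :
    -affinity f ^ (T 1 + 1) ≤ pureValue f c δ State.L i (pair i (cautious T f) t) := by
  let G : (Fin (T 1 + 1) → X) → ℝ := fun u =>
    if signalWeight f State.L u ≤ signalWeight f State.H u then 1 else 0
  have hint := integral_own f State.L i (n := T 1 + 1) fun u _ => -G u
  have hle : ∫ x, -G (own i (T 1 + 1) x) ∂(signalLaw f State.L) ≤
      pureValue f c δ State.L i (pair i (cautious T f) t) := by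
    refine integral_mono (integrable_own f State.L i fun u _ => -G u)
      (integrable_longRunPayoff_path hc h0 h1 i _ _ _) fun x => ?_
    by_cases hG : signalWeight f State.L (own i (T 1 + 1) x) ≤
        signalWeight f State.H (own i (T 1 + 1) x)
    · have e1 : G (own i (T 1 + 1) x) = 1 := if_pos hG
      simp only [e1]
      exact (abs_le.1 (abs_longRunPayoff_le hc h0 h1 i _)).1
    · have e1 : G (own i (T 1 + 1) x) = 0 := if_neg hG
      simp only [e1, longRunPayoff_cautious_eq_zero hG, neg_zero, le_refl]
  rw [hint] at hle
  have hsum : ∑ u : Fin (T 1 + 1) → X, ∑ v : Fin (T 1 + 1) → X, signalWeight f State.L u *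
      signalWeight f State.L v * -G u = -∑ u, signalWeight f State.L u * G u := by
    have e1 : ∀ u v : Fin (T 1 + 1) → X, signalWeight f State.L u * signalWeight f State.L v *
      -G u = signalWeight f State.L v * -(signalWeight f State.L u * G u) := fun u v => by ring
    simp only [e1, ← Finset.sum_mul, sum_signalWeight, one_mul, Finset.sum_neg_distrib]
  rw [hsum] at hle
  have := sum_signalWeight_misled_le f State.L State.H (by simp) (T 1 + 1)
  exact (neg_le_neg this).trans hle

/-- These ceilings turn a lower bound on the ex-ante payoff into one for each state separately. -/
theorem payoffInState_le (hc : c ∈ Set.Ioo (0 : ℝ) 1) (h0 : 0 < δ) (h1 : δ < 1)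
    (σ : Fin 2 → MixedStrategy X) (i : Fin 2) :
    payoffInState f c δ σ State.H i ≤ 1 - c ∧ payoffInState f c δ σ State.L i ≤ 0 := by
  have key : ∀ (θ : State) (d : ℝ), |d| ≤ 1 → (∀ a, stagePayoff c θ a i ≤ d) →
      payoffInState f c δ σ θ i ≤ d := by
    intro θ d hd h
    rw [payoffInState_eq f hc h0 h1]
    have h2 : ∀ s, pureValue f c δ θ i s ≤ d := by
      intro s
      calc pureValue f c δ θ i s ≤ ∫ _x, d ∂(signalLaw f θ) := by
            refine integral_mono (integrable_longRunPayoff_path hc h0 h1 i _ _ _)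
              (integrable_const _) fun x => ?_
            simp only [longRunPayoff_eq]
            rw [← discounted_const h0 h1 d]
            exact discounted_mono h0 h1 (fun _ => abs_stagePayoff_le hc _ _ _) (fun _ => hd)
              fun t => h _
        _ = d := by simp
    calc _ ≤ ∫ _s, d ∂(Measure.pi fun k => (σ k : Measure (PureStrategy X))) :=
          integral_mono (integrable_of_continuous_pure (continuous_pureValue f hc h0 h1 θ i))
            (integrable_const _) h2
      _ = d := by simp
  constructor
  · refine key _ _ (by rw [abs_le]; constructor <;> linarith [hc.1, hc.2]) fun a => ?_
    unfold stagePayoff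
    split
    · linarith [hc.2]
    · split_ifs <;> linarith [hc.1]
  · refine key _ _ (by simp) fun a => ?_
    unfold stagePayoff
    split
    · exact le_rfl
    · simp [hc.1.le]

variable {p₀ η γ D : ℝ}

/-- In equilibrium almost every pure strategy is a best response. -/
theorem ae_isBestResponse_of_isNash (hp : p₀ ∈ Set.Ioo (0 : ℝ) 1) (hc : c ∈ Set.Ioo (0 : ℝ) 1)
    (h0 : 0 < δ) (h1 : δ < 1) {σ : Fin 2 → MixedStrategy X} (hσ : IsNash p₀ f c δ σ)
    (i : Fin 2) : ∀ᵐ s ∂(σ i : Measure (PureStrategy X)),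
      IsBestResponse p₀ f c δ i (σ (opp i)) s := by
  have hcont := continuous_valueAgainst p₀ f hc h0 h1 i (σ (opp i))
  have hle : ∀ s, valueAgainst p₀ f c δ i (σ (opp i)) s ≤ payoff p₀ f c δ σ i := fun s => by
    rw [← payoff_update_dirac f hp hc h0 h1]
    exact hσ i _
  -- The shortfall of a pure strategy is nonnegative and averages to 0 under the equilibrium
  -- strategy, so it vanishes almost everywhere.
  have heq : ∫ s, (payoff p₀ f c δ σ i - valueAgainst p₀ f c δ i (σ (opp i)) s)
      ∂(σ i : Measure (PureStrategy X)) = 0 := by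
    rw [integral_sub (integrable_const _) (integrable_of_continuous hcont),
      ← payoff_update_eq f hp hc h0 h1, Function.update_eq_self]
    simp
  have hae := (integral_eq_zero_iff_of_nonneg (fun s => sub_nonneg.2 (hle s))
    ((integrable_const _).sub (integrable_of_continuous hcont))).1 heq
  filter_upwards [hae] with s hs s'
  have : payoff p₀ f c δ σ i - valueAgainst p₀ f c δ i (σ (opp i)) s = 0 := hs
  linarith [hle s']

/-- Payoffs in every equilibrium in cool-off strategies are almost efficient. -/
theorem IsAdmissible.payoff_ge (h : IsAdmissible p₀ f c δ η γ D T)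
    {σ : Fin 2 → MixedStrategy X} (hσ : σ ∈ coolOffProfiles f T (1 - γ ^ 2))
    (hnash : IsNash p₀ f c δ σ) (i : Fin 2) {β : ℝ} (hβ : 0 < β)
    (hfail : failureBound f p₀ c η γ D 0 (T 1) ≤ β / 8) (haff : affinity f ^ (T 1 + 1) ≤ β / 16)
    (hδ : 1 - β / 8 ≤ δ ^ (T 1 + 1)) :
    p₀ * (1 - c) - β ≤ payoff p₀ f c δ σ i := by
  classical
  have h0 := h.discount_pos
  have h1 := h.discount_lt
  have hc := h.cost
  -- The mass estimate for the first phase is uniform in its length, so a horizon can be chosen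
  -- beyond which payoffs are negligible.
  obtain ⟨N, hN, hNβ⟩ : ∃ N, T 1 < N ∧ δ ^ (N + 1) * 2 ≤ min (β / 8) 1 := by
    have hpos : 0 < min (β / 8) 1 / 2 := by positivity
    obtain ⟨n, hn⟩ := exists_pow_lt_of_lt_one hpos h1
    refine ⟨max n (T 1 + 1), by omega, ?_⟩
    have : δ ^ (max n (T 1 + 1) + 1) ≤ δ ^ n := pow_le_pow_of_le_one h0.le h1.le (by omega)
    linarith
  have hdev := hnash i (diracStrategy (cautious T f))
  rw [payoff_update_dirac f h.prior hc h0 h1] at hdev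
  refine le_trans ?_ hdev
  have hae : ∀ᵐ t ∂(σ (opp i) : Measure (PureStrategy X)),
      p₀ * (1 - c) - β ≤ exAnteValue p₀ f c δ i (pair i (cautious T f) t) := by
    filter_upwards [ae_isBestResponse_of_isNash h.prior hc h0 h1 hnash (opp i),
      ae_mem_pureCoolOff (hσ (opp i)).1] with t htb htc
    have hi : σ (opp (opp i)) ∈ coolOffStrategies f T (1 - γ ^ 2) (opp (opp i)) := by
      rw [opp_opp]
      exact hσ i
    have hmass := h.firstPhase_mass htc hi htb hN
    have hH := pureValue_cautious_H_ge (f := f) (i := i) hc h0 h1 hN hmass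
      (hNβ.trans (min_le_right _ _))
    have hL := pureValue_cautious_L_ge (f := f) (i := i) (T := T) (t := t) hc h0 h1
    have hN' := hNβ.trans (min_le_left _ _)
    have hp0 := h.prior.1
    have hp1 := h.prior.2
    -- The losses are at most β/8 from the delay, β/8 from the horizon and 2(β/16 + β/8) from
    -- misleading signals and failures of the opponent.
    have hH' : 1 - c - β * (3 / 4) ≤ pureValue f c δ State.H i (pair i (cautious T f) t) := by
      have e1 : (1 - β / 8) * (1 - c) ≤ δ ^ (T 1 + 1) * (1 - c) :=
        mul_le_mul_of_nonneg_right hδ (by linarith [hc.2])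
      nlinarith [hc.1]
    have hL' : -(β / 16) ≤ pureValue f c δ State.L i (pair i (cautious T f) t) := by linarith
    rw [exAnteValue]
    have e1 := mul_le_mul_of_nonneg_left hH' hp0.le
    have e2 := mul_le_mul_of_nonneg_left hL' (show 0 ≤ 1 - p₀ by linarith)
    nlinarith
  calc p₀ * (1 - c) - β = ∫ _t, (p₀ * (1 - c) - β)
        ∂(σ (opp i) : Measure (PureStrategy X)) := by simp
    _ ≤ _ := integral_mono_ae (integrable_const _) (integrable_of_continuous
        ((continuous_exAnteValue p₀ f hc h0 h1 i).comp (continuous_pair_right i _))) hae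

omit [MeasurableSpace X] [MeasurableSingletonClass X] in
theorem tendsto_failureBound (f : State → PMF X) (hρ : affinity f < 1) (p₀ c η γ D : ℝ) (b : ℕ) :
    Filter.Tendsto (failureBound f p₀ c η γ D b) Filter.atTop (nhds 0) := by
  have := ((tendsto_pow_atTop_nhds_zero_of_lt_one (affinity_nonneg f) hρ).const_mul
    (beliefBound p₀ c η γ * D ^ (b + 1) * D ^ b)).div_const (1 - affinity f / γ)
  rw [mul_zero, zero_div] at this
  exact this

end Efficiency

end InvestmentGame

/-! ### Choice of the parameters and conclusion. -/

theorem mainTheorem2 {X : Type*} [Fintype X] [MeasurableSpace X] [MeasurableSingletonClass X]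
    (f : State → PMF X) (hf_pos : ∀ θ x, 0 < f θ x) (hf_ne : f State.H ≠ f State.L)
    (p₀ : ℝ) (hp₀ : p₀ ∈ Set.Ioo (0 : ℝ) 1) (c : ℝ) (hc : c ∈ Set.Ioo (0 : ℝ) 1)
    (Δ : ℝ) (hΔ : 0 < Δ) :
    ∃ δbar ∈ Set.Ioo (0 : ℝ) 1, ∀ δ : ℝ, δbar ≤ δ → δ < 1 →
      ∃ (T : ℕ → ℕ) (ε : ℝ), 0 < ε ∧
        (∃ σ ∈ coolOffProfiles f T ε, IsNash p₀ f c δ σ) ∧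
        ∀ σ ∈ coolOffProfiles f T ε, IsNash p₀ f c δ σ →
          ∀ i : Fin 2, 1 - c - Δ ≤ payoffInState f c δ σ State.H i ∧
            -Δ ≤ payoffInState f c δ σ State.L i := by
  have hρ := affinity_lt_one hf_ne
  obtain ⟨D, hD1, hD⟩ := exists_ratio_bound hf_pos
  -- γ > √c makes joint investment profitable at the guaranteed probability γ²; γ > ρ makes the
  -- failure series converge.
  obtain ⟨γ, hγ, hγ1⟩ : ∃ γ, max (affinity f) (√c) < γ ∧ γ < 1 := by
    refine exists_between (max_lt hρ ?_)
    rw [Real.sqrt_lt' one_pos, one_pow]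
    exact hc.2
  obtain ⟨hγρ, hγc⟩ := max_lt_iff.1 hγ
  have hγ0 : 0 < γ := (Real.sqrt_nonneg c).trans_lt hγc
  have hγ2 : c < γ ^ 2 := (Real.sqrt_lt' hγ0).1 hγc
  have hε : 0 < 1 - γ ^ 2 := by
    have := pow_lt_one₀ hγ0.le hγ1 two_ne_zero
    linarith
  obtain ⟨η, hη0, hη⟩ : ∃ η, 0 < η ∧ η < γ ^ 2 - c := exists_between (by linarith)
  -- An ex-ante loss of β costs at most Δ in either state once it is divided by the prior.
  let β : ℝ := Δ * min p₀ (1 - p₀)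
  have hmin : 0 < min p₀ (1 - p₀) := lt_min hp₀.1 (by linarith [hp₀.2])
  have hβ : 0 < β := mul_pos hΔ hmin
  -- The first cool-off length is chosen before δ. Both b = 0 and b = 1 lead to T(1) through `max b
  -- 1`.
  obtain ⟨T₁, hT0, hT1, hTa⟩ : ∃ T₁ : ℕ,
      failureBound f p₀ c η γ D 0 T₁ ≤ min (1 - γ ^ 2) (β / 8) ∧
      failureBound f p₀ c η γ D 1 T₁ ≤ 1 - γ ^ 2 ∧ affinity f ^ (T₁ + 1) ≤ β / 16 := by
    have e1 := (tendsto_failureBound f hρ p₀ c η γ D 0).eventually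
      (ge_mem_nhds (show 0 < min (1 - γ ^ 2) (β / 8) from lt_min hε (by positivity)))
    have e2 := (tendsto_failureBound f hρ p₀ c η γ D 1).eventually (ge_mem_nhds hε)
    have e3 := ((Filter.tendsto_add_atTop_iff_nat 1).2
      (tendsto_pow_atTop_nhds_zero_of_lt_one (affinity_nonneg f) hρ)).eventually
      (ge_mem_nhds (show 0 < β / 16 by positivity))
    obtain ⟨T₁, h1, h2, h3⟩ := (e1.and (e2.and e3)).exists
    exact ⟨T₁, h1, h2, h3⟩
  -- By Bernoulli's inequality this threshold gives δ^(T₁+1) ≥ 1 - β/8; the 1/2 keeps δ positive.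
  refine ⟨max (1 / 2) (1 - β / (8 * (T₁ + 1))), ⟨by positivity, max_lt (by norm_num) ?_⟩,
    fun δ hδ hδ1 => ?_⟩
  · have : 0 < β / (8 * ((T₁ : ℝ) + 1)) := by positivity
    linarith
  obtain ⟨hδa, hδb⟩ := max_le_iff.1 hδ
  have hδ0 : 0 < δ := by linarith
  have hδpow : 1 - β / 8 ≤ δ ^ (T₁ + 1) := by
    have h1 := one_add_mul_le_pow (show -2 ≤ δ - 1 by linarith) (T₁ + 1)
    rw [add_sub_cancel] at h1
    refine le_trans ?_ h1
    have h2 : ((T₁ : ℝ) + 1) * (β / (8 * ((T₁ : ℝ) + 1))) = β / 8 := by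
      field_simp
    have h3 : ((T₁ : ℝ) + 1) * (1 - δ) ≤ ((T₁ : ℝ) + 1) * (β / (8 * ((T₁ : ℝ) + 1))) :=
      mul_le_mul_of_nonneg_left (by linarith) (by positivity)
    push_cast
    linarith
  -- Later cool-off lengths may depend on δ and on the date: they must outweigh D^(2b+1) and also
  -- punish sufficiently.
  have hlate : ∀ b : ℕ, ∃ l : ℕ, failureBound f p₀ c η γ D b l ≤ 1 - γ ^ 2 ∧
      δ ^ (l + 1) ≤ η * (1 - δ) := by
    intro b
    have e2 := (tendsto_failureBound f hρ p₀ c η γ D b).eventually (ge_mem_nhds hε)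
    have e3 := ((Filter.tendsto_add_atTop_iff_nat 1).2
      (tendsto_pow_atTop_nhds_zero_of_lt_one hδ0.le hδ1)).eventually
      (ge_mem_nhds (show 0 < η * (1 - δ) from mul_pos hη0 (by linarith)))
    exact (e2.and e3).exists
  choose late hlate1 hlate2 using hlate
  let T : ℕ → ℕ := fun s => if s ≤ 1 then T₁ else late s
  have hT1eq : T 1 = T₁ := if_pos le_rfl
  have hadm : IsAdmissible p₀ f c δ η γ D T :=
    { pos := hf_pos
      prior := hp₀
      cost := hc
      discount_pos := hδ0
      discount_lt := hδ1
      eta_pos := hη0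
      gamma_pos := hγ0
      gamma_lt := hγ1
      margin := by linarith
      affinity_lt_one := hρ
      affinity_lt := hγρ
      one_le := hD1
      ratio := hD
      punishment := fun n hn => by
        have : T (n + 1) = late (n + 1) := if_neg (by omega)
        rw [this]
        exact hlate2 _
      failure := fun b => by
        rcases Nat.lt_or_ge b 2 with hb | hb
        · have : T (max b 1) = T₁ := if_pos (by omega)
          rw [this]
          interval_cases b
          · exact hT0.trans (min_le_left _ _)
          · exact hT1
        · have : T (max b 1) = late b := by
            rw [max_eq_left (by omega)]
            exact if_neg (by omega)
          rw [this]
          exact hlate1 b }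
  refine ⟨T, 1 - γ ^ 2, hε, hadm.exists_nash, fun σ hσ hnash i => ?_⟩
  have hpay := hadm.payoff_ge hσ hnash i hβ (by rw [hT1eq]; exact hT0.trans (min_le_right _ _))
    (by rw [hT1eq]; exact hTa) (by rw [hT1eq]; exact hδpow)
  obtain ⟨hUH, hUL⟩ := payoffInState_le (f := f) hc hδ0 hδ1 σ i
  rw [payoff_eq f hc hδ0 hδ1 hp₀] at hpay
  have hp0 := hp₀.1
  have hp1 : 0 < 1 - p₀ := by linarith [hp₀.2]
  have hb1 : β ≤ p₀ * Δ := by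
    rw [mul_comm p₀]
    exact mul_le_mul_of_nonneg_left (min_le_left _ _) hΔ.le
  have hb2 : β ≤ (1 - p₀) * Δ := by
    rw [mul_comm (1 - p₀)]
    exact mul_le_mul_of_nonneg_left (min_le_right _ _) hΔ.le
  constructor
  · refine le_of_mul_le_mul_left ?_ hp0
    have := mul_le_mul_of_nonneg_left hUL hp1.le
    linarith
  · refine le_of_mul_le_mul_left ?_ hp1
    have := mul_le_mul_of_nonneg_left hUH hp0.le
    linarith
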